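/- **Setting.** All manifolds are smooth, finite dimensional, Hausdorff and second countable. Let $G$ be a real Lie group whose Lie algebra $\mathfrak g$ is simple and endowed with a $|1|$-grading $\mathfrak g=\mathfrak g_{-1}\oplus\mathfrak g_0\oplus\mathfrak g_1$ with $\mathfrak g_{-1}\neq 0$, i.e. $[\mathfrak g_i,\mathfrak g_j]\subset\mathfrak g_{i+j}$, where $\mathfrak g_\ell=0$ for $|\ell|>1$. Put $\mathfrak p=\mathfrak g_0\oplus\mathfrak g_1$ and $n=\dim(\mathfrak g/\mathfrak p)$, and let $P\subset G$ be a subgroup lying between the normalizer $\{g\in G:\mathrm{Ad}(g)(\mathfrak p)\subset\mathfrak p\}$ and its connected component of the identity; $(G,P)$ is called an *AHS-pair*. Let $G_0=\{g\in P:\mathrm{Ad}(g)(\mathfrak g_i)\subset\mathfrak g_i\ \forall i\}$ and let $P_+\subset P$ be the subgroup $\exp(\mathfrak g_1)$, so that $P/P_+\cong G_0$. The closed subgroups $P$ and $G_0$ carry their structures of embedded Lie subgroups. Let $\underline{\mathrm{Ad}}$ denote the representation of $P$ (and of $G_0\subset P$) on $\mathfrak g/\mathfrak p$ induced by the adjoint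 representation. Let $M$ be a manifold with an involutive distribution $F\subset TM$ of rank $n$. For a principal bundle $p:\mathcal G\to M$ put $\widetilde F_u=(T_up)^{-1}(F_{p(u)})\subset T_u\mathcal G$, which defines a distribution $\widetilde F\subset T\mathcal G$. A *partial Cartan geometry* of type $(G,P)$ on $(M,F)$ is a principal $P$-bundle $p:\mathcal G\to M$ with a smooth section $\omega\in\Gamma(L(\widetilde F,\mathfrak g))$ such that $(r^g)^*\omega=\mathrm{Ad}(g^{-1})\circ\omega$ for all $g\in P$, $\omega(\zeta_A)=A$ for the fundamental vector field $\zeta_A$ generated by $A\in\mathfrak p$, and each $\omega(u):\widetilde F_u\to\mathfrak g$ is a linear isomorphism. A *morphism* of partial Cartan geometries from $(\mathcal G^1\to M^1,\omega^1)$ over $F^1$ to $(\mathcal G^2\to M^2,\omega^2)$ over $F^2$ is a principal bundle homomorphism $\Phi:\mathcal G^1\to\mathcal G^2$ whose base map $\varphi$ satisfies $T_x\varphi(F^1_x)\subset F^2_{\varphi(x)}$ for all $x$ and such that $\Phi^*\omega^2=\omega^1$. A *partial $G_0$-structure* on $(M,F)$ is given by a principal $G_0$-bundle $p_0:\mathcal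 G_0\to M$ with a smooth fiber bundle morphism $j:\mathcal G_0\to GL(\mathfrak g/\mathfrak p,F)$ over $\mathrm{id}_M$ to the frame bundle of $F$, where $\underline{\mathrm{Ad}}$ makes $G_0$ a covering of a closed subgroup of $GL(\mathfrak g/\mathfrak p)\cong GL(n,\mathbb R)$ and $j(u\cdot g)=j(u)\circ\underline{\mathrm{Ad}}(g)$. A *morphism* of partial $G_0$-structures is a principal bundle homomorphism $\Psi:\mathcal G_0^1\to\mathcal G_0^2$ whose base map $\psi$ has the property that each $T_x\psi$ restricts to a linear isomorphism $F^1_x\to F^2_{\psi(x)}$, and such that $j^2(\Psi(u))=T_{p_0^1(u)}\psi\circ j^1(u)$ for all $u\in\mathcal G^1_0$. **Proposition 2.5.** (1) Let $(p:\mathcal G\to M,\omega)$ be a partial Cartan geometry of type $(G,P)$ on $(M,F)$. Then the quotient $\mathcal G_0:=\mathcal G/P_+$, with the quotient topology, is Hausdorff and second countable and carries a smooth structure for which the projection $q:\mathcal G\to\mathcal G_0$ is a surjective submersion, together with the structure of a principal $G_0$-bundle $p_0:\mathcal G_0\to M$ such that $p_0\circ q=p$ and $q(u\cdot g)=q(u)\cdot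 g$ for $u\in\mathcal G$ and $g\in G_0\subset P$. Let $\widehat F\subset T\mathcal G_0$ be the preimage of $F$ under $Tp_0$. Then $\omega$ descends to a smooth section $\theta\in\Gamma(L(\widehat F,\mathfrak g/\mathfrak p))$, i.e. $\theta(q(u))(T_uq(\xi))=\omega(u)(\xi)+\mathfrak p$ for $u\in\mathcal G$ and $\xi\in\widetilde F_u$. This $\theta$ is strictly horizontal, i.e. $\ker\theta(u)=\ker T_up_0$ for each $u\in\mathcal G_0$, and equivariant, i.e. $(r^g)^*\theta=\underline{\mathrm{Ad}}(g^{-1})\circ\theta$ for $g\in G_0$. It makes $\mathcal G_0$ into a partial $G_0$-structure over $(M,F)$, whose morphism $j$ to the frame bundle is determined by $j(u)(\theta(u)(\xi))=T_up_0(\xi)$ for $\xi\in\widehat F_u$. (2) The construction is functorial. If $\Phi$ is a morphism with base map $\varphi$ between partial Cartan geometries $(\mathcal G^i\to M^i,\omega^i)$ of type $(G,P)$ on $(M^i,F^i)$, $i=1,2$, and $q_i:\mathcal G^i\to\mathcal G^i_0$, $\theta^i$ are as in (1), then there is a unique map $\Psi:\mathcal G_0^1\to\mathcal G_0^2$ with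 $\Psi\circ q_1=q_2\circ\Phi$ that is a morphism of the underlying partial $G_0$-structures with base map $\varphi$ and satisfies $\Psi^*\theta^2=\theta^1$. -/

import Mathlib

open scoped Manifold ContDiff
open Bundle

noncomputable section

namespace PartialCartan

/-! ### The adjoint representation and one-parameter subgroups of a Lie group -/

/-- A smooth Lie group has the differentiability that is needed for the bracket on its
tangent space at the identity. -/
instance instLEInftyMinSmoothnessReal : ENat.LEInfty (minSmoothness ℝ 3) :=
  ⟨by rw [minSmoothness_of_isRCLikeNormedField]; exact ENat.LEInfty.out⟩

section LieGroups

variable (E : Type*) [NormedAddCommGroup E] [NormedSpace ℝ E]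
  (G : Type*) [TopologicalSpace G] [ChartedSpace E G] [Group G]

/-- The Lie algebra of the Lie group `G`, i.e. its tangent space at the identity. -/
abbrev LieAlg : Type _ := GroupLieAlgebra 𝓘(ℝ, E) G

variable {E G}

/-- The derivative at `1` of the conjugation `x ↦ g * x * g⁻¹`. -/
def adMap (g : G) : LieAlg E G →L[ℝ] LieAlg E G :=
  mfderiv 𝓘(ℝ, E) 𝓘(ℝ, E) (fun x : G => g * x * g⁻¹) 1

/-- The set `exp(S)` for a set `S` of elements of the Lie algebra: the values at time `1` of the
smooth one-parameter subgroups whose initial velocity lies in `S`. -/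
def expImage (S : Set (LieAlg E G)) : Set G :=
  {g | ∃ X ∈ S, ∃ γ : ℝ → G, ContMDiff 𝓘(ℝ, ℝ) 𝓘(ℝ, E) ∞ γ ∧
    (∀ s t, γ (s + t) = γ s * γ t) ∧
    (tangentMap 𝓘(ℝ, ℝ) 𝓘(ℝ, E) γ ⟨0, (1 : ℝ)⟩ : TangentBundle 𝓘(ℝ, E) G) = ⟨1, X⟩ ∧
    γ 1 = g}

theorem adMap_one : adMap (E := E) (1 : G) = ContinuousLinearMap.id ℝ _ := by
  have h : (fun x : G => 1 * x * 1⁻¹) = id := by ext x; simp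
  unfold adMap
  rw [h]
  exact mfderiv_id

variable [LieGroup 𝓘(ℝ, E) ∞ G]

theorem contMDiff_conj (g : G) :
    ContMDiff 𝓘(ℝ, E) 𝓘(ℝ, E) ∞ (fun x : G => g * x * g⁻¹) :=
  (contMDiff_const.mul contMDiff_id).mul contMDiff_const

theorem hasMFDerivAt_conj (g : G) {x : G} (hx : x = 1) :
    HasMFDerivAt 𝓘(ℝ, E) 𝓘(ℝ, E) (fun x : G => g * x * g⁻¹) x (adMap (E := E) g) := by
  subst hx
  exact ((contMDiff_conj g).mdifferentiable (by simp) 1).hasMFDerivAt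

theorem adMap_mul (g h : G) :
    adMap (E := E) (g * h) = (adMap (E := E) g).comp (adMap (E := E) h) := by
  have h1 := hasMFDerivAt_conj (E := E) h (rfl : (1 : G) = 1)
  have h2 := hasMFDerivAt_conj (E := E) g (x := h * 1 * h⁻¹) (by simp)
  have h3 := HasMFDerivAt.comp (1 : G) h2 h1
  have e : (fun x : G => g * x * g⁻¹) ∘ (fun x : G => h * x * h⁻¹)
      = fun x : G => (g * h) * x * (g * h)⁻¹ := by
    ext x; simp [mul_assoc]
  rw [e] at h3
  exact h3.mfderiv

variable (E G) in
/-- The adjoint representation `Ad` of a Lie group on its Lie algebra. -/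
def Ad : Representation ℝ G (LieAlg E G) where
  toFun g := (adMap (E := E) g).toLinearMap
  map_one' := by rw [adMap_one]; rfl
  map_mul' g h := by rw [adMap_mul]; rfl

end LieGroups

/-! ### AHS-pairs -/

/-- A `|1|`-grading of a real Lie algebra: a decomposition into the direct sum of
`comp (-1)`, `comp 0` and `comp 1` (the other components vanish) which is compatible with the
bracket and does not reduce to `comp 0`. -/
structure OneGrading (L : Type*) [LieRing L] [LieAlgebra ℝ L] where
  comp : ℤ → Submodule ℝ L
  comp_eq_bot : ∀ i, 1 < |i| → comp i = ⊥
  isInternal : DirectSum.IsInternal comp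
  lie_mem : ∀ i j, ∀ X ∈ comp i, ∀ Y ∈ comp j, ⁅X, Y⁆ ∈ comp (i + j)
  nontrivial : comp (-1) ≠ ⊥

/-- The subalgebra `𝔭 = 𝔤₀ ⊕ 𝔤₁` of a `|1|`-graded Lie algebra. -/
def OneGrading.parabolic {L : Type*} [LieRing L] [LieAlgebra ℝ L] (gr : OneGrading L) :
    Submodule ℝ L :=
  gr.comp 0 ⊔ gr.comp 1

section AHS

variable (E : Type*) [NormedAddCommGroup E] [NormedSpace ℝ E] [FiniteDimensional ℝ E]
  (G : Type*) [TopologicalSpace G] [ChartedSpace E G] [Group G] [LieGroup 𝓘(ℝ, E) ∞ G]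

variable {E G} in
/-- The normalizer `{g ∈ G : Ad(g)(𝔭) ⊆ 𝔭}` of a subspace `𝔭` of the Lie algebra of `G`. -/
def adNormalizer (p : Submodule ℝ (LieAlg E G)) : Set G :=
  {g | ∀ X ∈ p, Ad E G g X ∈ p}

/-- An AHS-pair `(G, P)`: the Lie algebra of `G` is simple and endowed with a `|1|`-grading, and
the subgroup `P` lies between the normalizer of `𝔭 = 𝔤₀ ⊕ 𝔤₁` in `G` and the connected
component of the identity of this normalizer. -/
structure AHSPair where
  simple : LieAlgebra.IsSimple ℝ (LieAlg E G)
  grading : OneGrading (LieAlg E G)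
  P : Subgroup G
  P_subset_normalizer : (P : Set G) ⊆ adNormalizer grading.parabolic
  component_subset_P : connectedComponentIn (adNormalizer grading.parabolic) 1 ⊆ (P : Set G)

namespace AHSPair

variable {E G} (A : AHSPair E G)

/-- The subalgebra `𝔭` of `𝔤`. -/
abbrev p : Submodule ℝ (LieAlg E G) := A.grading.parabolic

/-- The representation `\underline{Ad}` of `P` on `𝔤 / 𝔭` induced by the adjoint
representation. -/
def adQuot : Representation ℝ A.P (LieAlg E G ⧸ A.p) :=
  Representation.quotient ((Ad E G).comp A.P.subtype) A.p
    (fun g X hX => A.P_subset_normalizer g.2 X hX)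

/-- The subgroup `G₀ = {g ∈ P : Ad(g)(𝔤ᵢ) ⊆ 𝔤ᵢ for all i}` of `P`. -/
def G₀ : Subgroup A.P where
  carrier := {g | ∀ i, ∀ X ∈ A.grading.comp i, Ad E G g X ∈ A.grading.comp i}
  one_mem' := by
    intro i X hX
    simpa using hX
  mul_mem' := by
    intro g h hg hh i X hX
    simpa using hg i _ (hh i X hX)
  inv_mem' := by
    intro g hg i X hX
    have : FiniteDimensional ℝ (LieAlg E G) := inferInstanceAs (FiniteDimensional ℝ E)
    have hinv : ∀ Y, Ad E G ((g : G)⁻¹) (Ad E G g Y) = Y := fun Y => by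
      rw [← Module.End.mul_apply, ← map_mul]; simp
    let f : A.grading.comp i →ₗ[ℝ] A.grading.comp i := (Ad E G g).restrict (hg i)
    have hf : Function.Injective f := by
      intro a b hab
      have h : Ad E G g (a : LieAlg E G) = Ad E G g (b : LieAlg E G) := congrArg Subtype.val hab
      have h' := congrArg (Ad E G ((g : G)⁻¹)) h
      rw [hinv, hinv] at h'
      exact Subtype.ext h' 
    obtain ⟨Y, hY⟩ := LinearMap.surjective_of_injective hf ⟨X, hX⟩
    have hYX : Ad E G g (Y : LieAlg E G) = X := congrArg Subtype.val hY
    rw [← hYX]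
    simp only [InvMemClass.coe_inv, hinv]
    exact Y.2

/-- The representation of `G₀` on `𝔤 / 𝔭`, i.e. the restriction of `\underline{Ad}`. -/
def rep₀ : Representation ℝ A.G₀ (LieAlg E G ⧸ A.p) := A.adQuot.comp A.G₀.subtype

/-- The subgroup `P₊ = exp(𝔤₁)` of `P`, written as the subgroup which is generated by the set
`exp(𝔤₁)`. -/
def Pplus : Subgroup A.P :=
  (Subgroup.closure (expImage (A.grading.comp 1 : Set (LieAlg E G)))).subgroupOf A.P

end AHSPair

end AHS

/-! ### Distributions and partially defined forms -/

section Distributions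

variable (EM : Type*) [NormedAddCommGroup EM] [NormedSpace ℝ EM]
  (M : Type*) [TopologicalSpace M] [ChartedSpace EM M]

/-- A field of subspaces of the tangent spaces of a manifold. -/
abbrev SubspaceField : Type _ := ∀ x : M, Submodule ℝ (TangentSpace 𝓘(ℝ, EM) x)

variable {EM M} in
/-- The preimage of a field of subspaces `F` under the tangent maps of `f : Q → M`. If `f` is the
projection of a fiber bundle, this is the distribution on the total space determined by `F`. -/
def SubspaceField.lift (F : SubspaceField EM M)
    {EQ : Type*} [NormedAddCommGroup EQ] [NormedSpace ℝ EQ]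
    {Q : Type*} [TopologicalSpace Q] [ChartedSpace EQ Q] (f : Q → M) : SubspaceField EQ Q :=
  fun u => (F (f u)).comap (mfderiv 𝓘(ℝ, EQ) 𝓘(ℝ, EM) f u).toLinearMap

variable [IsManifold 𝓘(ℝ, EM) ∞ M]

variable {EM M} in
/-- Smoothness of a vector field on a subset `U` of a manifold. -/
def SmoothFieldOn (X : ∀ x : M, TangentSpace 𝓘(ℝ, EM) x) (U : Set M) : Prop :=
  ContMDiffOn 𝓘(ℝ, EM) (𝓘(ℝ, EM)).tangent ∞
    (fun x => (⟨x, X x⟩ : TangentBundle 𝓘(ℝ, EM) M)) U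

/-- An involutive distribution `F ⊆ TM` of rank `n` on a manifold `M`. -/
structure InvolutiveDistribution (n : ℕ) where
  toField : SubspaceField EM M
  exists_frame : ∀ x, ∃ U : Set M, IsOpen U ∧ x ∈ U ∧
    ∃ X : Fin n → ∀ y : M, TangentSpace 𝓘(ℝ, EM) y,
      (∀ i, SmoothFieldOn (X i) U) ∧
      ∀ y ∈ U, LinearIndependent ℝ (fun i => X i y) ∧
        Submodule.span ℝ (Set.range fun i => X i y) = toField y
  involutive : ∀ U : Set M, IsOpen U → ∀ X Y : ∀ y : M, TangentSpace 𝓘(ℝ, EM) y,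
    SmoothFieldOn X U → SmoothFieldOn Y U →
    (∀ y ∈ U, X y ∈ toField y) → (∀ y ∈ U, Y y ∈ toField y) →
    ∀ y ∈ U, VectorField.mlieBracket 𝓘(ℝ, EM) X Y y ∈ toField y

variable {EM M}

/-- A smooth section of the bundle `L(D, V)`, i.e. a partially defined `V`-valued one-form: a
family of linear maps `D u → V` which sends smooth local sections of `D` to smooth functions. A
function into the finite dimensional vector space `V` is smooth if its compositions with all linear
functionals are smooth. -/
structure PartialForm (D : SubspaceField EM M) (V : Type*) [AddCommGroup V] [Module ℝ V] where
  toFun : ∀ u, D u →ₗ[ℝ] V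
  smooth : ∀ U : Set M, IsOpen U → ∀ ξ : (∀ u, D u), SmoothFieldOn (fun u => (ξ u).1) U →
    ∀ l : V →ₗ[ℝ] ℝ, ContMDiffOn 𝓘(ℝ, EM) 𝓘(ℝ, ℝ) ∞ (fun u => l (toFun u (ξ u))) U

end Distributions

/-! ### Principal bundles -/

section Principal

variable (EM : Type*) [NormedAddCommGroup EM] [NormedSpace ℝ EM]
  (M : Type*) [TopologicalSpace M] [ChartedSpace EM M]
  (EH : Type*) [NormedAddCommGroup EH] [NormedSpace ℝ EH]
  (H : Type*) [TopologicalSpace H] [ChartedSpace EH H] [Group H]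
  (EQ : Type*) [NormedAddCommGroup EQ] [NormedSpace ℝ EQ]
  (Q : Type*) [TopologicalSpace Q] [ChartedSpace EQ Q]

/-- A smooth principal fiber bundle with total space `Q`, base `M` and structure group `H`. -/
structure PrincipalBundle where
  proj : Q → M
  /-- the principal right action -/
  act : Q → H → Q
  act_one : ∀ u, act u 1 = u
  act_mul : ∀ u g h, act u (g * h) = act (act u g) h
  proj_act : ∀ u g, proj (act u g) = proj u
  smooth_proj : ContMDiff 𝓘(ℝ, EQ) 𝓘(ℝ, EM) ∞ proj
  smooth_act : ContMDiff (𝓘(ℝ, EQ).prod 𝓘(ℝ, EH)) 𝓘(ℝ, EQ) ∞ (fun z : Q × H => act z.1 z.2)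
  exists_trivialization : ∀ x, ∃ e : Trivialization H proj, x ∈ e.baseSet ∧
    ContMDiffOn 𝓘(ℝ, EQ) (𝓘(ℝ, EM).prod 𝓘(ℝ, EH)) ∞ e e.source ∧
    ContMDiffOn (𝓘(ℝ, EM).prod 𝓘(ℝ, EH)) 𝓘(ℝ, EQ) ∞ e.toOpenPartialHomeomorph.symm e.target ∧
    ∀ u ∈ e.source, ∀ g, e (act u g) = ((e u).1, (e u).2 * g)

variable {EM M EH H EQ Q}

namespace PrincipalBundle

variable (B : PrincipalBundle EM M EH H EQ Q)

/-- The tangent map of the principal right action by `g`. -/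
def tangentAct (g : H) (u : Q) :
    TangentSpace 𝓘(ℝ, EQ) u →L[ℝ] TangentSpace 𝓘(ℝ, EQ) (B.act u g) :=
  mfderiv 𝓘(ℝ, EQ) 𝓘(ℝ, EQ) (fun v => B.act v g) u

/-- The value in `u` of the fundamental vector field generated by an element `a` of the Lie algebra
of the structure group, i.e. the derivative of `g ↦ u · g` at `g = 1` in direction `a`. -/
def fundamental (a : LieAlg EH H) (u : Q) : TangentSpace 𝓘(ℝ, EQ) u :=
  (mfderiv 𝓘(ℝ, EH) 𝓘(ℝ, EQ) (fun g : H => B.act u g) 1 a : TangentSpace 𝓘(ℝ, EQ) (B.act u 1))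

variable [IsManifold 𝓘(ℝ, EQ) ∞ Q] {V : Type*} [AddCommGroup V] [Module ℝ V] {F : SubspaceField EM M}

/-- Equivariance of a partial form `θ` for a representation `ρ` of the structure group:
`(r^g)^* θ = ρ(g⁻¹) ∘ θ`. -/
def Equivariant (ρ : Representation ℝ H V) (θ : PartialForm (F.lift (EQ := EQ) B.proj) V) : Prop :=
  ∀ (g : H) (u : Q) (ξ : F.lift (EQ := EQ) B.proj u),
    ∃ h : B.tangentAct g u ξ.1 ∈ F.lift (EQ := EQ) B.proj (B.act u g),
      θ.toFun (B.act u g) ⟨B.tangentAct g u ξ.1, h⟩ = ρ g⁻¹ (θ.toFun u ξ)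

/-- Strict horizontality of a partial form: the kernel in each point is the vertical subspace. -/
def StrictlyHorizontal (θ : PartialForm (F.lift (EQ := EQ) B.proj) V) : Prop :=
  ∀ (u : Q) (ξ : F.lift (EQ := EQ) B.proj u),
    θ.toFun u ξ = 0 ↔ mfderiv 𝓘(ℝ, EQ) 𝓘(ℝ, EM) B.proj u ξ.1 = 0

end PrincipalBundle

end Principal

/-- For manifolds `Q₁`, `Q₂` with partial forms `α₁`, `α₂`, the pullback of `α₂` along `Φ` is
well defined and coincides with `α₁`: the tangent maps of `Φ` send the domain
of `α₁` to the domain of `α₂`, and `α₂(Φ(u))(T_uΦ(ξ)) = α₁(u)(ξ)`. -/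
def PullsBackTo {EQ₁ : Type*} [NormedAddCommGroup EQ₁] [NormedSpace ℝ EQ₁]
    {Q₁ : Type*} [TopologicalSpace Q₁] [ChartedSpace EQ₁ Q₁]
    {EQ₂ : Type*} [NormedAddCommGroup EQ₂] [NormedSpace ℝ EQ₂]
    {Q₂ : Type*} [TopologicalSpace Q₂] [ChartedSpace EQ₂ Q₂]
    {V : Type*} [AddCommGroup V] [Module ℝ V]
    {D₁ : SubspaceField EQ₁ Q₁} {D₂ : SubspaceField EQ₂ Q₂}
    (Φ : Q₁ → Q₂) (α₂ : ∀ u, D₂ u →ₗ[ℝ] V) (α₁ : ∀ u, D₁ u →ₗ[ℝ] V) : Prop :=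
  ∀ (u : Q₁) (ξ : D₁ u),
    ∃ h : mfderiv 𝓘(ℝ, EQ₁) 𝓘(ℝ, EQ₂) Φ u ξ.1 ∈ D₂ (Φ u),
      α₂ (Φ u) ⟨mfderiv 𝓘(ℝ, EQ₁) 𝓘(ℝ, EQ₂) Φ u ξ.1, h⟩ = α₁ u ξ

/-- A homomorphism `Φ` of principal bundles with the same structure group, with base map `φ`. -/
structure IsPrincipalHom
    {EM₁ : Type*} [NormedAddCommGroup EM₁] [NormedSpace ℝ EM₁]
    {M₁ : Type*} [TopologicalSpace M₁] [ChartedSpace EM₁ M₁]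
    {EM₂ : Type*} [NormedAddCommGroup EM₂] [NormedSpace ℝ EM₂]
    {M₂ : Type*} [TopologicalSpace M₂] [ChartedSpace EM₂ M₂]
    {EH : Type*} [NormedAddCommGroup EH] [NormedSpace ℝ EH]
    {H : Type*} [TopologicalSpace H] [ChartedSpace EH H] [Group H]
    {EQ₁ : Type*} [NormedAddCommGroup EQ₁] [NormedSpace ℝ EQ₁]
    {Q₁ : Type*} [TopologicalSpace Q₁] [ChartedSpace EQ₁ Q₁]
    {EQ₂ : Type*} [NormedAddCommGroup EQ₂] [NormedSpace ℝ EQ₂]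
    {Q₂ : Type*} [TopologicalSpace Q₂] [ChartedSpace EQ₂ Q₂]
    (B₁ : PrincipalBundle EM₁ M₁ EH H EQ₁ Q₁) (B₂ : PrincipalBundle EM₂ M₂ EH H EQ₂ Q₂)
    (Φ : Q₁ → Q₂) (φ : M₁ → M₂) : Prop where
  smooth : ContMDiff 𝓘(ℝ, EQ₁) 𝓘(ℝ, EQ₂) ∞ Φ
  smooth_base : ContMDiff 𝓘(ℝ, EM₁) 𝓘(ℝ, EM₂) ∞ φ
  proj_comm : ∀ u, B₂.proj (Φ u) = φ (B₁.proj u)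
  act_comm : ∀ u g, Φ (B₁.act u g) = B₂.act (Φ u) g

/-! ### Partial `G₀`-structures -/

section PartialGStructures

/-- The homomorphism `H → GL(n, ℝ)` given by a representation of `H` and a basis of its space. -/
def matrixHom {H : Type*} [Group H] {V : Type*} [AddCommGroup V] [Module ℝ V]
    (ρ : Representation ℝ H V) {n : ℕ} (b : Module.Basis (Fin n) ℝ V) :
    H →* Matrix.GeneralLinearGroup (Fin n) ℝ :=
  (Units.map (LinearMap.toMatrixAlgEquiv b : Module.End ℝ V →* Matrix (Fin n) (Fin n) ℝ)).comp
    (MonoidHom.toHomUnits ρ)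

/-- The representation `ρ : H → GL(V) ≅ GL(n, ℝ)` makes `H` a covering of a closed subgroup
of `GL(n, ℝ)`. -/
def IsCoveringOfClosedSubgroup {H : Type*} [TopologicalSpace H] [Group H]
    {V : Type*} [AddCommGroup V] [Module ℝ V] (ρ : Representation ℝ H V) : Prop :=
  ∀ (n : ℕ) (b : Module.Basis (Fin n) ℝ V),
    IsClosed ((matrixHom ρ b).range : Set (Matrix.GeneralLinearGroup (Fin n) ℝ)) ∧
    IsCoveringMap (matrixHom ρ b).rangeRestrict

/-- A partial `H`-structure on `(M, F)`, where `H` is a covering of a closed subgroup of `GL(V)` via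
the representation `ρ`: a principal `H`-bundle with total space `Q` over `M` and a morphism of
fiber bundles from `Q` to the frame bundle `GL(V, F)` of `F`, which covers the identity and is
equivariant over `ρ`. The morphism sends `u` to the isomorphism `frame u` from `V` to the fiber of
`F` over the base point of `u`. Since the frame bundle is open in the vector bundle
`L(V, F) ⊆ L(V, TM)`, the morphism is smooth if and only if `u ↦ frame u A` is a smooth map to `TM`
for each `A` in `V`. -/
structure PartialGStructure
    {EM : Type*} [NormedAddCommGroup EM] [NormedSpace ℝ EM]
    {M : Type*} [TopologicalSpace M] [ChartedSpace EM M] [IsManifold 𝓘(ℝ, EM) ∞ M]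
    {n : ℕ} (F : InvolutiveDistribution EM M n)
    (EH : Type*) [NormedAddCommGroup EH] [NormedSpace ℝ EH]
    {H : Type*} [TopologicalSpace H] [ChartedSpace EH H] [Group H]
    {V : Type*} [AddCommGroup V] [Module ℝ V] (ρ : Representation ℝ H V)
    (EQ : Type*) [NormedAddCommGroup EQ] [NormedSpace ℝ EQ]
    (Q : Type*) [TopologicalSpace Q] [ChartedSpace EQ Q]
    extends PrincipalBundle EM M EH H EQ Q where
  covering : IsCoveringOfClosedSubgroup ρ
  frame : ∀ u, V ≃ₗ[ℝ] F.toField (proj u)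
  smooth_frame : ∀ A : V, ContMDiff 𝓘(ℝ, EQ) (𝓘(ℝ, EM)).tangent ∞
    (fun u => (⟨proj u, (frame u A).1⟩ : TangentBundle 𝓘(ℝ, EM) M))
  frame_act : ∀ u g A,
    (⟨proj (act u g), (frame (act u g) A).1⟩ : TangentBundle 𝓘(ℝ, EM) M) =
      ⟨proj u, (frame u (ρ g A)).1⟩

variable
    {EM₁ : Type*} [NormedAddCommGroup EM₁] [NormedSpace ℝ EM₁]
    {M₁ : Type*} [TopologicalSpace M₁] [ChartedSpace EM₁ M₁] [IsManifold 𝓘(ℝ, EM₁) ∞ M₁]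
    {EM₂ : Type*} [NormedAddCommGroup EM₂] [NormedSpace ℝ EM₂]
    {M₂ : Type*} [TopologicalSpace M₂] [ChartedSpace EM₂ M₂] [IsManifold 𝓘(ℝ, EM₂) ∞ M₂]
    {n : ℕ} {F₁ : InvolutiveDistribution EM₁ M₁ n} {F₂ : InvolutiveDistribution EM₂ M₂ n}
    {EH : Type*} [NormedAddCommGroup EH] [NormedSpace ℝ EH]
    {H : Type*} [TopologicalSpace H] [ChartedSpace EH H] [Group H]
    {V : Type*} [AddCommGroup V] [Module ℝ V] {ρ : Representation ℝ H V}
    {EQ₁ : Type*} [NormedAddCommGroup EQ₁] [NormedSpace ℝ EQ₁]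
    {Q₁ : Type*} [TopologicalSpace Q₁] [ChartedSpace EQ₁ Q₁]
    {EQ₂ : Type*} [NormedAddCommGroup EQ₂] [NormedSpace ℝ EQ₂]
    {Q₂ : Type*} [TopologicalSpace Q₂] [ChartedSpace EQ₂ Q₂]

/-- A morphism of partial `H`-structures: a principal bundle homomorphism `Ψ` whose base map `ψ` has
tangent maps that restrict to linear isomorphisms between the fibers of the distributions, and which
is compatible with the morphisms to the frame bundles. -/
structure IsGStructureMorphism (S₁ : PartialGStructure F₁ EH ρ EQ₁ Q₁)
    (S₂ : PartialGStructure F₂ EH ρ EQ₂ Q₂) (Ψ : Q₁ → Q₂) (ψ : M₁ → M₂) : Prop where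
  isPrincipalHom : IsPrincipalHom S₁.toPrincipalBundle S₂.toPrincipalBundle Ψ ψ
  base_iso : ∀ x, ∃ e : F₁.toField x ≃ₗ[ℝ] F₂.toField (ψ x),
    ∀ v, (e v : TangentSpace 𝓘(ℝ, EM₂) (ψ x)) = mfderiv 𝓘(ℝ, EM₁) 𝓘(ℝ, EM₂) ψ x v.1
  frame_comm : ∀ u A,
    (⟨S₂.proj (Ψ u), (S₂.frame (Ψ u) A).1⟩ : TangentBundle 𝓘(ℝ, EM₂) M₂) =
      tangentMap 𝓘(ℝ, EM₁) 𝓘(ℝ, EM₂) ψ ⟨S₁.proj u, (S₁.frame u A).1⟩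

end PartialGStructures

/-! ### Partial Cartan geometries -/

section Cartan

variable {E : Type*} [NormedAddCommGroup E] [NormedSpace ℝ E] [FiniteDimensional ℝ E]
  {G : Type*} [TopologicalSpace G] [ChartedSpace E G] [Group G] [LieGroup 𝓘(ℝ, E) ∞ G]
  (A : AHSPair E G)
  (EP : Type*) [NormedAddCommGroup EP] [NormedSpace ℝ EP] [ChartedSpace EP A.P]

/-- A partial Cartan geometry of type `(G, P)` on `(M, F)` for an AHS-pair `(G, P)`: a principal
`P`-bundle with total space `Q` and a partial Cartan connection `conn`. An element of the Lie algebra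
of `P` is viewed as an element of the Lie algebra of `G` via the derivative of the inclusion. -/
structure PartialCartanGeometry
    {EM : Type*} [NormedAddCommGroup EM] [NormedSpace ℝ EM]
    {M : Type*} [TopologicalSpace M] [ChartedSpace EM M] [IsManifold 𝓘(ℝ, EM) ∞ M]
    (F : InvolutiveDistribution EM M (Module.finrank ℝ (LieAlg E G ⧸ A.p)))
    (EQ : Type*) [NormedAddCommGroup EQ] [NormedSpace ℝ EQ]
    (Q : Type*) [TopologicalSpace Q] [ChartedSpace EQ Q]
    [IsManifold 𝓘(ℝ, EQ) ∞ Q]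
    extends PrincipalBundle EM M EP A.P EQ Q where
  conn : PartialForm (F.toField.lift (EQ := EQ) proj) (LieAlg E G)
  equivariant : toPrincipalBundle.Equivariant ((Ad E G).comp A.P.subtype) conn
  reproduces : ∀ (a : LieAlg EP A.P) (u : Q),
    ∃ h : toPrincipalBundle.fundamental a u ∈ F.toField.lift (EQ := EQ) proj u,
      conn.toFun u ⟨toPrincipalBundle.fundamental a u, h⟩ =
        mfderiv 𝓘(ℝ, EP) 𝓘(ℝ, E) (Subtype.val : A.P → G) 1 a
  bijective : ∀ u, Function.Bijective (conn.toFun u)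

variable {A EP}
  {EM : Type*} [NormedAddCommGroup EM] [NormedSpace ℝ EM]
  {M : Type*} [TopologicalSpace M] [ChartedSpace EM M] [IsManifold 𝓘(ℝ, EM) ∞ M]
  {F : InvolutiveDistribution EM M (Module.finrank ℝ (LieAlg E G ⧸ A.p))}
  {EQ : Type*} [NormedAddCommGroup EQ] [NormedSpace ℝ EQ]
  {Q : Type*} [TopologicalSpace Q] [ChartedSpace EQ Q]
    [IsManifold 𝓘(ℝ, EQ) ∞ Q]

namespace PartialCartanGeometry

variable (C : PartialCartanGeometry A EP F EQ Q)

/-- The equivalence relation on `𝒢` whose classes are the orbits of `P₊`. -/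
def orbitSetoid : Setoid Q where
  r u v := ∃ g ∈ A.Pplus, C.act u g = v
  iseqv :=
    { refl := fun u => ⟨1, one_mem _, C.act_one u⟩
      symm := by
        rintro u _ ⟨g, hg, rfl⟩
        exact ⟨g⁻¹, inv_mem hg, by rw [← C.act_mul, mul_inv_cancel, C.act_one]⟩
      trans := by
        rintro u _ _ ⟨g, hg, rfl⟩ ⟨h, hh, rfl⟩
        exact ⟨g * h, mul_mem hg hh, C.act_mul u g h⟩ }

/-- The orbit space `𝒢 / P₊` with the quotient topology. -/
abbrev OrbitSpace : Type _ := Quotient C.orbitSetoid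

/-- The projection `𝒢 → 𝒢 / P₊`. -/
def toOrbitSpace (u : Q) : C.OrbitSpace := Quotient.mk C.orbitSetoid u

/-- The composition of the partial Cartan connection with the projection `𝔤 → 𝔤 / 𝔭`. -/
def projected (u : Q) :
    F.toField.lift (EQ := EQ) C.proj u →ₗ[ℝ] LieAlg E G ⧸ A.p :=
  A.p.mkQ.comp (C.conn.toFun u)

end PartialCartanGeometry

/-- The partial `G₀`-structure `S` with total space `Q₀` and the partial form `θ` on `Q₀` underlie
the partial Cartan geometry `C` via `q : 𝒢 → Q₀`. The first six conditions say that `q` realizes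
the principal `G₀`-bundle `Q₀` as the quotient `𝒢 / P₊` (with `P / P₊ ≅ G₀`), the others
that `ω` descends to the strictly horizontal, equivariant form `θ`, and that `θ` is the form which
corresponds to the morphism of `S` to the frame bundle of `F`. -/
structure IsUnderlying {EP₀ : Type*} [NormedAddCommGroup EP₀] [NormedSpace ℝ EP₀]
    [ChartedSpace EP₀ A.G₀]
    {EQ₀ : Type*} [NormedAddCommGroup EQ₀] [NormedSpace ℝ EQ₀]
    {Q₀ : Type*} [TopologicalSpace Q₀] [ChartedSpace EQ₀ Q₀]
    [IsManifold 𝓘(ℝ, EQ₀) ∞ Q₀]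
    (C : PartialCartanGeometry A EP F EQ Q)
    (S : PartialGStructure F EP₀ A.rep₀ EQ₀ Q₀)
    (θ : PartialForm (F.toField.lift (EQ := EQ₀) S.proj) (LieAlg E G ⧸ A.p))
    (q : Q → Q₀) : Prop where
  smooth : ContMDiff 𝓘(ℝ, EQ) 𝓘(ℝ, EQ₀) ∞ q
  surjective : Function.Surjective q
  submersion : ∀ u, Function.Surjective (mfderiv 𝓘(ℝ, EQ) 𝓘(ℝ, EQ₀) q u)
  fibers : ∀ u v, q u = q v ↔ ∃ g ∈ A.Pplus, C.act u g = v
  proj_comm : ∀ u, S.proj (q u) = C.proj u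
  act_comm : ∀ u (g : A.G₀), q (C.act u g) = S.act (q u) g
  descends : PullsBackTo q θ.toFun C.projected
  strictlyHorizontal : S.toPrincipalBundle.StrictlyHorizontal θ
  equivariant : S.toPrincipalBundle.Equivariant A.rep₀ θ
  frame_comp : ∀ u (ξ : F.toField.lift (EQ := EQ₀) S.proj u),
    ((S.frame u (θ.toFun u ξ)).1 : TangentSpace 𝓘(ℝ, EM) (S.proj u)) =
      mfderiv 𝓘(ℝ, EQ₀) 𝓘(ℝ, EM) S.proj u ξ.1

/-- A morphism of partial Cartan geometries: a principal bundle homomorphism `Φ` whose base map `φ`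
satisfies `T_xφ(F¹_x) ⊆ F²_φ(x)` and such that `Φ^* ω² = ω¹`. -/
structure IsCartanMorphism
    {EM₂ : Type*} [NormedAddCommGroup EM₂] [NormedSpace ℝ EM₂]
    {M₂ : Type*} [TopologicalSpace M₂] [ChartedSpace EM₂ M₂] [IsManifold 𝓘(ℝ, EM₂) ∞ M₂]
    {F₂ : InvolutiveDistribution EM₂ M₂ (Module.finrank ℝ (LieAlg E G ⧸ A.p))}
    {EQ₂ : Type*} [NormedAddCommGroup EQ₂] [NormedSpace ℝ EQ₂]
    {Q₂ : Type*} [TopologicalSpace Q₂] [ChartedSpace EQ₂ Q₂]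
    [IsManifold 𝓘(ℝ, EQ₂) ∞ Q₂]
    (C₁ : PartialCartanGeometry A EP F EQ Q) (C₂ : PartialCartanGeometry A EP F₂ EQ₂ Q₂)
    (Φ : Q → Q₂) (φ : M → M₂) : Prop where
  isPrincipalHom : IsPrincipalHom C₁.toPrincipalBundle C₂.toPrincipalBundle Φ φ
  base_mem : ∀ x, ∀ v ∈ F.toField x,
    mfderiv 𝓘(ℝ, EM) 𝓘(ℝ, EM₂) φ x v ∈ F₂.toField (φ x)
  pullback : PullsBackTo Φ C₂.conn.toFun C₁.conn.toFun

end Cartan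

end PartialCartan

end

/-!
A partial Cartan geometry `𝒢 → M` is pushed down to `𝒢 / P₊` by means of the splitting `P = G₀ ⋉ P₊`.

*The group.* All derivations of the simple Lie algebra `𝔤` are inner, so the grading is given by a grading
element `e` (`OneGrading.elt`), and an automorphism which preserves `𝔭` changes `e` by an element of `𝔤₁`
(`OneGrading.map_elt_sub_mem`). Since `Ad(exp Z)(e) = e - Z` for `Z ∈ 𝔤₁`, multiplying `g ∈ P` from the left
by `exp(Ad(g)(e) - e)` gives an element of `G₀`. This is a homomorphism `AHSPair.levi : P → G₀` with kernel
`P₊` which is the identity on `G₀`, and it is smooth because `exp` is smooth on the commutative subalgebra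
`𝔤₁`. The one-parameter subgroups with velocity in `𝔭` stay in `P`, and `𝔭` is its own normalizer, so `𝔭`
is the Lie algebra of `P` (`AHSPair.range_mfderiv_val`).

*The representation on `𝔤 / 𝔭`.* It makes `G₀` a covering of a closed subgroup
(`AHSPair.isCoveringOfClosedSubgroup_rep₀`). The kernel is discrete: an element which acts trivially on
`𝔤₋₁ ≅ 𝔤 / 𝔭` acts trivially on `𝔤₁`, by duality under the Killing form, hence on `𝔤`, which is generated by
`𝔤₋₁` and `𝔤₁`. In the same way, convergence on `𝔤 / 𝔭` implies convergence on `𝔤`; the limit is an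
automorphism which preserves the grading, and such an automorphism near the image of `P` lies in it, by the
inverse function theorem and since the derivations which preserve `𝔭` come from `𝔭`.

*The quotient.* A smooth homomorphism with a smooth homomorphic section transports the local
trivializations of a principal bundle to its quotient by the kernel
(`IsQuotientBy.exists_principalBundle`). The projection to the quotient has local sections through all
points, so that it is a submersion, smoothness can be tested upstairs, and vector fields lift along it
(`PrincipalBundle.exists_lift_field`).

*The soldering form.* By reproduction of fundamental fields and equality of dimensions, the elements of
`F̃_u` which `ω(u)` sends to `𝔭` are exactly the vertical ones. So `ω(u)` induces an isomorphism from `𝔤 / 𝔭`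
to the fiber of `F` (`PartialCartanGeometry.frame`), which is equivariant over `\underline{Ad}` and thus
invariant under `P₊`. It descends to the morphism `j` to the frame bundle, and `θ` is the composition of
`Tp₀` with the inverse of `j` (`exists_isUnderlying`).

*Functoriality.* A morphism `Φ` is equivariant, so it maps `P₊`-orbits to `P₊`-orbits and induces `Ψ`
(`IsCartanMorphism.existsUnique_descends`). All properties of `Ψ` are checked upstairs, where they follow from
those of `Φ`; its tangent maps are isomorphisms between the fibers of `F¹` and `F²`, as they intertwine the
frames.
-/

noncomputable section

namespace PartialCartan

/-! ### The derivative of the adjoint representation -/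

section
variable {E : Type*} [NormedAddCommGroup E] [NormedSpace ℝ E]
  {G : Type*} [TopologicalSpace G] [ChartedSpace E G] [Group G]

/-- The operator `Ad(g)`, viewed as an endomorphism of the model space `E` of `G`. -/
def adCLM (g : G) : E →L[ℝ] E := adMap (E := E) g

/-- If all base points are `1`, the changes of coordinates in `inTangentCoordinates` are trivial. -/
theorem inTangentCoordinates_of_const {N : Type*} [IsManifold 𝓘(ℝ, E) 1 G] {f g : N → G}
    (hf : ∀ x, f x = 1) (hg : ∀ x, g x = 1) (ϕ : N → E →L[ℝ] E) (x₀ x : N) :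
    inTangentCoordinates 𝓘(ℝ, E) 𝓘(ℝ, E) f g ϕ x₀ x = ϕ x := by
  obtain rfl : f = fun _ => 1 := funext hf
  obtain rfl : g = fun _ => 1 := funext hg
  have h := fun v => (tangentBundleCore 𝓘(ℝ, E) G).coordChange_self (achart E (1 : G)) 1 (by simp) v
  rw [inTangentCoordinates_eq _ _ _ (by simp) (by simp)]
  ext v
  simp only [ContinuousLinearMap.comp_apply]
  rw [h]
  exact congrArg _ (h _)

variable [LieGroup 𝓘(ℝ, E) ∞ G]

theorem contMDiff_adCLM :
    ContMDiff 𝓘(ℝ, E) 𝓘(ℝ, E →L[ℝ] E) ∞ (adCLM : G → (E →L[ℝ] E)) := by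
  intro g₀
  have hf : ContMDiffAt (𝓘(ℝ, E).prod 𝓘(ℝ, E)) 𝓘(ℝ, E) ∞
      (Function.uncurry (fun (g x : G) => g * x * g⁻¹)) (g₀, 1) := by
    have : ContMDiff (𝓘(ℝ, E).prod 𝓘(ℝ, E)) 𝓘(ℝ, E) ∞ (fun p : G × G => p.1 * p.2 * p.1⁻¹) :=
      (contMDiff_fst.mul contMDiff_snd).mul contMDiff_fst.inv
    exact this.contMDiffAt
  have h := ContMDiffAt.mfderiv (x₀ := g₀) (fun (g x : G) => g * x * g⁻¹) (fun _ => (1 : G)) hf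
    contMDiffAt_const (m := ∞) (by simp)
  refine h.congr_of_eventuallyEq (Filter.Eventually.of_forall fun g => ?_)
  exact (inTangentCoordinates_of_const (fun _ => rfl) (fun _ => by simp) adCLM g₀ g).symm

variable (E G) in
/-- The multiplication of `G` in the chart around `1`. -/
def chartMul (z : E × E) : E :=
  extChartAt 𝓘(ℝ, E) (1 : G)
    ((extChartAt 𝓘(ℝ, E) (1 : G)).symm z.1 * (extChartAt 𝓘(ℝ, E) (1 : G)).symm z.2)

theorem contDiffAt_chartMul :
    ContDiffAt ℝ ∞ (chartMul E G) (extChartAt 𝓘(ℝ, E) (1 : G) 1, extChartAt 𝓘(ℝ, E) (1 : G) 1) := by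
  have h1 : ContMDiffAt 𝓘(ℝ, E) 𝓘(ℝ, E) ∞ (extChartAt 𝓘(ℝ, E) (1 : G)).symm
     (extChartAt 𝓘(ℝ, E) (1 : G) 1) :=
    (contMDiffOn_extChartAt_symm (1 : G)).contMDiffAt (extChartAt_target_mem_nhds _)
  have h2 : ContMDiffAt 𝓘(ℝ, E × E) 𝓘(ℝ, E) ∞ (fun z : E × E => (extChartAt 𝓘(ℝ, E) (1 : G)).symm z.1)
     (extChartAt 𝓘(ℝ, E) (1 : G) 1, extChartAt 𝓘(ℝ, E) (1 : G) 1) :=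
    ContMDiffAt.comp (I' := 𝓘(ℝ, E)) _ h1 (contDiff_fst.contMDiff.contMDiffAt)
  have h3 : ContMDiffAt 𝓘(ℝ, E × E) 𝓘(ℝ, E) ∞ (fun z : E × E => (extChartAt 𝓘(ℝ, E) (1 : G)).symm z.2)
     (extChartAt 𝓘(ℝ, E) (1 : G) 1, extChartAt 𝓘(ℝ, E) (1 : G) 1) :=
    ContMDiffAt.comp (I' := 𝓘(ℝ, E)) _ h1 (contDiff_snd.contMDiff.contMDiffAt)
  have h4 := h2.mul h3
  have h5 : ContMDiffAt 𝓘(ℝ, E) 𝓘(ℝ, E) ∞ (extChartAt 𝓘(ℝ, E) (1 : G)) (1 : G) := contMDiffAt_extChartAt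
  have h6 := ContMDiffAt.comp_of_eq (I' := 𝓘(ℝ, E)) h5 h4 (by simp)
  exact h6.contDiffAt

/-- The derivative of `f` at `1`, read off in the chart around `1`. -/
theorem mfderiv_chart_apply_mfderiv {f : G → G} {v : E} {g : G} (hg : f 1 = g)
    (hf : MDifferentiableAt 𝓘(ℝ, E) 𝓘(ℝ, E) f 1)
    (h1 : f 1 ∈ (chartAt E (1 : G)).source) {f' : E →L[ℝ] E}
    (hd : HasFDerivAt (fun y => extChartAt 𝓘(ℝ, E) (1 : G) (f ((extChartAt 𝓘(ℝ, E) (1 : G)).symm y)))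
      f' (extChartAt 𝓘(ℝ, E) (1 : G) 1)) :
    (mfderiv 𝓘(ℝ, E) 𝓘(ℝ, E) (extChartAt 𝓘(ℝ, E) (1 : G)) g
      (mfderiv 𝓘(ℝ, E) 𝓘(ℝ, E) f 1 v) : E) = f' v := by
  subst hg
  have hφ := hasMFDerivAt_extChartAt (I := 𝓘(ℝ, E)) (x := (1 : G)) (y := 1) (by simp)
  have hφ' := (hasMFDerivAt_extChartAt (I := 𝓘(ℝ, E)) (x := (1 : G)) h1).comp (1 : G) hf.hasMFDerivAt
  have hd' := (hd.hasMFDerivAt).comp (1 : G) (mdifferentiableAt_extChartAt (I := 𝓘(ℝ, E)) (x := (1 : G)) (y := 1) (by simp)).hasMFDerivAt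
  have hd2 := hd'.congr_of_eventuallyEq (f₁ := (extChartAt 𝓘(ℝ, E) (1 : G)) ∘ f) (by
    filter_upwards [extChartAt_source_mem_nhds (I := 𝓘(ℝ, E)) (1 : G)] with y hy
    simp only [Function.comp_apply, (extChartAt 𝓘(ℝ, E) (1 : G)).left_inv hy])
  have e1 := hd2.mfderiv
  have e2 := ((mdifferentiableAt_extChartAt (I := 𝓘(ℝ, E)) (x := (1 : G)) h1).hasMFDerivAt.comp (1 : G) hf.hasMFDerivAt).mfderiv
  rw [mfderiv_extChartAt_self] at e1
  exact DFunLike.congr_fun (e2.symm.trans e1) v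

/-- The coordinate expression of a vector field in the chart around `1`. -/
theorem mpullback_chart {V : ∀ g : G, TangentSpace 𝓘(ℝ, E) g} {x : E}
    (hx : x ∈ (extChartAt 𝓘(ℝ, E) (1 : G)).target) :
    (VectorField.mpullbackWithin 𝓘(ℝ, E) 𝓘(ℝ, E) (extChartAt 𝓘(ℝ, E) (1 : G)).symm V
      (Set.range 𝓘(ℝ, E)) x : E) =
    mfderiv 𝓘(ℝ, E) 𝓘(ℝ, E) (extChartAt 𝓘(ℝ, E) (1 : G))
      ((extChartAt 𝓘(ℝ, E) (1 : G)).symm x) (V ((extChartAt 𝓘(ℝ, E) (1 : G)).symm x)) := by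
  rw [VectorField.mpullbackWithin_apply]
  have h1 := mfderiv_extChartAt_comp_mfderivWithin_extChartAt_symm (I := 𝓘(ℝ, E)) (x := (1 : G)) hx
  have h2 := mfderivWithin_extChartAt_symm_comp_mfderiv_extChartAt (I := 𝓘(ℝ, E)) (x := (1 : G)) hx
  exact DFunLike.congr_fun (ContinuousLinearMap.inverse_eq h2 h1) _

variable (E G) in
/-- The base point of the chart around `1`. -/
abbrev chartOne : E := extChartAt 𝓘(ℝ, E) (1 : G) 1

theorem eventually_differentiableAt_chartMul :
    ∀ᶠ z in nhds (chartOne E G, chartOne E G), DifferentiableAt ℝ (chartMul E G) z := by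
  have h := (contDiffAt_chartMul (E := E) (G := G)).of_le (m := 1) (by simp)
  filter_upwards [h.eventually (by simp)] with z hz
  exact hz.differentiableAt (by simp)

theorem differentiableAt_fderiv_chartMul :
    DifferentiableAt ℝ (fderiv ℝ (chartMul E G)) (chartOne E G, chartOne E G) :=
  ((contDiffAt_chartMul (E := E) (G := G)).fderiv_right (m := 1) (by norm_cast)).differentiableAt
    (by simp)

/-- In the chart around `1`, the left invariant vector fields are the partial derivatives of the
multiplication in the second variable. -/
theorem eventually_leftInvariant_chart :
    ∀ᶠ x in nhds (chartOne E G), ∀ w : E,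
      (mfderiv 𝓘(ℝ, E) 𝓘(ℝ, E) (extChartAt 𝓘(ℝ, E) (1 : G)) ((extChartAt 𝓘(ℝ, E) (1 : G)).symm x)
        (mfderiv 𝓘(ℝ, E) 𝓘(ℝ, E) (fun y : G => (extChartAt 𝓘(ℝ, E) (1 : G)).symm x * y) 1 w) : E)
      = fderiv ℝ (chartMul E G) (x, chartOne E G) (0, w) := by
  have hc : ContinuousAt (fun x : E => (x, chartOne E G)) (chartOne E G) := by fun_prop
  filter_upwards [hc.eventually eventually_differentiableAt_chartMul,
    extChartAt_target_mem_nhds (I := 𝓘(ℝ, E)) (1 : G)] with x hx hxt w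
  have hs := (extChartAt 𝓘(ℝ, E) (1 : G)).map_target hxt
  have h2 : HasFDerivAt (fun y : E => (x, y))
      ((0 : E →L[ℝ] E).prod (ContinuousLinearMap.id ℝ E)) (chartOne E G) :=
    (hasFDerivAt_const x _).prodMk (hasFDerivAt_id _)
  have h3 := hx.hasFDerivAt.comp (chartOne E G) h2
  have := mfderiv_chart_apply_mfderiv (v := w)
    (f := fun y : G => (extChartAt 𝓘(ℝ, E) (1 : G)).symm x * y) (mul_one _)
    ((contMDiff_mul_left (I := 𝓘(ℝ, E)) (n := ∞)).mdifferentiable (by simp) 1)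
    (by simpa using hs) h3
  simpa using this

/-- In the chart around `1`, the right invariant vector fields are the partial derivatives of the
multiplication in the first variable. -/
theorem eventually_rightInvariant_chart :
    ∀ᶠ x in nhds (chartOne E G), ∀ w : E,
      (mfderiv 𝓘(ℝ, E) 𝓘(ℝ, E) (extChartAt 𝓘(ℝ, E) (1 : G)) ((extChartAt 𝓘(ℝ, E) (1 : G)).symm x)
        (mfderiv 𝓘(ℝ, E) 𝓘(ℝ, E) (fun y : G => y * (extChartAt 𝓘(ℝ, E) (1 : G)).symm x) 1 w) : E)
      = fderiv ℝ (chartMul E G) (chartOne E G, x) (w, 0) := by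
  have hc : ContinuousAt (fun x : E => (chartOne E G, x)) (chartOne E G) := by fun_prop
  filter_upwards [hc.eventually eventually_differentiableAt_chartMul,
    extChartAt_target_mem_nhds (I := 𝓘(ℝ, E)) (1 : G)] with x hx hxt w
  have hs := (extChartAt 𝓘(ℝ, E) (1 : G)).map_target hxt
  have h2 : HasFDerivAt (fun y : E => (y, x))
      ((ContinuousLinearMap.id ℝ E).prod (0 : E →L[ℝ] E)) (chartOne E G) :=
    (hasFDerivAt_id _).prodMk (hasFDerivAt_const x _)
  have h3 := hx.hasFDerivAt.comp (chartOne E G) h2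
  have := mfderiv_chart_apply_mfderiv (v := w)
    (f := fun y : G => y * (extChartAt 𝓘(ℝ, E) (1 : G)).symm x) (one_mul _)
    ((contMDiff_mul_right (I := 𝓘(ℝ, E)) (n := ∞)).mdifferentiable (by simp) 1)
    (by simpa using hs) h3
  simpa using this

theorem lieBracketWithin_eq_of_eventuallyEq {V W V₁ W₁ : E → E} {s : Set E} {c : E}
    (hs : s = Set.univ) (hV : V =ᶠ[nhds c] V₁) (hW : W =ᶠ[nhds c] W₁) :
    VectorField.lieBracketWithin ℝ V W s c = VectorField.lieBracket ℝ V₁ W₁ c := by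
  rw [hs, VectorField.lieBracketWithin_univ]
  exact hV.lieBracket_vectorField_eq hW

theorem hasFDerivAt_prodMk_left (a b : E) :
    HasFDerivAt (fun y : E => (a, y)) ((0 : E →L[ℝ] E).prod (ContinuousLinearMap.id ℝ E)) b :=
  (hasFDerivAt_const a _).prodMk (hasFDerivAt_id _)

theorem hasFDerivAt_prodMk_right (a b : E) :
    HasFDerivAt (fun y : E => (y, a)) ((ContinuousLinearMap.id ℝ E).prod (0 : E →L[ℝ] E)) b :=
  (hasFDerivAt_id _).prodMk (hasFDerivAt_const a _)

theorem fderiv_chartMul_one_right (v : E) :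
    fderiv ℝ (chartMul E G) (chartOne E G, chartOne E G) ((0 : E), v) = v := by
  have h1 := HasFDerivAt.comp (chartOne E G)
    (eventually_differentiableAt_chartMul (E := E) (G := G)).self_of_nhds.hasFDerivAt
    (hasFDerivAt_prodMk_left (chartOne E G) (chartOne E G))
  have h2 : (fun y : E => chartMul E G (chartOne E G, y)) =ᶠ[nhds (chartOne E G)] id := by
    filter_upwards [extChartAt_target_mem_nhds (I := 𝓘(ℝ, E)) (1 : G)] with y hy
    simp only [chartMul, extChartAt_to_inv, one_mul, id]
    exact (extChartAt 𝓘(ℝ, E) (1 : G)).right_inv hy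
  have h3 := h1.unique ((hasFDerivAt_id _).congr_of_eventuallyEq h2)
  simpa using DFunLike.congr_fun h3 v

theorem fderiv_chartMul_one_left (v : E) :
    fderiv ℝ (chartMul E G) (chartOne E G, chartOne E G) (v, (0 : E)) = v := by
  have h1 := HasFDerivAt.comp (f := fun y : E => (y, chartOne E G)) (chartOne E G)
    (eventually_differentiableAt_chartMul (E := E) (G := G)).self_of_nhds.hasFDerivAt
    (hasFDerivAt_prodMk_right (chartOne E G) (chartOne E G))
  have h2 : (fun y : E => chartMul E G (y, chartOne E G)) =ᶠ[nhds (chartOne E G)] id := by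
    filter_upwards [extChartAt_target_mem_nhds (I := 𝓘(ℝ, E)) (1 : G)] with y hy
    simp only [chartMul, extChartAt_to_inv, mul_one, id]
    exact (extChartAt 𝓘(ℝ, E) (1 : G)).right_inv hy
  have h3 := h1.unique ((hasFDerivAt_id _).congr_of_eventuallyEq h2)
  simpa using DFunLike.congr_fun h3 v

variable (E G) in
/-- The second derivative of the multiplication in the chart around `1`. -/
abbrev mulHessian : E × E →L[ℝ] E × E →L[ℝ] E :=
  fderiv ℝ (fderiv ℝ (chartMul E G)) (chartOne E G, chartOne E G)

theorem mulHessian_symm (z w : E × E) : mulHessian E G z w = mulHessian E G w z :=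
  (contDiffAt_chartMul (E := E) (G := G)).isSymmSndFDerivAt (by simpa using ENat.LEInfty.out) z w

theorem hasFDerivAt_fderiv_chartMul_right (u : E) :
    HasFDerivAt (fun x => fderiv ℝ (chartMul E G) (x, chartOne E G) (0, u))
      ((((ContinuousLinearMap.apply ℝ E ((0 : E), u)).comp (mulHessian E G)).comp
        ((ContinuousLinearMap.id ℝ E).prod (0 : E →L[ℝ] E)))) (chartOne E G) :=
  (ContinuousLinearMap.apply ℝ E ((0 : E), u)).hasFDerivAt.comp (chartOne E G)
    (HasFDerivAt.comp (f := fun y : E => (y, chartOne E G)) (chartOne E G)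
      (differentiableAt_fderiv_chartMul (E := E) (G := G)).hasFDerivAt
      (hasFDerivAt_prodMk_right _ _))

theorem lieBracket_chartMul (v w : E) :
    VectorField.lieBracket ℝ (fun x => fderiv ℝ (chartMul E G) (x, chartOne E G) (0, v))
      (fun x => fderiv ℝ (chartMul E G) (x, chartOne E G) (0, w)) (chartOne E G) =
    mulHessian E G (v, 0) (0, w) - mulHessian E G (w, 0) (0, v) := by
  rw [VectorField.lieBracket_eq]
  simp only [(hasFDerivAt_fderiv_chartMul_right _).fderiv, fderiv_chartMul_one_right]
  simp

/-- The bracket of the Lie algebra, which is defined by left invariant vector fields, is the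
antisymmetrization of the mixed second derivative of the multiplication. -/
theorem lie_eq_mulHessian [CompleteSpace E] (v w : LieAlg E G) :
    (⁅v, w⁆ : LieAlg E G) =
      (mulHessian E G ((v : E), 0) (0, (w : E)) - mulHessian E G ((w : E), 0) (0, (v : E)) : E) := by
  have key : ∀ u : LieAlg E G,
      (VectorField.mpullbackWithin 𝓘(ℝ, E) 𝓘(ℝ, E) (extChartAt 𝓘(ℝ, E) (1 : G)).symm
        (mulInvariantVectorField u) (Set.range 𝓘(ℝ, E)) : E → E) =ᶠ[nhds (chartOne E G)]
      (fun x => fderiv ℝ (chartMul E G) (x, chartOne E G) ((0 : E), (u : E))) := by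
    intro u
    filter_upwards [eventually_leftInvariant_chart (E := E) (G := G),
      extChartAt_target_mem_nhds (I := 𝓘(ℝ, E)) (1 : G)] with x hx hxt
    exact (mpullback_chart hxt).trans (hx u)
  have hb := GroupLieAlgebra.bracket_def v w
  rw [← VectorField.mlieBracketWithin_univ, VectorField.mlieBracketWithin_apply,
    mfderiv_extChartAt_self] at hb
  rw [hb]
  refine (congrFun (congrArg _ ContinuousLinearMap.inverse_id) _).trans ?_
  refine (lieBracketWithin_eq_of_eventuallyEq (s := _) (by simp) (key v) (key w)).trans ?_
  exact lieBracket_chartMul (E := E) (G := G) v w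

/-- The left and the right invariant vector fields are related by `Ad`. -/
theorem mfderiv_mul_left_eq (g : G) (w : E) :
    (mfderiv 𝓘(ℝ, E) 𝓘(ℝ, E) (fun y : G => g * y) 1 w : E) =
      mfderiv 𝓘(ℝ, E) 𝓘(ℝ, E) (fun y : G => y * g) 1 (adCLM g w : E) := by
  have h1 : ∀ x : G, x = 1 → HasMFDerivAt 𝓘(ℝ, E) 𝓘(ℝ, E) (fun y : G => y * g) x
      (mfderiv 𝓘(ℝ, E) 𝓘(ℝ, E) (fun y : G => y * g) 1 : E →L[ℝ] E) := by
    rintro x rfl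
    exact ((contMDiff_mul_right (I := 𝓘(ℝ, E)) (n := ∞)).mdifferentiable (by simp) 1).hasMFDerivAt
  have h2 := (h1 (g * 1 * g⁻¹) (by simp)).comp 1 (hasMFDerivAt_conj (E := E) g (rfl : (1 : G) = 1))
  have e : (fun y : G => y * g) ∘ (fun x => g * x * g⁻¹) = fun y => g * y := by
    ext y; simp
  rw [e] at h2
  exact DFunLike.congr_fun h2.mfderiv w

theorem eventually_chartMul_adCLM :
    ∀ᶠ x in nhds (chartOne E G), ∀ w : E,
      fderiv ℝ (chartMul E G) (x, chartOne E G) (0, w) =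
        fderiv ℝ (chartMul E G) (chartOne E G, x)
          (adCLM ((extChartAt 𝓘(ℝ, E) (1 : G)).symm x) w, 0) := by
  filter_upwards [eventually_leftInvariant_chart (E := E) (G := G),
    eventually_rightInvariant_chart (E := E) (G := G)] with x hx hx' w
  exact ((hx w).symm.trans (congrArg _ (mfderiv_mul_left_eq _ w))).trans (hx' _)

/-- The derivative of `g ↦ Ad(g)` at `1`, in the chart around `1`. -/
theorem fderiv_adCLM_chart_apply {D : E →L[ℝ] E →L[ℝ] E}
    (hd : HasFDerivAt (fun x => adCLM ((extChartAt 𝓘(ℝ, E) (1 : G)).symm x)) D (chartOne E G))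
    (v w : E) : D v w = mulHessian E G (v, 0) (0, w) - mulHessian E G (w, 0) (0, v) := by
  have h1 := hasFDerivAt_fderiv_chartMul_right (E := E) (G := G) w
  have h2 : HasFDerivAt (fun x => fderiv ℝ (chartMul E G) (chartOne E G, x))
      ((mulHessian E G).comp ((0 : E →L[ℝ] E).prod (ContinuousLinearMap.id ℝ E))) (chartOne E G) :=
    HasFDerivAt.comp (f := fun y : E => (chartOne E G, y)) (chartOne E G)
      (differentiableAt_fderiv_chartMul (E := E) (G := G)).hasFDerivAt
      (hasFDerivAt_prodMk_left _ _)
  have h3 : HasFDerivAt (fun x => (adCLM ((extChartAt 𝓘(ℝ, E) (1 : G)).symm x) w, (0 : E))) _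
      (chartOne E G) :=
    HasFDerivAt.prodMk (hd.clm_apply (hasFDerivAt_const w _)) (hasFDerivAt_const (0 : E) _)
  have h4 := h2.clm_apply h3
  have h5 := (h1.congr_of_eventuallyEq
    (eventually_chartMul_adCLM.mono fun x hx => (hx w).symm)).unique h4
  have h6 := DFunLike.congr_fun h5 v
  have e1 : (extChartAt 𝓘(ℝ, E) (1 : G)).symm (chartOne E G) = 1 := extChartAt_to_inv _
  have e2 : ∀ u : E, adCLM (1 : G) u = u := fun u =>
    DFunLike.congr_fun (adMap_one (E := E) (G := G)) u
  simp only [ContinuousLinearMap.comp_apply, add_apply,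
    ContinuousLinearMap.flip_apply, ContinuousLinearMap.prod_apply, ContinuousLinearMap.id_apply,
    zero_apply, ContinuousLinearMap.apply_apply, zero_add, e1, e2,
    fderiv_chartMul_one_left] at h6
  rw [h6, mulHessian_symm (0, v), add_sub_cancel_right]

variable (E G) in
/-- The adjoint action `ad`, as a continuous linear map. -/
def adDeriv : E →L[ℝ] E →L[ℝ] E :=
  mfderiv 𝓘(ℝ, E) 𝓘(ℝ, E →L[ℝ] E) (adCLM : G → (E →L[ℝ] E)) 1

theorem hasMFDerivAt_adCLM_one :
    HasMFDerivAt 𝓘(ℝ, E) 𝓘(ℝ, E →L[ℝ] E) (adCLM : G → (E →L[ℝ] E)) 1 (adDeriv E G) :=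
  ((contMDiff_adCLM (E := E) (G := G)).mdifferentiable (by simp) 1).hasMFDerivAt

/-- The derivative of `Ad` at `1` is the bracket. -/
theorem adDeriv_apply [CompleteSpace E] (v w : LieAlg E G) :
    (adDeriv E G v w : E) = (⁅v, w⁆ : LieAlg E G) := by
  have h := (hasMFDerivAt_adCLM_one (E := E) (G := G)).2
  have h' : HasFDerivAt (fun x => adCLM ((extChartAt 𝓘(ℝ, E) (1 : G)).symm x)) (adDeriv E G)
      (chartOne E G) := by
    refine HasFDerivWithinAt.hasFDerivAt (s := Set.range 𝓘(ℝ, E)) h ?_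
    rw [modelWithCornersSelf_coe, Set.range_id]
    exact Filter.univ_mem
  exact (fderiv_adCLM_chart_apply h' v w).trans (lie_eq_mulHessian v w).symm

end

/-! ### One-parameter subgroups -/

section
variable {E : Type*} [NormedAddCommGroup E] [NormedSpace ℝ E]
  {G : Type*} [TopologicalSpace G] [ChartedSpace E G] [Group G] [LieGroup 𝓘(ℝ, E) ∞ G]

omit [LieGroup 𝓘(ℝ, E) ∞ G] in
theorem adCLM_one : adCLM (1 : G) = ContinuousLinearMap.id ℝ E := adMap_one

theorem adCLM_mul (g h : G) : adCLM (g * h) = (adCLM g).comp (adCLM (E := E) h) := adMap_mul g h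

theorem adCLM_mul_apply (g h : G) (v : E) : adCLM (g * h) v = adCLM g (adCLM h v) := by
  rw [adCLM_mul]; rfl

theorem adCLM_inv_apply_self (g : G) (v : E) : adCLM g⁻¹ (adCLM g v) = v := by
  rw [← adCLM_mul_apply, inv_mul_cancel, adCLM_one]; rfl

theorem adCLM_apply_inv_self (g : G) (v : E) : adCLM g (adCLM g⁻¹ v) = v := by
  rw [← adCLM_mul_apply, mul_inv_cancel, adCLM_one]; rfl

theorem adDeriv_adCLM (g : G) (v w : E) :
    adDeriv E G (adCLM g v) (adCLM g w) = adCLM g (adDeriv E G v w) := by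
  have h1 : ∀ x : G, x = 1 → HasMFDerivAt 𝓘(ℝ, E) 𝓘(ℝ, E →L[ℝ] E) (adCLM : G → (E →L[ℝ] E)) x
      (adDeriv E G) := by
    rintro x rfl; exact hasMFDerivAt_adCLM_one
  have h2 := (h1 (g * 1 * g⁻¹) (by simp)).comp 1 (hasMFDerivAt_conj (E := E) g (rfl : (1 : G) = 1))
  let L : (E →L[ℝ] E) →L[ℝ] (E →L[ℝ] E) :=
    (ContinuousLinearMap.compL ℝ E E E (adCLM g)).comp
      ((ContinuousLinearMap.compL ℝ E E E).flip (adCLM g⁻¹))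
  have h3 := (L.hasFDerivAt.hasMFDerivAt (x := adCLM (1 : G))).comp 1
    (hasMFDerivAt_adCLM_one (E := E) (G := G))
  have e : L ∘ (adCLM : G → (E →L[ℝ] E)) = adCLM ∘ (fun x => g * x * g⁻¹) := by
    ext x v
    simp [L, adCLM_mul_apply]
  rw [e] at h3
  have h4 := h2.mfderiv.symm.trans h3.mfderiv
  have h5 : adDeriv E G (adCLM g v) = L (adDeriv E G v) := DFunLike.congr_fun h4 v
  rw [h5]
  simp [L, adCLM_inv_apply_self]

omit [LieGroup 𝓘(ℝ, E) ∞ G] [Group G] in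
theorem tangentBundle_mk_eq {a b : G} {v : TangentSpace 𝓘(ℝ, E) a} {w : TangentSpace 𝓘(ℝ, E) b}
    (h : a = b) (hv : (v : E) = (w : E)) : (⟨a, v⟩ : TangentBundle 𝓘(ℝ, E) G) = ⟨b, w⟩ := by
  subst h
  exact congrArg _ hv

theorem contMDiff_leftInvariant (X : LieAlg E G) :
    ContMDiff 𝓘(ℝ, E) (𝓘(ℝ, E)).tangent ∞
      (fun g : G => (⟨g, mulInvariantVectorField X g⟩ : TangentBundle 𝓘(ℝ, E) G)) := by
  have h1 : ContMDiff 𝓘(ℝ, E) (𝓘(ℝ, E)).tangent ∞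
      (fun g : G => (⟨g, 0⟩ : TangentBundle 𝓘(ℝ, E) G)) := contMDiff_zeroSection _ _
  have h2 : ContMDiff 𝓘(ℝ, E) (𝓘(ℝ, E)).tangent ∞
      (fun _ : G => (⟨1, X⟩ : TangentBundle 𝓘(ℝ, E) G)) := contMDiff_const
  have h3 : ContMDiff ((𝓘(ℝ, E)).prod 𝓘(ℝ, E)).tangent (𝓘(ℝ, E)).tangent ∞
      (tangentMap ((𝓘(ℝ, E)).prod 𝓘(ℝ, E)) 𝓘(ℝ, E) (fun p : G × G => p.1 * p.2)) :=
    (contMDiff_mul 𝓘(ℝ, E) ∞).contMDiff_tangentMap (m := ∞) (by simp)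
  have h4 := h3.comp (contMDiff_equivTangentBundleProd_symm.comp (h1.prodMk h2))
  refine h4.congr fun g => ?_
  refine tangentBundle_mk_eq (mul_one g).symm ?_
  have h5 := mfderiv_prod_eq_add_apply (p := (g, (1 : G)))
    (v := (((0 : E), (X : E)) : TangentSpace (𝓘(ℝ, E).prod 𝓘(ℝ, E)) (g, (1 : G))))
    ((contMDiff_mul 𝓘(ℝ, E) ∞).mdifferentiable (by simp) (g, (1 : G)))
  refine Eq.trans ?_ h5.symm
  have h6 : ∀ (L : E →L[ℝ] E) (w : E), w = L 0 + w := by simp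
  exact h6 (mfderiv 𝓘(ℝ, E) 𝓘(ℝ, E) (fun y : G => y * 1) g) _

theorem leftInvariant_mul (X : LieAlg E G) (g h : G) :
    (mulInvariantVectorField X (g * h) : E) =
      mfderiv 𝓘(ℝ, E) 𝓘(ℝ, E) (fun y : G => g * y) h (mulInvariantVectorField X h) := by
  have h1 : ∀ k : G, k = h → HasMFDerivAt 𝓘(ℝ, E) 𝓘(ℝ, E) (fun y : G => g * y) k
      (mfderiv 𝓘(ℝ, E) 𝓘(ℝ, E) (fun y : G => g * y) h : E →L[ℝ] E) := by
    rintro k rfl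
    exact ((contMDiff_mul_left (I := 𝓘(ℝ, E)) (n := ∞) (a := g)).mdifferentiable (by simp)
      k).hasMFDerivAt
  have h2 := (h1 (h * 1) (mul_one h)).comp 1 ((contMDiff_mul_left (I := 𝓘(ℝ, E)) (n := ∞)
    (a := h)).mdifferentiable (by simp) (1 : G)).hasMFDerivAt
  have e : (fun y : G => g * y) ∘ (fun y => h * y) = fun y => g * h * y := by
    ext y; simp [mul_assoc]
  rw [e] at h2
  exact DFunLike.congr_fun h2.mfderiv X

/-- `γ` is a smooth one-parameter subgroup with initial velocity `X`. -/
structure IsOneParam (γ : ℝ → G) (X : E) : Prop where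
  contMDiff : ContMDiff 𝓘(ℝ, ℝ) 𝓘(ℝ, E) ∞ γ
  map_add : ∀ s t, γ (s + t) = γ s * γ t
  velocity : (tangentMap 𝓘(ℝ, ℝ) 𝓘(ℝ, E) γ ⟨0, (1 : ℝ)⟩ : TangentBundle 𝓘(ℝ, E) G) = ⟨1, X⟩

theorem isMIntegralCurve_mul_left {γ : ℝ → G} {X : LieAlg E G} {s : Set ℝ}
    (h : IsMIntegralCurveOn γ (mulInvariantVectorField X) s) (g : G) :
    IsMIntegralCurveOn (fun t => g * γ t) (mulInvariantVectorField X) s := by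
  intro t ht
  have h1 := ((contMDiff_mul_left (I := 𝓘(ℝ, E)) (n := ∞) (a := g)).mdifferentiable (by simp)
    (γ t)).hasMFDerivAt
  have h2 := h1.comp_hasMFDerivWithinAt t (h t ht)
  refine h2.congr_mfderiv ?_
  ext
  refine (map_smul (mfderiv 𝓘(ℝ, E) 𝓘(ℝ, E) (fun y : G => g * y) (γ t)) _ _).trans ?_
  exact congrArg (_ • ·) (leftInvariant_mul X g (γ t)).symm

/-- Integral curves of smooth vector fields are smooth, by bootstrapping from the equation. -/
theorem contMDiff_of_isMIntegralCurve {γ : ℝ → G} {V : ∀ g : G, TangentSpace 𝓘(ℝ, E) g}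
    (hV : ContMDiff 𝓘(ℝ, E) (𝓘(ℝ, E)).tangent ∞ (fun g : G => (⟨g, V g⟩ : TangentBundle 𝓘(ℝ, E) G)))
    (h : IsMIntegralCurve γ V) : ContMDiff 𝓘(ℝ, ℝ) 𝓘(ℝ, E) ∞ γ := by
  rw [contMDiff_infty]
  intro n
  induction n with
  | zero => exact contMDiff_zero_iff.2 h.continuous
  | succ n ih =>
    intro t₀
    have h1 := ((hV.of_le (m := n) (by exact_mod_cast le_top)).comp ih).contMDiffAt (x := t₀)
    rw [contMDiffAt_totalSpace] at h1
    have h2 := (h.isMIntegralCurveAt t₀).eventually_hasDerivAt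
    have h3 : ContDiffAt ℝ (n + 1 : ℕ) ((extChartAt 𝓘(ℝ, E) (γ t₀)) ∘ γ) t₀ := by
      push_cast
      rw [contDiffAt_succ_iff_hasFDerivAt]
      refine ⟨_, ⟨_, h2, fun t ht => ht.hasFDerivAt⟩, ?_⟩
      have h4 : ContDiffAt ℝ n (fun t => (tangentCoordChange 𝓘(ℝ, E) (γ t) (γ t₀) (γ t) (V (γ t)) : E)) t₀ := h1.2.contDiffAt
      exact (ContinuousLinearMap.smulRightL ℝ ℝ E (1 : ℝ →L[ℝ] ℝ)).contDiff.contDiffAt.comp t₀ h4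
    rw [contMDiffAt_iff_target]
    exact ⟨h.continuous.continuousAt, h3.contMDiffAt⟩

variable [T2Space G]

omit [LieGroup 𝓘(ℝ, E) ∞ G] [T2Space G] in
theorem IsOneParam.map_zero {γ : ℝ → G} {X : E} (h : IsOneParam γ X) : γ 0 = 1 := by
  have := h.map_add 0 0
  simpa using this

omit [LieGroup 𝓘(ℝ, E) ∞ G] [T2Space G] in
theorem IsOneParam.hasMFDerivAt_zero {γ : ℝ → G} {X : E} (h : IsOneParam γ X) :
    HasMFDerivAt 𝓘(ℝ, ℝ) 𝓘(ℝ, E) γ 0 ((1 : ℝ →L[ℝ] ℝ).smulRight (X : E) : ℝ →L[ℝ] E) := by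
  have h1 := (h.contMDiff.mdifferentiable (by simp) 0).hasMFDerivAt
  refine h1.congr_mfderiv ?_
  have h2 : ∀ {p q : TangentBundle 𝓘(ℝ, E) G}, p = q → (p.2 : E) = q.2 := by rintro p _ rfl; rfl
  have h3 := h2 h.velocity
  ext
  refine h3.trans ?_
  exact (one_smul ℝ (X : E)).symm

omit [T2Space G] in
theorem IsOneParam.isMIntegralCurve {γ : ℝ → G} {X : E} (h : IsOneParam γ X) :
    IsMIntegralCurve (I := 𝓘(ℝ, E)) γ (mulInvariantVectorField (X : LieAlg E G)) := by
  intro t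
  have h1 : ∀ k : G, k = 1 → HasMFDerivAt 𝓘(ℝ, E) 𝓘(ℝ, E) (fun y : G => γ t * y) k
      (mfderiv 𝓘(ℝ, E) 𝓘(ℝ, E) (fun y : G => γ t * y) 1 : E →L[ℝ] E) := by
    rintro k rfl
    exact ((contMDiff_mul_left (I := 𝓘(ℝ, E)) (n := ∞) (a := γ t)).mdifferentiable (by simp)
      1).hasMFDerivAt
  have h0 : HasMFDerivAt 𝓘(ℝ, ℝ) 𝓘(ℝ, ℝ) (fun s : ℝ => s - t) t (ContinuousLinearMap.id ℝ ℝ) :=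
    ((hasFDerivAt_id t).sub_const t).hasMFDerivAt
  have h2 : ∀ s : ℝ, s = 0 → HasMFDerivAt 𝓘(ℝ, ℝ) 𝓘(ℝ, E) γ s
      ((1 : ℝ →L[ℝ] ℝ).smulRight (X : E) : ℝ →L[ℝ] E) := by
    rintro s rfl; exact h.hasMFDerivAt_zero
  have h3 := (h1 (γ (t - t)) (by simp [h.map_zero])).comp t
    (HasMFDerivAt.comp (f := fun s : ℝ => s - t) t (h2 (t - t) (sub_self t)) h0)
  have e : (fun y : G => γ t * y) ∘ γ ∘ (fun s : ℝ => s - t) = γ := by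
    ext s; simp [← h.map_add]
  rw [e] at h3
  refine h3.congr_mfderiv ?_
  ext
  exact map_smul (mfderiv 𝓘(ℝ, E) 𝓘(ℝ, E) (fun y : G => γ t * y) 1) _ _

theorem IsOneParam.unique [CompleteSpace E] {γ γ' : ℝ → G} {X : E} (h : IsOneParam γ X)
    (h' : IsOneParam γ' X) : γ = γ' :=
  isMIntegralCurve_Ioo_eq_of_contMDiff_boundaryless (t₀ := 0)
    ((contMDiff_leftInvariant (E := E) (G := G) X).of_le (by simp)) h.isMIntegralCurve h'.isMIntegralCurve
    (by rw [h.map_zero, h'.map_zero])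

/-- Existence of one-parameter subgroups: the integral curve through `1` of a left invariant vector
field extends to all times, since left translations turn a local solution into solutions through all
points with the same life time. -/
theorem exists_isOneParam [CompleteSpace E] (X : E) : ∃ γ : ℝ → G, IsOneParam γ X := by
  have hV := (contMDiff_leftInvariant (E := E) (G := G) X).of_le (m := 1) (by simp)
  obtain ⟨γ₀, h0, h1⟩ := exists_isMIntegralCurveAt_of_contMDiffAt_boundaryless (t₀ := 0)
    hV.contMDiffAt (x₀ := (1 : G))
  rw [isMIntegralCurveAt_iff'] at h1
  obtain ⟨ε, hε, h1⟩ := h1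
  obtain ⟨γ, h2, h3⟩ := exists_isMIntegralCurve_of_isMIntegralCurveOn hV hε (fun g => by
    refine ⟨fun t => g * γ₀ t, by simp [h0], ?_⟩
    have := isMIntegralCurve_mul_left (E := E) h1 g
    rwa [Real.ball_eq_Ioo, zero_sub, zero_add] at this) 1
  refine ⟨γ, contMDiff_of_isMIntegralCurve (contMDiff_leftInvariant (E := E) (G := G) X) h3, fun s t => ?_, ?_⟩
  · have h4 := isMIntegralCurve_iff_isMIntegralCurveOn.2
      (isMIntegralCurve_mul_left (h3.isMIntegralCurveOn Set.univ) (γ s))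
    have h5 := h3.comp_add s
    have h6 := isMIntegralCurve_Ioo_eq_of_contMDiff_boundaryless (I := 𝓘(ℝ, E)) (t₀ := 0) hV h5 h4 (by simp [h2])
    have := congrFun h6 t
    simpa [add_comm] using this
  · refine tangentBundle_mk_eq h2 ?_
    refine (DFunLike.congr_fun (h3 0).mfderiv (1 : ℝ)).trans ?_
    refine (one_smul ℝ (mulInvariantVectorField (I := 𝓘(ℝ, E)) X (γ 0) : E)).trans ?_
    have : ∀ g : G, g = 1 → (mulInvariantVectorField (I := 𝓘(ℝ, E)) X g : E) = X := by
      rintro g rfl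
      have : (fun x : G => (1 : G) * x) = id := by ext; simp
      unfold mulInvariantVectorField
      rw [this, mfderiv_id]
      rfl
    exact this _ h2

omit [Group G] [LieGroup 𝓘(ℝ, E) ∞ G] [T2Space G] in
theorem hasDerivAt_of_hasMFDerivAt_comp {W : Type*} [NormedAddCommGroup W] [NormedSpace ℝ W]
    {f : G → W} {γ : ℝ → G} {t : ℝ} {f' : E →L[ℝ] W} {x : E}
    (hf : HasMFDerivAt 𝓘(ℝ, E) 𝓘(ℝ, W) f (γ t) f')
    (hγ : HasMFDerivAt 𝓘(ℝ, ℝ) 𝓘(ℝ, E) γ t ((1 : ℝ →L[ℝ] ℝ).smulRight x)) :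
    HasDerivAt (fun t => f (γ t)) (f' x) t := by
  have h : HasFDerivAt (fun t => f (γ t)) (f'.comp ((1 : ℝ →L[ℝ] ℝ).smulRight x)) t :=
    (hf.comp t hγ).hasFDerivAt
  simpa using h.hasDerivAt

omit [T2Space G] in
theorem IsOneParam.hasDerivAt_adCLM {γ : ℝ → G} {X : E} (h : IsOneParam γ X) (t : ℝ) :
    HasDerivAt (fun t => adCLM (γ t)) ((adCLM (γ t)).comp (adDeriv E G X)) t := by
  have h1 : ∀ k : G, k = 1 → HasMFDerivAt 𝓘(ℝ, E) 𝓘(ℝ, E →L[ℝ] E) (adCLM : G → (E →L[ℝ] E)) k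
      (adDeriv E G) := by
    rintro k rfl; exact hasMFDerivAt_adCLM_one
  have h4 : HasDerivAt (fun t => adCLM (γ t)) (adDeriv E G X) 0 :=
    hasDerivAt_of_hasMFDerivAt_comp (h1 (γ 0) h.map_zero) h.hasMFDerivAt_zero
  have h5 : HasDerivAt (fun s => adCLM (γ (s - t))) (adDeriv E G X) t := by
    have h6 : HasDerivAt (fun s => adCLM (γ s)) (adDeriv E G X) (t - t) := by
      rwa [sub_self]
    exact h6.comp_sub_const t t
  have h7 := (ContinuousLinearMap.compL ℝ E E E (adCLM (γ t))).hasFDerivAt.comp_hasDerivAt t h5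
  refine h7.congr_of_eventuallyEq (Filter.Eventually.of_forall fun s => ?_)
  rw [Function.comp_apply, ContinuousLinearMap.compL_apply, ← adCLM_mul, ← h.map_add, add_sub_cancel]

omit [T2Space G] in
theorem IsOneParam.hasDerivAt_adCLM_apply {γ : ℝ → G} {X : E} (h : IsOneParam γ X) (v : E)
    (t : ℝ) : HasDerivAt (fun t => adCLM (γ t) v) (adCLM (γ t) (adDeriv E G X v)) t := by
  simpa using (h.hasDerivAt_adCLM t).clm_apply (hasDerivAt_const t v)

end

/-! ### The exponential map -/

section
variable {E : Type*} [NormedAddCommGroup E] [NormedSpace ℝ E]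
  {G : Type*} [TopologicalSpace G] [ChartedSpace E G] [Group G]

theorem IsOneParam.of_hasMFDerivAt {γ : ℝ → G} {X : E}
    (h1 : ContMDiff 𝓘(ℝ, ℝ) 𝓘(ℝ, E) ∞ γ) (h2 : ∀ s t, γ (s + t) = γ s * γ t)
    (h3 : HasMFDerivAt 𝓘(ℝ, ℝ) 𝓘(ℝ, E) γ 0 ((1 : ℝ →L[ℝ] ℝ).smulRight (X : E) : ℝ →L[ℝ] E)) :
    IsOneParam γ X := by
  refine ⟨h1, h2, tangentBundle_mk_eq (by simpa using h2 0 0) ?_⟩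
  exact (DFunLike.congr_fun h3.mfderiv (1 : ℝ)).trans (one_smul ℝ (X : E))

variable [LieGroup 𝓘(ℝ, E) ∞ G]

omit [LieGroup 𝓘(ℝ, E) ∞ G] in
theorem IsOneParam.const_smul {γ : ℝ → G} {X : E} (h : IsOneParam γ X) (c : ℝ) :
    IsOneParam (E := E) (fun t => γ (c * t)) (c • X : E) := by
  refine .of_hasMFDerivAt (h.contMDiff.comp (contDiff_const.mul contDiff_id).contMDiff)
    (fun s t => by simp [mul_add, h.map_add]) ?_
  have h2 : ∀ s : ℝ, s = 0 → HasMFDerivAt 𝓘(ℝ, ℝ) 𝓘(ℝ, E) γ s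
      ((1 : ℝ →L[ℝ] ℝ).smulRight (X : E) : ℝ →L[ℝ] E) := by
    rintro s rfl; exact h.hasMFDerivAt_zero
  have h3 : HasMFDerivAt 𝓘(ℝ, ℝ) 𝓘(ℝ, ℝ) (fun s : ℝ => c * s) 0 (c • ContinuousLinearMap.id ℝ ℝ) :=
    ((hasFDerivAt_id (0 : ℝ)).const_mul c).hasMFDerivAt
  refine (HasMFDerivAt.comp (f := fun s : ℝ => c * s) 0 (h2 (c * 0) (mul_zero c))
    h3).congr_mfderiv ?_
  have : ∀ x : E, (((1 : ℝ →L[ℝ] ℝ).smulRight x).comp (c • ContinuousLinearMap.id ℝ ℝ))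
      = (1 : ℝ →L[ℝ] ℝ).smulRight (c • x) := by
    intro x; ext; simp
  exact this X

theorem IsOneParam.conj {γ : ℝ → G} {X : E} (h : IsOneParam γ X) (g : G) :
    IsOneParam (E := E) (fun t => g * γ t * g⁻¹) (adCLM (E := E) g X) := by
  refine .of_hasMFDerivAt ((contMDiff_const.mul h.contMDiff).mul contMDiff_const)
    (fun s t => by simp [h.map_add, mul_assoc]) ?_
  refine ((hasMFDerivAt_conj (E := E) g h.map_zero).comp 0 h.hasMFDerivAt_zero).congr_mfderiv ?_
  have : ∀ (L : E →L[ℝ] E) (x : E), L.comp ((1 : ℝ →L[ℝ] ℝ).smulRight x)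
      = (1 : ℝ →L[ℝ] ℝ).smulRight (L x) := by
    intro L x; ext; simp
  exact this (adCLM g) X

/-- The product of two commuting one-parameter subgroups. -/
theorem IsOneParam.mul {γ γ' : ℝ → G} {X Y : E} (h : IsOneParam γ X)
    (h' : IsOneParam γ' Y) (hc : ∀ s t, γ s * γ' t = γ' t * γ s) :
    IsOneParam (E := E) (fun t => γ t * γ' t) (X + Y) := by
  refine .of_hasMFDerivAt (h.contMDiff.mul h'.contMDiff) (fun s t => ?_) ?_
  · simp only [h.map_add, h'.map_add]
    rw [mul_assoc, ← mul_assoc (γ t), hc t s, mul_assoc, mul_assoc]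
  · have h1 := h.hasMFDerivAt_zero.prodMk h'.hasMFDerivAt_zero
    have h2 : ∀ p : G × G, p = (1, 1) → HasMFDerivAt (𝓘(ℝ, E).prod 𝓘(ℝ, E)) 𝓘(ℝ, E)
        (fun p : G × G => p.1 * p.2) p (ContinuousLinearMap.fst ℝ E E + ContinuousLinearMap.snd ℝ E E) := by
      rintro p rfl
      have hd := (contMDiff_mul 𝓘(ℝ, E) ∞).mdifferentiable (by simp) ((1 : G), (1 : G))
      refine hd.hasMFDerivAt.congr_mfderiv ?_
      have e1 : HasMFDerivAt 𝓘(ℝ, E) 𝓘(ℝ, E) (fun y : G => y * 1) 1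
          (ContinuousLinearMap.id ℝ E) :=
        (hasMFDerivAt_id (I := 𝓘(ℝ, E)) (1 : G)).congr_of_eventuallyEq
          (Filter.Eventually.of_forall fun y => by simp)
      have e2 : HasMFDerivAt 𝓘(ℝ, E) 𝓘(ℝ, E) (fun y : G => 1 * y) 1
          (ContinuousLinearMap.id ℝ E) :=
        (hasMFDerivAt_id (I := 𝓘(ℝ, E)) (1 : G)).congr_of_eventuallyEq
          (Filter.Eventually.of_forall fun y => by simp)
      have e3 := mfderiv_prod_eq_add_comp hd
      ext v
      refine (DFunLike.congr_fun e3 v).trans ?_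
      exact congrArg₂ (fun a b : E => a + b) (DFunLike.congr_fun e1.mfderiv v.1) (DFunLike.congr_fun e2.mfderiv v.2)
    refine ((h2 (γ 0, γ' 0) (by rw [h.map_zero, h'.map_zero])).comp 0 h1).congr_mfderiv ?_
    have : ∀ x y : E, (ContinuousLinearMap.fst ℝ E E + ContinuousLinearMap.snd ℝ E E).comp
        (((1 : ℝ →L[ℝ] ℝ).smulRight x).prod ((1 : ℝ →L[ℝ] ℝ).smulRight y))
        = (1 : ℝ →L[ℝ] ℝ).smulRight (x + y) := by
      intro x y; ext; simp
    exact this X Y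

/-- If `(ad X)² v = 0`, then `Ad(γ(t)) v = v + t [X, v]`. -/
theorem IsOneParam.adCLM_apply_eq_add {γ : ℝ → G} {X : E} (h : IsOneParam γ X) {v w : E}
    (hv : adDeriv E G X v = w) (hw : adDeriv E G X w = 0) (t : ℝ) :
    adCLM (γ t) v = v + t • w := by
  have hw' : ∀ t, adCLM (γ t) w = w := by
    have h1 : ∀ t, HasDerivAt (fun t => adCLM (γ t) w) 0 t := fun t => by
      simpa [hw] using h.hasDerivAt_adCLM_apply w t
    intro t
    have := is_const_of_deriv_eq_zero (fun t => (h1 t).differentiableAt) (fun t => (h1 t).deriv) t 0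
    rw [this, h.map_zero, adCLM_one]; rfl
  have h1 : ∀ t, HasDerivAt (fun t => adCLM (γ t) v - t • w) 0 t := fun t => by
    have h2 := (h.hasDerivAt_adCLM_apply v t).fun_sub ((hasDerivAt_id' t).smul_const w)
    simpa [hv, hw'] using h2
  have := is_const_of_deriv_eq_zero (fun t => (h1 t).differentiableAt) (fun t => (h1 t).deriv) t 0
  simp only [h.map_zero, adCLM_one, zero_smul, sub_zero] at this
  rw [← sub_eq_iff_eq_add]
  exact this

theorem IsOneParam.adCLM_apply_eq_self {γ : ℝ → G} {X : E} (h : IsOneParam γ X) {v : E}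
    (hv : adDeriv E G X v = 0) (t : ℝ) : adCLM (γ t) v = v := by
  simpa using h.adCLM_apply_eq_add hv (_root_.map_zero _) t

/-- `Ad(γ(t))` preserves each subspace which is preserved by `ad X`. -/
theorem IsOneParam.adCLM_mem [FiniteDimensional ℝ E] {γ : ℝ → G} {X : E}
    (h : IsOneParam γ X) {S : Submodule ℝ E}
    (hS : ∀ v ∈ S, adDeriv E G X v ∈ S) {v : E} (hv : v ∈ S) (t : ℝ) : adCLM (γ t) v ∈ S := by
  have : CompleteSpace E := FiniteDimensional.complete ℝ E
  set A : E →L[ℝ] E := adDeriv E G X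
  have hinv : ∀ t, (adCLM (γ t)).comp (adCLM (γ (-t))) = ContinuousLinearMap.id ℝ E := fun t => by
    rw [← adCLM_mul, ← h.map_add, add_neg_cancel, h.map_zero, adCLM_one]
  -- `t ↦ Ad(γ(-t)) ∘ exp(t ad X)` has derivative zero
  have h1 : ∀ w t, HasDerivAt (fun t => adCLM (γ (-t)) (NormedSpace.exp (t • A) w)) 0 t := by
    intro w t
    have h3 : HasDerivAt (fun t => adCLM (E := E) (γ (-t))) (-((adCLM (γ (-t))).comp A)) t := by
      have := HasDerivAt.scomp t (h.hasDerivAt_adCLM (-t)) (hasDerivAt_neg t)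
      rwa [neg_one_smul] at this
    have h4 : HasDerivAt (fun t : ℝ => NormedSpace.exp (t • A) w) ((A * NormedSpace.exp (t • A)) w) t := by
      have := (hasDerivAt_exp_smul_const' (𝕂 := ℝ) A t).clm_apply (hasDerivAt_const t w)
      rwa [_root_.map_zero, add_zero] at this
    have h5 := h3.clm_apply h4
    rwa [neg_apply, ContinuousLinearMap.comp_apply,
      mul_apply_eq_comp, neg_add_cancel] at h5
  have h2 : ∀ t w, adCLM (γ t) w = NormedSpace.exp (t • A) w := by
    intro t w
    have := is_const_of_deriv_eq_zero (fun t => (h1 w t).differentiableAt)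
      (fun t => (h1 w t).deriv) t 0
    simp only [neg_zero, h.map_zero, adCLM_one, zero_smul, NormedSpace.exp_zero] at this
    have h3 := DFunLike.congr_fun (hinv t) (NormedSpace.exp (t • A) w)
    rw [ContinuousLinearMap.comp_apply, this] at h3
    exact h3
  rw [h2]
  have h3 := (NormedSpace.exp_series_hasSum_exp' (𝕂 := ℝ) (t • A)).mapL (ContinuousLinearMap.apply ℝ E v)
  refine (Submodule.closed_of_finiteDimensional S).mem_of_tendsto h3
    (Filter.Eventually.of_forall fun s => S.sum_mem fun n _ => ?_)
  have h4 : ∀ n : ℕ, ((t • A) ^ n) v ∈ S := by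
    intro n
    induction n with
    | zero => simpa using hv
    | succ n ih =>
      rw [pow_succ']
      exact S.smul_mem _ (hS _ ih)
  exact S.smul_mem _ (h4 n)

variable [CompleteSpace E] [T2Space G]

/-- The exponential map of a Lie group. -/
def lieExp (X : E) : G := (exists_isOneParam (G := G) X).choose 1

theorem IsOneParam.commute {γ γ' : ℝ → G} {X Y : E} (h : IsOneParam γ X)
    (h' : IsOneParam γ' Y) (hXY : adDeriv E G X Y = 0) (s t : ℝ) : γ s * γ' t = γ' t * γ s := by
  have h1 := h'.conj (γ s)
  rw [h.adCLM_apply_eq_self hXY s] at h1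
  have h2 := congrFun (h1.unique h') t
  rw [← inv_mul_cancel_right (γ s * γ' t) (γ s), h2]

theorem IsOneParam.apply_one {γ : ℝ → G} {X : E} (h : IsOneParam γ X) :
    γ 1 = lieExp X := by
  rw [lieExp, h.unique (exists_isOneParam X).choose_spec]

theorem IsOneParam.apply {γ : ℝ → G} {X : E} (h : IsOneParam γ X) (t : ℝ) :
    γ t = lieExp (t • X) := by
  rw [← (h.const_smul t).apply_one, mul_one]

theorem isOneParam_lieExp (X : E) : IsOneParam (E := E) (fun t : ℝ => lieExp (G := G) (t • X)) X := by
  have h := (exists_isOneParam (G := G) X).choose_spec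
  rwa [funext h.apply] at h

theorem lieExp_add {X Y : E} (h : adDeriv E G X Y = 0) :
    lieExp (G := G) (X + Y) = lieExp X * lieExp Y := by
  have h1 := (isOneParam_lieExp (G := G) X).mul (isOneParam_lieExp (G := G) Y)
    ((isOneParam_lieExp (G := G) X).commute (isOneParam_lieExp (G := G) Y) h)
  rw [← h1.apply_one, one_smul, one_smul]

theorem lieExp_zero : lieExp (0 : E) = (1 : G) := by
  have := (isOneParam_lieExp (G := G) (0 : E)).map_zero
  simpa using this

/-- The exponential map is smooth on a commutative subalgebra, where it is the product of the
one-parameter subgroups of a basis. -/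
theorem contMDiff_lieExp_comp {W : Type*} [NormedAddCommGroup W] [NormedSpace ℝ W]
    [FiniteDimensional ℝ W] (F : W →ₗ[ℝ] E) (hF : ∀ x y, adDeriv E G (F x) (F y) = 0) :
    ContMDiff 𝓘(ℝ, W) 𝓘(ℝ, E) ∞ (fun w => (lieExp (G := G) (F w) : G)) := by
  let b := Module.finBasis ℝ W
  have h : ∀ s : Finset (Fin (Module.finrank ℝ W)),
      ContMDiff 𝓘(ℝ, W) 𝓘(ℝ, E) ∞ (fun w => (lieExp (G := G) (F (∑ i ∈ s, b.repr w i • b i)) : G)) := by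
    intro s
    induction s using Finset.induction_on with
    | empty =>
      simp only [Finset.sum_empty]
      exact contMDiff_const
    | insert a s ha ih =>
      have h1 : ContMDiff 𝓘(ℝ, W) 𝓘(ℝ, E) ∞ (fun w => (lieExp (G := G) ((b.repr w a) • (F (b a))) : G)) := by
        exact (isOneParam_lieExp (G := G) (F (b a))).contMDiff.comp
          (LinearMap.toContinuousLinearMap (b.coord a)).contDiff.contMDiff
      refine (h1.mul ih).congr fun w => ?_
      rw [Finset.sum_insert ha, Pi.mul_apply, ← lieExp_add]
      · rw [map_add, map_smul]
      · rw [← map_smul F]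
        exact hF _ _
  refine (h Finset.univ).congr fun w => ?_
  rw [b.sum_repr]

end

/-! ### `|1|`-graded simple Lie algebras -/

namespace OneGrading

variable {L : Type*} [LieRing L] [LieAlgebra ℝ L] (gr : OneGrading L)

/-- The projection of `L` onto the component of degree `i`. -/
def proj (i : ℤ) : L →ₗ[ℝ] L :=
  ((gr.comp i).subtype.comp (DirectSum.component ℝ ℤ (fun i => gr.comp i) i)).comp
    (LinearEquiv.ofBijective (DirectSum.coeLinearMap gr.comp) gr.isInternal).symm.toLinearMap

theorem proj_mem (i : ℤ) (x : L) : gr.proj i x ∈ gr.comp i :=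
  Subtype.property _

theorem proj_of_mem {i : ℤ} {x : L} (hx : x ∈ gr.comp i) : gr.proj i x = x := by
  have := gr.isInternal.ofBijective_coeLinearMap_of_mem hx
  simp only [proj, LinearMap.comp_apply, LinearEquiv.coe_coe, DirectSum.component]
  exact congrArg Subtype.val this

theorem proj_of_mem_ne {i j : ℤ} (hij : i ≠ j) {x : L} (hx : x ∈ gr.comp i) : gr.proj j x = 0 := by
  have := gr.isInternal.ofBijective_coeLinearMap_of_mem_ne hij hx
  simp only [proj, LinearMap.comp_apply, LinearEquiv.coe_coe, DirectSum.component]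
  exact congrArg Subtype.val this

/-- Induction over sums of homogeneous elements. -/
theorem induction {p : L → Prop} (x : L) (hp : ∀ i, ∀ x ∈ gr.comp i, p x)
    (hadd : ∀ x y, p x → p y → p (x + y)) : p x :=
  Submodule.iSup_induction gr.comp (motive := p)
    (gr.isInternal.submodule_iSup_eq_top ▸ Submodule.mem_top : x ∈ ⨆ i, gr.comp i) hp
    (hp 0 0 (zero_mem _)) hadd

theorem cases_of_mem {i : ℤ} {x : L} (hx : x ∈ gr.comp i) : x = 0 ∨ i = -1 ∨ i = 0 ∨ i = 1 := by
  by_cases h : 1 < |i|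
  · left
    simpa [gr.comp_eq_bot i h] using hx
  · right
    have := abs_le.1 (not_lt.1 h)
    omega

theorem proj_add_proj_add_proj (x : L) : gr.proj (-1) x + gr.proj 0 x + gr.proj 1 x = x := by
  induction x using gr.induction with
  | hadd x y hx hy =>
    simp only [map_add]
    calc _ = (gr.proj (-1) x + gr.proj 0 x + gr.proj 1 x) +
          (gr.proj (-1) y + gr.proj 0 y + gr.proj 1 y) := by abel
      _ = x + y := by rw [hx, hy]
  | hp i x hx =>
    obtain rfl | rfl | rfl | rfl := gr.cases_of_mem hx
    · simp
    · rw [gr.proj_of_mem hx, gr.proj_of_mem_ne (by norm_num) hx, gr.proj_of_mem_ne (by norm_num) hx]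
      simp
    · rw [gr.proj_of_mem hx, gr.proj_of_mem_ne (by norm_num) hx, gr.proj_of_mem_ne (by norm_num) hx]
      simp
    · rw [gr.proj_of_mem hx, gr.proj_of_mem_ne (by norm_num) hx, gr.proj_of_mem_ne (by norm_num) hx]
      simp

theorem mem_parabolic_iff {x : L} : x ∈ gr.parabolic ↔ gr.proj (-1) x = 0 := by
  constructor
  · intro h
    obtain ⟨y, hy, z, hz, rfl⟩ := Submodule.mem_sup.1 h
    rw [map_add, gr.proj_of_mem_ne (by norm_num) hy, gr.proj_of_mem_ne (by norm_num) hz, add_zero]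
  · intro h
    rw [← gr.proj_add_proj_add_proj x, h, zero_add]
    exact Submodule.add_mem_sup (gr.proj_mem 0 x) (gr.proj_mem 1 x)

theorem comp_zero_le : gr.comp 0 ≤ gr.parabolic := le_sup_left

theorem comp_one_le : gr.comp 1 ≤ gr.parabolic := le_sup_right

theorem eq_zero_of_mem_of_mem_parabolic {x : L} (hx : x ∈ gr.comp (-1)) (h : x ∈ gr.parabolic) :
    x = 0 := by
  rw [← gr.proj_of_mem hx, gr.mem_parabolic_iff.1 h]

/-- The operator which acts on `gr.comp i` by multiplication by `i`. -/
def degree : L →ₗ[ℝ] L := gr.proj 1 - gr.proj (-1)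

theorem degree_of_mem {i : ℤ} {x : L} (hx : x ∈ gr.comp i) : gr.degree x = (i : ℝ) • x := by
  rw [degree, LinearMap.sub_apply]
  obtain rfl | rfl | rfl | rfl := gr.cases_of_mem hx
  · simp
  · rw [gr.proj_of_mem hx, gr.proj_of_mem_ne (by norm_num) hx]; simp
  · rw [gr.proj_of_mem_ne (by norm_num) hx, gr.proj_of_mem_ne (by norm_num) hx]; simp
  · rw [gr.proj_of_mem hx, gr.proj_of_mem_ne (by norm_num) hx]; simp

/-- The operator `gr.degree` is a derivation, in the form that `LieDerivation` asks for. -/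
theorem degree_lie (a b : L) : gr.degree ⁅a, b⁆ = ⁅a, gr.degree b⁆ - ⁅b, gr.degree a⁆ := by
  induction a using gr.induction with
  | hadd x y hx hy => simp only [add_lie, map_add, lie_add, hx, hy]; abel
  | hp i a ha =>
    induction b using gr.induction with
    | hadd x y hx hy => simp only [add_lie, map_add, lie_add, hx, hy]; abel
    | hp j b hb =>
      rw [gr.degree_of_mem ha, gr.degree_of_mem hb, gr.degree_of_mem (gr.lie_mem i j a ha b hb),
        lie_smul, lie_smul, ← lie_skew a b]
      push_cast
      module

theorem mem_of_degree {x : L} {i : ℤ} (hi : i = -1 ∨ i = 0 ∨ i = 1)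
    (h : gr.degree x = (i : ℝ) • x) : x ∈ gr.comp i := by
  have hx := gr.proj_add_proj_add_proj x
  have h1 : ∀ j : ℤ, ((j : ℝ) - i) • gr.proj j x = 0 := by
    intro j
    have h2 := congrArg (gr.proj j) h
    have h3 : gr.degree x = (-1 : ℝ) • gr.proj (-1) x + (0 : ℝ) • gr.proj 0 x + (1 : ℝ) • gr.proj 1 x := by
      simp [degree]; abel
    by_cases hj : j = -1 ∨ j = 0 ∨ j = 1
    · have e : ∀ k : ℤ, k ≠ j → gr.proj j (gr.proj k x) = 0 := fun k hk => gr.proj_of_mem_ne hk (gr.proj_mem k x)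
      have e' : gr.proj j (gr.proj j x) = gr.proj j x := gr.proj_of_mem (gr.proj_mem j x)
      rw [h3] at h2
      simp only [map_add, map_smul] at h2
      rw [sub_smul, ← h2]
      obtain rfl | rfl | rfl := hj
      · rw [e', e 0 (by norm_num), e 1 (by norm_num)]; simp
      · rw [e', e (-1) (by norm_num), e 1 (by norm_num)]; simp
      · rw [e', e (-1) (by norm_num), e 0 (by norm_num)]; simp
    · have : gr.proj j x = 0 := by
        have := gr.cases_of_mem (gr.proj_mem j x)
        tauto
      simp [this]
  have h2 : ∀ j : ℤ, j ≠ i → gr.proj j x = 0 := fun j hj =>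
    (smul_eq_zero.1 (h1 j)).resolve_left (sub_ne_zero.2 (by exact_mod_cast hj))
  obtain rfl | rfl | rfl := hi
  · rw [h2 0 (by norm_num), h2 1 (by norm_num), add_zero, add_zero] at hx
    exact hx ▸ gr.proj_mem _ x
  · rw [h2 (-1) (by norm_num), h2 1 (by norm_num), add_zero, zero_add] at hx
    exact hx ▸ gr.proj_mem _ x
  · rw [h2 0 (by norm_num), h2 (-1) (by norm_num), add_zero, zero_add] at hx
    exact hx ▸ gr.proj_mem _ x

theorem lie_eq_zero_of_mem_one {x y : L} (hx : x ∈ gr.comp 1) (hy : y ∈ gr.comp 1) : ⁅x, y⁆ = 0 := by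
  have := gr.lie_mem 1 1 x hx y hy
  rwa [gr.comp_eq_bot _ (by norm_num), Submodule.mem_bot] at this

theorem lie_eq_zero_of_mem_neg_one {x y : L} (hx : x ∈ gr.comp (-1)) (hy : y ∈ gr.comp (-1)) :
    ⁅x, y⁆ = 0 := by
  have := gr.lie_mem (-1) (-1) x hx y hy
  rwa [gr.comp_eq_bot _ (by norm_num), Submodule.mem_bot] at this

theorem lie_mem_parabolic {x y : L} (hx : x ∈ gr.parabolic) (hy : y ∈ gr.parabolic) :
    ⁅x, y⁆ ∈ gr.parabolic := by
  obtain ⟨a, ha, b, hb, rfl⟩ := Submodule.mem_sup.1 hx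
  obtain ⟨c, hc, d, hd, rfl⟩ := Submodule.mem_sup.1 hy
  rw [add_lie, lie_add, lie_add, gr.lie_eq_zero_of_mem_one hb hd, add_zero]
  exact add_mem (add_mem (gr.comp_zero_le (gr.lie_mem 0 0 _ ha _ hc))
    (gr.comp_one_le (gr.lie_mem 0 1 _ ha _ hd))) (gr.comp_one_le (gr.lie_mem 1 0 _ hb _ hc))

variable [LieAlgebra.IsSimple ℝ L]

/-- A `|1|`-graded simple Lie algebra is generated by its components of degree `±1`. -/
theorem eq_top_of_lie_mem {S : Submodule ℝ L} (hS : ∀ x ∈ S, ∀ y ∈ S, ⁅x, y⁆ ∈ S)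
    (h1 : gr.comp (-1) ≤ S) (h2 : gr.comp 1 ≤ S) : S = ⊤ := by
  let N : Submodule ℝ L := Submodule.span ℝ {x | ∃ y ∈ gr.comp (-1), ∃ z ∈ gr.comp 1, x = ⁅y, z⁆}
  have hN0 : N ≤ gr.comp 0 := by
    refine Submodule.span_le.2 ?_
    rintro _ ⟨y, hy, z, hz, rfl⟩
    exact gr.lie_mem (-1) 1 y hy z hz
  have hNS : N ≤ S := by
    refine Submodule.span_le.2 ?_
    rintro _ ⟨y, hy, z, hz, rfl⟩
    exact hS y (h1 hy) z (h2 hz)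
  have hN : ∀ {y z}, y ∈ gr.comp (-1) → z ∈ gr.comp 1 → ⁅y, z⁆ ∈ N := fun hy hz =>
    Submodule.subset_span ⟨_, hy, _, hz, rfl⟩
  have h0N : ∀ a ∈ gr.comp 0, ∀ x ∈ N, ⁅a, x⁆ ∈ N := by
    intro a ha x hx
    induction hx using Submodule.span_induction with
    | mem x hx =>
      obtain ⟨y, hy, z, hz, rfl⟩ := hx
      rw [leibniz_lie]
      exact add_mem (hN (gr.lie_mem 0 (-1) _ ha _ hy) hz) (hN hy (gr.lie_mem 0 1 _ ha _ hz))
    | zero => simp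
    | add x y _ _ hx hy => rw [lie_add]; exact add_mem hx hy
    | smul c x _ hx => rw [lie_smul]; exact N.smul_mem c hx
  -- a nonzero ideal, hence all of `L`
  let I : LieIdeal ℝ L :=
    { toSubmodule := gr.comp (-1) ⊔ N ⊔ gr.comp 1
      lie_mem := by
        intro a m hm
        obtain ⟨m', hm', z, hz, rfl⟩ := Submodule.mem_sup.1 (show m ∈ gr.comp (-1) ⊔ N ⊔ gr.comp 1 from hm)
        obtain ⟨y, hy, x, hx, rfl⟩ := Submodule.mem_sup.1 hm'
        have k1 : ∀ {w}, w ∈ gr.comp (-1) → w ∈ gr.comp (-1) ⊔ N ⊔ gr.comp 1 := fun hw =>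
          Submodule.mem_sup_left (Submodule.mem_sup_left hw)
        have k2 : ∀ {w}, w ∈ N → w ∈ gr.comp (-1) ⊔ N ⊔ gr.comp 1 := fun hw =>
          Submodule.mem_sup_left (Submodule.mem_sup_right hw)
        have k3 : ∀ {w}, w ∈ gr.comp 1 → w ∈ gr.comp (-1) ⊔ N ⊔ gr.comp 1 := fun hw =>
          Submodule.mem_sup_right hw
        change ⁅a, y + x + z⁆ ∈ gr.comp (-1) ⊔ N ⊔ gr.comp 1
        rw [lie_add, lie_add]
        induction a using gr.induction with
        | hadd a b ha hb =>
          simp only [add_lie]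
          convert! add_mem ha hb using 1
          abel
        | hp i a ha =>
          obtain rfl | rfl | rfl | rfl := gr.cases_of_mem ha
          · simp
          · rw [gr.lie_eq_zero_of_mem_neg_one ha hy, zero_add]
            exact add_mem (k1 (gr.lie_mem (-1) 0 _ ha _ (hN0 hx))) (k2 (hN ha hz))
          · exact add_mem (add_mem (k1 (gr.lie_mem 0 (-1) _ ha _ hy)) (k2 (h0N a ha x hx)))
              (k3 (gr.lie_mem 0 1 _ ha _ hz))
          · rw [gr.lie_eq_zero_of_mem_one ha hz, add_zero, ← lie_skew a y]
            exact add_mem (k2 (N.neg_mem (hN hy ha))) (k3 (gr.lie_mem 1 0 _ ha _ (hN0 hx))) }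
  have hI : I = ⊤ := by
    refine (LieAlgebra.IsSimple.eq_bot_or_eq_top (R := ℝ) I).resolve_left fun h => gr.nontrivial ?_
    rw [eq_bot_iff]
    intro y hy
    have : y ∈ I := Submodule.mem_sup_left (Submodule.mem_sup_left hy)
    simpa [h] using this
  rw [eq_top_iff]
  intro x _
  have hx : x ∈ I := by rw [hI]; exact LieSubmodule.mem_top x
  exact (sup_le (sup_le h1 hNS) h2 : gr.comp (-1) ⊔ N ⊔ gr.comp 1 ≤ S) hx

variable [FiniteDimensional ℝ L]

/-- The grading element exists, since all derivations of a simple Lie algebra are inner. -/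
theorem exists_gradingElement : ∃ e : L, ∀ x, ⁅e, x⁆ = gr.degree x := by
  obtain ⟨e, he⟩ := LieDerivation.IsKilling.exists_eq_ad (R := ℝ) (L := L)
    { toLinearMap := gr.degree, leibniz' := gr.degree_lie }
  exact ⟨e, fun x => by simpa using congrArg (fun D : LieDerivation ℝ L L => D x) he⟩

/-- The grading element: it acts on `gr.comp i` by multiplication by `i`. -/
def elt : L := gr.exists_gradingElement.choose

theorem elt_lie (x : L) : ⁅gr.elt, x⁆ = gr.degree x := gr.exists_gradingElement.choose_spec x

theorem elt_lie_of_mem {i : ℤ} {x : L} (hx : x ∈ gr.comp i) : ⁅gr.elt, x⁆ = (i : ℝ) • x := by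
  rw [elt_lie, gr.degree_of_mem hx]

theorem elt_mem : gr.elt ∈ gr.comp 0 := by
  refine gr.mem_of_degree (by simp) ?_
  rw [← gr.elt_lie, lie_self]; simp

/-- The subalgebra `𝔭` is its own normalizer. -/
theorem mem_parabolic_of_lie {x : L} (h : ∀ y ∈ gr.parabolic, ⁅x, y⁆ ∈ gr.parabolic) :
    x ∈ gr.parabolic := by
  have h1 := h _ (gr.comp_zero_le gr.elt_mem)
  rw [← lie_skew, elt_lie, degree, LinearMap.sub_apply, neg_sub] at h1
  have h2 := gr.mem_parabolic_iff.1 h1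
  rw [map_sub, gr.proj_of_mem (gr.proj_mem _ x), gr.proj_of_mem_ne (by norm_num) (gr.proj_mem 1 x),
    sub_zero] at h2
  exact gr.mem_parabolic_iff.2 h2

theorem killingForm_eq_zero {i j : ℤ} (hij : i + j ≠ 0) {x y : L} (hx : x ∈ gr.comp i)
    (hy : y ∈ gr.comp j) : killingForm ℝ L x y = 0 := by
  have h := LieModule.traceForm_apply_lie_apply ℝ L L x gr.elt y
  rw [← lie_skew x, gr.elt_lie_of_mem hx, gr.elt_lie_of_mem hy] at h
  simp only [map_neg, map_smul, LinearMap.neg_apply, LinearMap.smul_apply, smul_eq_mul] at h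
  have h2 : ((i + j : ℤ) : ℝ) * killingForm ℝ L x y = 0 := by
    push_cast
    linear_combination -h
  exact (mul_eq_zero.1 h2).resolve_left (by exact_mod_cast hij)

theorem eq_zero_of_killingForm {x : L} (h : ∀ y, killingForm ℝ L x y = 0) : x = 0 :=
  (LieAlgebra.IsKilling.killingForm_nondegenerate ℝ L).1 x h

/-- The Killing form restricts to a nondegenerate pairing of the components of degree `±1`. -/
theorem eq_zero_of_killingForm_of_mem_one {z : L} (hz : z ∈ gr.comp 1)
    (h : ∀ y ∈ gr.comp (-1), killingForm ℝ L z y = 0) : z = 0 := by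
  refine eq_zero_of_killingForm fun y => ?_
  rw [← gr.proj_add_proj_add_proj y, map_add, map_add, h _ (gr.proj_mem _ _),
    gr.killingForm_eq_zero (by norm_num) hz (gr.proj_mem 0 y),
    gr.killingForm_eq_zero (by norm_num) hz (gr.proj_mem 1 y)]
  simp

theorem eq_zero_of_lie_eq_zero {x : L} (h : ∀ y : L, ⁅x, y⁆ = 0) : x = 0 := by
  refine eq_zero_of_killingForm fun y => ?_
  have : LieAlgebra.ad ℝ L x = 0 := by ext y; simpa using h y
  rw [killingForm_apply_apply, this]; simp

/-- The component of degree zero acts faithfully on the component of degree `-1`. -/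
theorem eq_zero_of_lie_neg_one {x : L} (hx : x ∈ gr.comp 0)
    (h : ∀ y ∈ gr.comp (-1), ⁅x, y⁆ = 0) : x = 0 := by
  have h1 : ∀ z ∈ gr.comp 1, ⁅x, z⁆ = 0 := by
    intro z hz
    refine gr.eq_zero_of_killingForm_of_mem_one (gr.lie_mem 0 1 x hx z hz) fun y hy => ?_
    have e : killingForm ℝ L ⁅z, x⁆ y = killingForm ℝ L z ⁅x, y⁆ :=
      LieModule.traceForm_apply_lie_apply ℝ L L z x y
    rw [h y hy, map_zero] at e
    rw [← lie_skew x z, map_neg, LinearMap.neg_apply, e, neg_zero]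
  let S : Submodule ℝ L := LinearMap.ker (LieAlgebra.ad ℝ L x : L →ₗ[ℝ] L)
  have hS : ∀ y, y ∈ S ↔ ⁅x, y⁆ = 0 := fun y => by simp [S]
  have : S = ⊤ := by
    refine gr.eq_top_of_lie_mem (fun a ha b hb => ?_) (fun y hy => (hS y).2 (h y hy))
      (fun y hy => (hS y).2 (h1 y hy))
    rw [hS] at *
    rw [leibniz_lie, ha, hb, zero_lie, lie_zero, add_zero]
  exact eq_zero_of_lie_eq_zero fun y => (hS y).1 (this ▸ Submodule.mem_top)

/-- An automorphism which preserves `𝔭` changes the grading element by an element of degree one. -/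
theorem map_elt_sub_mem (φ : L ≃ₗ⁅ℝ⁆ L) (hφ : ∀ x ∈ gr.parabolic, φ x ∈ gr.parabolic) :
    φ gr.elt - gr.elt ∈ gr.comp 1 := by
  have hD : ∀ w, ⁅gr.elt, w⁆ + w ∈ gr.parabolic := fun w => by
    rw [elt_lie, mem_parabolic_iff, degree, map_add, LinearMap.sub_apply, map_sub,
      gr.proj_of_mem (gr.proj_mem _ w), gr.proj_of_mem_ne (by norm_num) (gr.proj_mem 1 w)]
    simp
  set u := φ gr.elt - gr.elt with hu
  have hup : u ∈ gr.parabolic :=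
    sub_mem (hφ _ (gr.comp_zero_le gr.elt_mem)) (gr.comp_zero_le gr.elt_mem)
  have h1 : ∀ y, ⁅u, y⁆ ∈ gr.parabolic := by
    intro y
    have h2 := hφ _ (hD (φ.symm y))
    rw [map_add, LieEquiv.map_lie, LieEquiv.apply_symm_apply] at h2
    have h3 := sub_mem h2 (hD y)
    rwa [add_sub_add_right_eq_sub, ← sub_lie] at h3
  obtain ⟨a, ha, b, hb, hab⟩ := Submodule.mem_sup.1 hup
  have ha0 : a = 0 := by
    refine gr.eq_zero_of_lie_neg_one ha fun y hy => ?_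
    refine gr.eq_zero_of_mem_of_mem_parabolic (gr.lie_mem 0 (-1) a ha y hy) ?_
    have h2 := h1 y
    rw [← hab, add_lie] at h2
    have h3 : ⁅b, y⁆ ∈ gr.parabolic := gr.comp_zero_le (gr.lie_mem 1 (-1) b hb y hy)
    simpa using sub_mem h2 h3
  rw [← hab, ha0, zero_add]
  exact hb

theorem map_mem_of_map_elt (φ : L ≃ₗ⁅ℝ⁆ L) (hφ : φ gr.elt = gr.elt) {i : ℤ} {x : L}
    (hx : x ∈ gr.comp i) : φ x ∈ gr.comp i := by
  obtain rfl | hi := gr.cases_of_mem hx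
  · rw [map_zero]; exact zero_mem _
  · refine gr.mem_of_degree hi ?_
    rw [← elt_lie]
    nth_rw 1 [← hφ]
    rw [← LieEquiv.map_lie, gr.elt_lie_of_mem hx, map_smul]

theorem map_elt_of_map_mem (φ : L ≃ₗ⁅ℝ⁆ L) (hφ : ∀ i, ∀ x ∈ gr.comp i, φ x ∈ gr.comp i) :
    φ gr.elt = gr.elt := by
  rw [← sub_eq_zero]
  refine eq_zero_of_lie_eq_zero fun y => ?_
  obtain ⟨y, rfl⟩ : ∃ y', φ y' = y := ⟨φ.symm y, φ.apply_symm_apply y⟩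
  rw [sub_lie, sub_eq_zero, ← LieEquiv.map_lie]
  induction y using gr.induction with
  | hadd x y hx hy => rw [lie_add, map_add, map_add, lie_add, hx, hy]
  | hp i x hx => rw [gr.elt_lie_of_mem hx, gr.elt_lie_of_mem (hφ i x hx), map_smul]

/-- A graded automorphism which is trivial on `L / 𝔭` is trivial. -/
theorem eq_of_map_sub_mem (φ : L ≃ₗ⁅ℝ⁆ L) (hφ : ∀ i, ∀ x ∈ gr.comp i, φ x ∈ gr.comp i)
    (h : ∀ x, φ x - x ∈ gr.parabolic) (x : L) : φ x = x := by
  have h1 : ∀ y ∈ gr.comp (-1), φ y = y := fun y hy =>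
    sub_eq_zero.1 (gr.eq_zero_of_mem_of_mem_parabolic (sub_mem (hφ _ y hy) hy) (h y))
  have h2 : ∀ z ∈ gr.comp 1, φ z = z := by
    intro z hz
    rw [← sub_eq_zero]
    refine gr.eq_zero_of_killingForm_of_mem_one (sub_mem (hφ _ z hz) hz) fun y hy => ?_
    have e := LieAlgebra.killingForm_of_equiv_apply φ z y
    rw [h1 y hy] at e
    rw [map_sub, LinearMap.sub_apply, e, sub_self]
  let S : Submodule ℝ L := LinearMap.eqLocus (φ : L →ₗ[ℝ] L) LinearMap.id
  have hS : ∀ y, y ∈ S ↔ φ y = y := fun y => by simp [S]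
  have : S = ⊤ := by
    refine gr.eq_top_of_lie_mem (fun a ha b hb => ?_) (fun y hy => (hS y).2 (h1 y hy))
      (fun y hy => (hS y).2 (h2 y hy))
    rw [hS] at *
    rw [LieEquiv.map_lie, ha, hb]
  exact (hS x).1 (this ▸ Submodule.mem_top)

end OneGrading

/-! ### The subgroups `G₀` and `P₊` of `P` -/

section
variable {E : Type*} [NormedAddCommGroup E] [NormedSpace ℝ E] [FiniteDimensional ℝ E]
  {G : Type*} [TopologicalSpace G] [ChartedSpace E G] [Group G] [LieGroup 𝓘(ℝ, E) ∞ G]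

instance instFiniteDimensionalLieAlg : FiniteDimensional ℝ (LieAlg E G) :=
  inferInstanceAs (FiniteDimensional ℝ E)

omit [FiniteDimensional ℝ E] in
theorem Ad_mul_apply (g h : G) (v : LieAlg E G) : Ad E G (g * h) v = Ad E G g (Ad E G h v) :=
  adCLM_mul_apply (E := E) g h v

/-- `Ad(g)` as an automorphism of the Lie algebra. -/
def adEquiv (g : G) : LieAlg E G ≃ₗ⁅ℝ⁆ LieAlg E G :=
  { Ad E G g with
    map_lie' := fun {v w} => by
      have h := adDeriv_adCLM (E := E) g v w
      exact (adDeriv_apply (E := E) (G := G) (Ad E G g v) (Ad E G g w)).symm.trans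
        (h.trans (congrArg (adCLM g) (adDeriv_apply (E := E) (G := G) v w))) |>.symm
    invFun := Ad E G g⁻¹
    left_inv := fun v => adCLM_inv_apply_self (E := E) g v
    right_inv := fun v => adCLM_apply_inv_self (E := E) g v }

theorem Ad_lie (g : G) (v w : LieAlg E G) : Ad E G g ⁅v, w⁆ = ⁅Ad E G g v, Ad E G g w⁆ :=
  (adEquiv g).map_lie v w

namespace AHSPair

variable (A : AHSPair E G)

/-- The grading element of an AHS-pair. -/
def elt : LieAlg E G :=
  haveI := A.simple
  A.grading.elt

theorem lie_elt_of_mem_one {Z : LieAlg E G} (hZ : Z ∈ A.grading.comp 1) : ⁅Z, A.elt⁆ = -Z := by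
  have := A.simple
  rw [← lie_skew, elt, A.grading.elt_lie_of_mem hZ]; simp

theorem Ad_mem_p {g : G} (hg : g ∈ A.P) {v : LieAlg E G} (hv : v ∈ A.p) : Ad E G g v ∈ A.p :=
  A.P_subset_normalizer hg v hv

theorem Ad_elt_sub_mem {g : G} (hg : g ∈ A.P) : Ad E G g A.elt - A.elt ∈ A.grading.comp 1 :=
  have := A.simple
  A.grading.map_elt_sub_mem (adEquiv g) fun _ hx => A.Ad_mem_p hg hx

/-- `G₀` is the stabilizer of the grading element in `P`. -/
theorem mem_G₀_iff {g : A.P} : g ∈ A.G₀ ↔ Ad E G g A.elt = A.elt := by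
  have := A.simple
  refine ⟨fun h => A.grading.map_elt_of_map_mem (adEquiv (g : G)) h, fun h i x hx => ?_⟩
  exact A.grading.map_mem_of_map_elt (adEquiv (g : G)) h hx

/-- The adjoint action of `P` preserves `𝔤₁`: apply `Ad(g)` to `[e, Z] = Z` and use that `Ad(g)`
changes the grading element `e` by an element of `𝔤₁`. -/
theorem Ad_mem_one {g : G} (hg : g ∈ A.P) {Z : LieAlg E G} (hZ : Z ∈ A.grading.comp 1) :
    Ad E G g Z ∈ A.grading.comp 1 := by
  have := A.simple
  set W := Ad E G g A.elt - A.elt with hW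
  have hW1 : W ∈ A.grading.comp 1 := A.Ad_elt_sub_mem hg
  obtain ⟨a, ha, b, hb, hab⟩ := Submodule.mem_sup.1 (A.Ad_mem_p hg (A.grading.comp_one_le hZ))
  have h1 : ⁅Ad E G g A.elt, Ad E G g Z⁆ = Ad E G g Z := by
    rw [← Ad_lie, elt, A.grading.elt_lie_of_mem hZ]; simp
  have h2 : Ad E G g A.elt = A.elt + W := by rw [hW]; abel
  rw [h2, ← hab, add_lie, lie_add, lie_add, A.grading.lie_eq_zero_of_mem_one hW1 hb, elt,
    A.grading.elt_lie_of_mem ha, A.grading.elt_lie_of_mem hb] at h1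
  have h3 : a = ⁅W, a⁆ := by
    have : ⁅W, a⁆ - a = 0 := by rw [← sub_eq_zero] at h1; rw [← h1]; simp; abel
    exact (sub_eq_zero.1 this).symm
  have h4 : a ∈ A.grading.comp 1 := h3 ▸ A.grading.lie_mem 1 0 W hW1 a ha
  rw [← hab]
  exact add_mem h4 hb

theorem mem_adNormalizer_of_isOneParam {γ : ℝ → G} {X : LieAlg E G} (hγ : IsOneParam (E := E) γ X)
    (hX : X ∈ A.p) (t : ℝ) : γ t ∈ adNormalizer A.p := by
  intro v hv
  refine hγ.adCLM_mem (S := A.p) (fun w hw => ?_) hv t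
  have h := A.grading.lie_mem_parabolic hX (y := (w : LieAlg E G)) hw
  have e : (adDeriv E G X w : E) = (⁅X, (w : LieAlg E G)⁆ : LieAlg E G) :=
    adDeriv_apply (E := E) (G := G) X w
  exact e ▸ h

/-- The one-parameter subgroups with velocity in `𝔭` lie in `P`, since they stay in the identity
component of the normalizer of `𝔭`. -/
theorem mem_P_of_isOneParam {γ : ℝ → G} {X : LieAlg E G} (hγ : IsOneParam (E := E) γ X)
    (hX : X ∈ A.p) (t : ℝ) : γ t ∈ A.P := by
  apply A.component_subset_P
  have h1 : IsPreconnected (Set.range γ) := isPreconnected_range hγ.contMDiff.continuous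
  refine h1.subset_connectedComponentIn ⟨0, hγ.map_zero⟩ ?_ ⟨t, rfl⟩
  rintro _ ⟨s, rfl⟩
  exact A.mem_adNormalizer_of_isOneParam hγ hX s

section Exponential

variable [T2Space G]

omit [FiniteDimensional ℝ E] in
theorem adCLM_lieExp_apply_eq_add [CompleteSpace E] {X v w : E} (hv : adDeriv E G X v = w)
    (hw : adDeriv E G X w = 0) : adCLM (lieExp (G := G) X) v = v + w := by
  have h := (isOneParam_lieExp (E := E) (G := G) X).adCLM_apply_eq_add hv hw 1
  rwa [one_smul, one_smul] at h

omit [FiniteDimensional ℝ E] in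
/-- If `L` vanishes on the derivatives of the curve `Ad(exp(tX)) v`, it is constant along the curve. -/
theorem map_adCLM_lieExp_eq [CompleteSpace E] {W : Type*} [NormedAddCommGroup W] [NormedSpace ℝ W]
    {X v : E} (L : E →L[ℝ] W)
    (h : ∀ t : ℝ, L (adCLM (lieExp (G := G) (t • X)) (adDeriv E G X v)) = 0) :
    L (adCLM (lieExp (G := G) X) v) = L v := by
  have h1 : ∀ t, HasDerivAt (fun t : ℝ => L (adCLM (lieExp (G := G) (t • X)) v)) 0 t := by
    intro t
    have h2 := L.hasFDerivAt.comp_hasDerivAt t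
      ((isOneParam_lieExp (E := E) (G := G) X).hasDerivAt_adCLM_apply v t)
    rwa [h t] at h2
  have h2 := is_const_of_deriv_eq_zero (fun t => (h1 t).differentiableAt) (fun t => (h1 t).deriv) 1 0
  rwa [one_smul, zero_smul, lieExp_zero, adCLM_one] at h2

theorem Ad_lieExp_apply_eq_add {Z v w : LieAlg E G} (hv : ⁅Z, v⁆ = w) (hw : ⁅Z, w⁆ = 0) :
    Ad E G (lieExp (E := E) Z) v = v + w :=
  adCLM_lieExp_apply_eq_add (E := E) ((adDeriv_apply (E := E) (G := G) Z v).trans hv)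
    ((adDeriv_apply (E := E) (G := G) Z w).trans hw)

theorem lieExp_mem_P {X : LieAlg E G} (hX : X ∈ A.p) : lieExp (E := E) X ∈ A.P := by
  have hγ := isOneParam_lieExp (E := E) (G := G) X
  exact (congrArg (· ∈ A.P) hγ.apply_one).mp (A.mem_P_of_isOneParam hγ hX 1)

omit [FiniteDimensional ℝ E] in
theorem lieExp_zero_lieAlg [CompleteSpace E] : lieExp (E := E) (0 : LieAlg E G) = (1 : G) :=
  lieExp_zero

theorem lieExp_add_of_mem_one {Z W : LieAlg E G} (hZ : Z ∈ A.grading.comp 1)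
    (hW : W ∈ A.grading.comp 1) :
    lieExp (G := G) (E := E) (Z + W) = lieExp (E := E) Z * lieExp (E := E) W :=
  lieExp_add (E := E) ((adDeriv_apply (E := E) (G := G) Z W).trans
    (A.grading.lie_eq_zero_of_mem_one hZ hW))

omit [FiniteDimensional ℝ E] in
theorem conj_lieExp [CompleteSpace E] (g : G) (X : E) :
    g * lieExp X * g⁻¹ = lieExp (adCLM g X) := by
  have h := ((isOneParam_lieExp (G := G) X).conj g).apply_one
  rwa [one_smul] at h

/-- The elements of `exp(𝔤₁)` act trivially on `𝔤 / 𝔭`. -/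
theorem Ad_lieExp_sub_mem {Z : LieAlg E G} (hZ : Z ∈ A.grading.comp 1) (v : LieAlg E G) :
    Ad E G (lieExp (E := E) Z) v - v ∈ A.p := by
  have hγ := isOneParam_lieExp (E := E) (G := G) Z
  have hZv : ⁅Z, v⁆ ∈ A.p := by
    rw [← A.grading.proj_add_proj_add_proj v, lie_add, lie_add]
    refine add_mem (add_mem (A.grading.comp_zero_le ?_) (A.grading.comp_one_le ?_)) ?_
    · exact A.grading.lie_mem 1 (-1) _ hZ _ (A.grading.proj_mem _ _)
    · exact A.grading.lie_mem 1 0 _ hZ _ (A.grading.proj_mem _ _)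
    · rw [A.grading.lie_eq_zero_of_mem_one hZ (A.grading.proj_mem _ _)]; exact zero_mem _
  rw [A.grading.mem_parabolic_iff, map_sub, sub_eq_zero]
  let L : E →ₗ[ℝ] E := A.grading.proj (-1)
  let Z' : E := Z
  refine map_adCLM_lieExp_eq (E := E) (G := G) (LinearMap.toContinuousLinearMap L) fun t => ?_
  let Y : E := adCLM (lieExp (G := G) (t • Z')) (adDeriv E G Z' v)
  refine (A.grading.mem_parabolic_iff (x := Y)).1 ?_
  refine A.mem_adNormalizer_of_isOneParam hγ (A.grading.comp_one_le hZ) t _ ?_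
  have e : (adDeriv E G Z v : E) = (⁅Z, v⁆ : LieAlg E G) :=
    adDeriv_apply (E := E) (G := G) Z v
  exact e ▸ hZv

theorem mem_expImage_iff {S : Set (LieAlg E G)} {g : G} :
    g ∈ expImage S ↔ ∃ X ∈ S, g = lieExp (E := E) X := by
  constructor
  · rintro ⟨X, hX, γ, h1, h2, h3, rfl⟩
    exact ⟨X, hX, IsOneParam.apply_one (E := E) ⟨h1, h2, h3⟩⟩
  · rintro ⟨X, hX, rfl⟩
    have h := isOneParam_lieExp (E := E) (G := G) X
    exact ⟨X, hX, _, h.contMDiff, h.map_add, h.velocity, h.apply_one⟩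

/-- Since `𝔤₁` is commutative, `exp(𝔤₁)` is a subgroup. -/
theorem mem_Pplus_iff {g : A.P} :
    g ∈ A.Pplus ↔ ∃ Z ∈ A.grading.comp 1, (g : G) = lieExp (E := E) Z := by
  constructor
  · intro hg
    have hg' : (g : G) ∈ Subgroup.closure (expImage (A.grading.comp 1 : Set (LieAlg E G))) := hg
    refine Subgroup.closure_induction (p := fun x _ => ∃ Z ∈ A.grading.comp 1, x = lieExp (E := E) Z)
      (fun x hx => mem_expImage_iff.1 hx) ⟨0, zero_mem _, lieExp_zero.symm⟩ ?_ ?_ hg'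
    · rintro _ _ _ _ ⟨Z, hZ, rfl⟩ ⟨W, hW, rfl⟩
      exact ⟨Z + W, add_mem hZ hW, (A.lieExp_add_of_mem_one hZ hW).symm⟩
    · rintro _ _ ⟨Z, hZ, rfl⟩
      refine ⟨-Z, neg_mem hZ, ?_⟩
      rw [inv_eq_iff_mul_eq_one, ← A.lieExp_add_of_mem_one hZ (neg_mem hZ), add_neg_cancel]
      exact lieExp_zero
  · rintro ⟨Z, hZ, h⟩
    exact Subgroup.subset_closure (mem_expImage_iff.2 ⟨Z, hZ, h⟩)

/-- The change `Ad(g)(e) - e` of the grading element `e`; it lies in `𝔤₁` for `g` in `P`. -/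
def nilpart (g : G) : LieAlg E G := Ad E G g A.elt - A.elt

omit [T2Space G] in
theorem nilpart_mem {g : G} (hg : g ∈ A.P) : A.nilpart g ∈ A.grading.comp 1 :=
  A.Ad_elt_sub_mem hg

omit [T2Space G] in
theorem nilpart_mul (g h : G) : A.nilpart (g * h) = A.nilpart g + Ad E G g (A.nilpart h) := by
  rw [nilpart, nilpart, nilpart, map_sub, Ad_mul_apply]; abel

theorem nilpart_lieExp {Z : LieAlg E G} (hZ : Z ∈ A.grading.comp 1) :
    A.nilpart (lieExp (E := E) Z) = -Z := by
  rw [nilpart, Ad_lieExp_apply_eq_add (A.lie_elt_of_mem_one hZ) (by simp), add_sub_cancel_left]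

/-- The projection `P → G₀` with kernel `P₊`. It sends `g` to `exp(Z) g` with `Z = Ad(g)(e) - e` for the
grading element `e`; since `Ad(exp(Z))(e) = e - Z`, this product stabilizes `e`. -/
def levi : A.P →* A.G₀ where
  toFun g := ⟨⟨lieExp (E := E) (A.nilpart g) * g,
      mul_mem (A.lieExp_mem_P (A.grading.comp_one_le (A.nilpart_mem g.2))) g.2⟩, by
    rw [mem_G₀_iff, ← sub_eq_zero]
    change A.nilpart _ = 0
    rw [nilpart_mul, A.nilpart_lieExp (A.nilpart_mem g.2),
      Ad_lieExp_apply_eq_add (w := 0) (lie_self _) (lie_zero _), add_zero, neg_add_cancel]⟩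
  map_one' := by
    ext
    have : A.nilpart 1 = 0 := by rw [nilpart, map_one]; simp
    simp only [OneMemClass.coe_one, this, mul_one]
    exact lieExp_zero
  map_mul' g h := by
    ext
    simp only [Subgroup.coe_mul, nilpart_mul]
    rw [A.lieExp_add_of_mem_one (A.nilpart_mem g.2) (A.Ad_mem_one g.2 (A.nilpart_mem h.2))]
    have h1 : (g : G) * lieExp (E := E) (A.nilpart h) * (g : G)⁻¹ =
      lieExp (E := E) (Ad E G g (A.nilpart h)) := conj_lieExp (E := E) (g : G) (A.nilpart h)
    rw [← h1]
    group

theorem coe_levi (g : A.P) : ((A.levi g : A.P) : G) = lieExp (E := E) (A.nilpart g) * g := rfl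

theorem levi_coe (g : A.G₀) : A.levi g = g := by
  ext
  have : A.nilpart (g : A.P) = 0 := sub_eq_zero.2 (A.mem_G₀_iff.1 g.2)
  rw [coe_levi, this]
  exact (congrArg (· * ((g : A.P) : G)) lieExp_zero).trans (one_mul _)

theorem levi_eq_one_iff {g : A.P} : A.levi g = 1 ↔ g ∈ A.Pplus := by
  rw [mem_Pplus_iff]
  constructor
  · intro h
    have h1 : lieExp (E := E) (A.nilpart g) * (g : G) = 1 := by rw [← coe_levi, h]; rfl
    refine ⟨-A.nilpart g, neg_mem (A.nilpart_mem g.2), ?_⟩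
    have h2 := A.lieExp_add_of_mem_one (A.nilpart_mem g.2) (neg_mem (A.nilpart_mem g.2))
    rw [add_neg_cancel, lieExp_zero_lieAlg] at h2
    exact mul_left_cancel (h1.trans h2)
  · rintro ⟨Z, hZ, h⟩
    ext
    have h2 := A.lieExp_add_of_mem_one (neg_mem hZ) hZ
    rw [neg_add_cancel, lieExp_zero_lieAlg] at h2
    rw [coe_levi, h, A.nilpart_lieExp hZ, ← h2]
    rfl

/-- `P₊` acts trivially on `𝔤 / 𝔭`. -/
theorem adQuot_of_mem_Pplus {g : A.P} (hg : g ∈ A.Pplus) : A.adQuot g = 1 := by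
  obtain ⟨Z, hZ, h⟩ := A.mem_Pplus_iff.1 hg
  refine LinearMap.ext fun v => ?_
  obtain ⟨v, rfl⟩ := Submodule.mkQ_surjective _ v
  have h1 := A.Ad_lieExp_sub_mem hZ v
  rw [← h] at h1
  exact (Submodule.Quotient.eq _).2 h1

end Exponential

section Embedded

variable [T2Space G] {A} {EP : Type*} [NormedAddCommGroup EP] [NormedSpace ℝ EP]
  [ChartedSpace EP A.P]
  (hP : Manifold.IsSmoothEmbedding 𝓘(ℝ, EP) 𝓘(ℝ, E) ∞ (Subtype.val : A.P → G))

include hP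

omit [T2Space G] in
/-- Maps to an embedded subgroup are smooth if they are smooth as maps to the group. -/
theorem contMDiff_toP {EN : Type*} [NormedAddCommGroup EN] [NormedSpace ℝ EN] {HN : Type*}
    [TopologicalSpace HN] {I : ModelWithCorners ℝ EN HN}
    {N : Type*} [TopologicalSpace N] [ChartedSpace HN N] {f : N → A.P}
    (hf : ContMDiff I 𝓘(ℝ, E) ∞ (fun x => (f x : G))) : ContMDiff I 𝓘(ℝ, EP) ∞ f :=
  (ContMDiff.iff_comp_isImmersion hP.isImmersion).2
    ⟨hP.isEmbedding.continuous_iff.2 hf.continuous, hf⟩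

omit [T2Space G] in
theorem hasMFDerivAt_val {y : A.P} (hy : y = 1) : HasMFDerivAt 𝓘(ℝ, EP) 𝓘(ℝ, E)
    (Subtype.val : A.P → G) y
    (mfderiv 𝓘(ℝ, EP) 𝓘(ℝ, E) (Subtype.val : A.P → G) 1 : EP →L[ℝ] E) := by
  subst hy
  exact (hP.contMDiff.mdifferentiable (by simp) _).hasMFDerivAt

/-- The Lie algebra of `P` is `𝔭`: it normalizes `𝔭`, which is its own normalizer, and the one-parameter
subgroups with velocity in `𝔭` lie in `P`. -/
theorem range_mfderiv_val : Set.range (mfderiv 𝓘(ℝ, EP) 𝓘(ℝ, E) (Subtype.val : A.P → G) 1) =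
    (A.p : Set (LieAlg E G)) := by
  have := A.simple
  ext X
  constructor
  · rintro ⟨a, rfl⟩
    set D : EP →L[ℝ] E := mfderiv 𝓘(ℝ, EP) 𝓘(ℝ, E) (Subtype.val : A.P → G) 1 with hD
    refine A.grading.mem_parabolic_of_lie (x := D a) fun v hv => ?_
    have hval := hasMFDerivAt_val hP (rfl : (1 : A.P) = 1)
    have h1 := (hasMFDerivAt_adCLM_one (E := E) (G := G)).comp (1 : A.P) hval
    let Λ : (E →L[ℝ] E) →L[ℝ] E :=
      (LinearMap.toContinuousLinearMap (A.grading.proj (-1)) : E →L[ℝ] E).comp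
        (ContinuousLinearMap.apply ℝ E v)
    have h2 := (Λ.hasFDerivAt.hasMFDerivAt (x := adCLM ((1 : A.P) : G))).comp (1 : A.P) h1
    have h3 : (Λ ∘ (adCLM : G → (E →L[ℝ] E)) ∘ (Subtype.val : A.P → G)) = fun _ => (0 : E) := by
      funext g
      exact A.grading.mem_parabolic_iff.1 (A.Ad_mem_p g.2 hv)
    rw [h3] at h2
    have h4 := h2.mfderiv.symm.trans (mfderiv_const (c := (0 : E)))
    have h5 : Λ (adDeriv E G (D a)) = 0 := DFunLike.congr_fun h4 a
    rw [A.grading.mem_parabolic_iff]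
    exact (congrArg (A.grading.proj (-1)) (adDeriv_apply (E := E) (G := G) (D a) v)).symm.trans h5
  · intro hX
    have hγ := isOneParam_lieExp (E := E) (G := G) X
    let δ : ℝ → A.P := fun t => ⟨_, A.mem_P_of_isOneParam hγ hX t⟩
    have hδ : ContMDiff 𝓘(ℝ, ℝ) 𝓘(ℝ, EP) ∞ δ := contMDiff_toP hP hγ.contMDiff
    have h1 := (hδ.mdifferentiable (by simp) 0).hasMFDerivAt
    have h2 := (hasMFDerivAt_val hP (y := δ 0) (Subtype.ext hγ.map_zero)).comp (0 : ℝ) h1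
    have h3 := h2.mfderiv.symm.trans hγ.hasMFDerivAt_zero.mfderiv
    refine ⟨(mfderiv 𝓘(ℝ, ℝ) 𝓘(ℝ, EP) δ 0 (1 : ℝ) : EP), ?_⟩
    exact (DFunLike.congr_fun h3 (1 : ℝ)).trans (one_smul ℝ (X : E))

variable {EP₀ : Type*} [NormedAddCommGroup EP₀] [NormedSpace ℝ EP₀]
  [ChartedSpace EP₀ A.G₀]
  (hG₀ : Manifold.IsSmoothEmbedding 𝓘(ℝ, EP₀) 𝓘(ℝ, EP) ∞ (Subtype.val : A.G₀ → A.P))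

include hG₀

/-- The projection `P → G₀` is smooth, since the exponential map is smooth on `𝔤₁`. -/
theorem contMDiff_levi : ContMDiff 𝓘(ℝ, EP) 𝓘(ℝ, EP₀) ∞ A.levi := by
  have h : ContMDiff 𝓘(ℝ, EP) 𝓘(ℝ, EP) ∞ (fun g => (A.levi g : A.P)) := by
    refine contMDiff_toP hP ?_
    let F : E →ₗ[ℝ] E := A.grading.proj 1
    have hF : ∀ x y, adDeriv E G (F x) (F y) = 0 := fun x y =>
      (adDeriv_apply (E := E) (G := G) (F x) (F y)).trans (A.grading.lie_eq_zero_of_mem_one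
        (A.grading.proj_mem 1 x) (A.grading.proj_mem 1 y))
    have h1 : ContMDiff 𝓘(ℝ, EP) 𝓘(ℝ, E) ∞ (fun g : A.P => F (A.nilpart g)) := by
      let e : E := A.elt
      have h3 : ContDiff ℝ ∞ (fun T : E →L[ℝ] E => F (T e - e)) :=
        (LinearMap.toContinuousLinearMap F).contDiff.comp
          ((ContinuousLinearMap.apply ℝ E e).contDiff.sub contDiff_const)
      exact h3.contMDiff.comp ((contMDiff_adCLM (E := E) (G := G)).comp hP.contMDiff)
    refine (((contMDiff_lieExp_comp F hF).comp h1).mul hP.contMDiff).congr fun g => ?_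
    rw [coe_levi, Pi.mul_apply]
    refine congrArg (fun Z : E => lieExp Z * (g : G)) ?_
    have e1 := A.grading.proj_of_mem (A.nilpart_mem g.2)
    exact ((congrArg F e1).trans e1).symm
  exact (ContMDiff.iff_comp_isImmersion hG₀.isImmersion).2 ⟨hG₀.isEmbedding.continuous_iff.2
    h.continuous, h⟩

end Embedded

end AHSPair
end

/-! ### Automorphisms of the Lie algebra near the identity -/

section
variable {E : Type*} [NormedAddCommGroup E] [NormedSpace ℝ E] [FiniteDimensional ℝ E]

open Filter Topology

/-- If the derivative at `x` is injective, `x` is isolated in its level set. -/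
theorem eventually_eq_of_hasFDerivAt {W V : Type*} [NormedAddCommGroup W] [NormedSpace ℝ W]
    [FiniteDimensional ℝ W] [NormedAddCommGroup V] [NormedSpace ℝ V] {f : W → V} {f' : W →L[ℝ] V}
    {x : W} (hf : HasFDerivAt f f' x) (hinj : ∀ w, f' w = 0 → w = 0) (c : V) :
    ∀ᶠ y in 𝓝 x, f y = c → y = x := by
  obtain ⟨C, -, hC⟩ := (f' : W →ₗ[ℝ] V).exists_antilipschitzWith
    (LinearMap.ker_eq_bot'.2 hinj)
  have h := hf.eventually_ne ⟨C, hC⟩ (c := c)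
  rw [eventually_nhdsWithin_iff] at h
  filter_upwards [h] with y hy h1
  by_contra hne
  exact hy hne h1

/-- A complement of the range of a linear map, parametrized by some `ℝᵐ`. -/
theorem exists_complement_range {V R : Type*} [AddCommGroup V] [Module ℝ V] [NormedAddCommGroup R]
    [NormedSpace ℝ R] [FiniteDimensional ℝ R] (f : V →ₗ[ℝ] R) :
    ∃ (m : ℕ) (ι : (Fin m → ℝ) →L[ℝ] R), (∀ T, ∃ a w, f a + ι w = T) ∧
      ∀ a w, f a = ι w → w = 0 := by
  obtain ⟨K, hK⟩ := Submodule.exists_isCompl f.range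
  let e := (Module.finBasis ℝ K).equivFun
  refine ⟨_, LinearMap.toContinuousLinearMap (K.subtype.comp e.symm.toLinearMap), fun T => ?_,
    fun a w h => ?_⟩
  · obtain ⟨_, ⟨a, rfl⟩, k, hk, h⟩ := Submodule.mem_sup.1
      (hK.sup_eq_top ▸ Submodule.mem_top : T ∈ f.range ⊔ K)
    exact ⟨a, e ⟨k, hk⟩, by simpa using h⟩
  · have h1 : f a = (e.symm w : K) := h
    have h2 := Submodule.disjoint_def.1 hK.disjoint _ ⟨a, rfl⟩ (h1 ▸ (e.symm w).2)
    rw [h1] at h2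
    exact e.symm.map_eq_zero_iff.1 (Subtype.ext h2)

/-- If the range of `ι` complements the derivative of the family `f` of operators, then the operators
near the identity are of the form `f(a) ∘ (1 + ι(w))`, by the inverse function theorem. -/
theorem map_nhds_comp_eq {V W : Type*}
    [NormedAddCommGroup V] [NormedSpace ℝ V] [FiniteDimensional ℝ V]
    [NormedAddCommGroup W] [NormedSpace ℝ W] [FiniteDimensional ℝ W]
    {f : V → (E →L[ℝ] E)} {f' : V →L[ℝ] (E →L[ℝ] E)} {y₀ : V} (hf : HasStrictFDerivAt f f' y₀)
    (hf₀ : f y₀ = ContinuousLinearMap.id ℝ E)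
    (ι : W →L[ℝ] (E →L[ℝ] E)) (hsurj : ∀ T, ∃ a w, f' a + ι w = T) :
    map (fun z : V × W => (f z.1).comp (ContinuousLinearMap.id ℝ E + ι z.2)) (𝓝 (y₀, 0)) =
      𝓝 (ContinuousLinearMap.id ℝ E) := by
  have : CompleteSpace E := FiniteDimensional.complete ℝ E
  have : CompleteSpace V := FiniteDimensional.complete ℝ V
  have : CompleteSpace W := FiniteDimensional.complete ℝ W
  have h1 : HasStrictFDerivAt (fun z : V × W => f z.1)
      (f'.comp (ContinuousLinearMap.fst ℝ V W)) (y₀, 0) :=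
    HasStrictFDerivAt.comp (y₀, (0 : W)) (f := Prod.fst) hf hasStrictFDerivAt_fst
  have h2 : HasStrictFDerivAt (fun z : V × W => ContinuousLinearMap.id ℝ E + ι z.2)
      (ι.comp (ContinuousLinearMap.snd ℝ V W)) (y₀, 0) :=
    (ι.hasStrictFDerivAt.comp (y₀, (0 : W)) (f := Prod.snd) hasStrictFDerivAt_snd).const_add _
  have h3 := (h1.clm_comp h2).map_nhds_eq_of_surj (by
    rw [eq_top_iff]
    intro T _
    obtain ⟨a, w, h⟩ := hsurj T
    refine ⟨(a, w), ?_⟩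
    rw [← h]
    ext v
    simp [hf₀, add_comm])
  have h4 : (fun z : V × W => (f z.1).comp (ContinuousLinearMap.id ℝ E + ι z.2)) (y₀, 0) =
    ContinuousLinearMap.id ℝ E := by simp [hf₀]
  exact h3.trans (congrArg 𝓝 h4)

/-- Near the identity, an automorphism of the bilinear map `B` which preserves the kernel of the
projection `p` and differs from the identity by an element of `W` is trivial, provided that
`W` contains no derivations of `B` which preserve this kernel. -/
theorem eventually_eq_zero_of_map_bilinear {W : Type*} [NormedAddCommGroup W] [NormedSpace ℝ W]
    [FiniteDimensional ℝ W] (B : E →L[ℝ] E →L[ℝ] E) (p : E →L[ℝ] E) (ι : W →L[ℝ] (E →L[ℝ] E))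
    (hι : ∀ k, (∀ v w, ι k (B v w) = B (ι k v) w + B v (ι k w)) → (∀ v, p (ι k (v - p v)) = 0) →
      k = 0) :
    ∀ᶠ k : W in 𝓝 0, (∀ v w, (B v w + ι k (B v w)) = B (v + ι k v) (w + ι k w)) →
      (∀ v, p (ι k (v - p v)) = 0) → k = 0 := by
  let b := Module.finBasis ℝ E
  let ev : E → (W →L[ℝ] E) := fun v => (ContinuousLinearMap.apply ℝ E v).comp ι
  let f₁ : ∀ i j, W →L[ℝ] E := fun i j =>
    ev (B (b i) (b j)) - (B.flip (b j)).comp (ev (b i)) - (B (b i)).comp (ev (b j))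
  let f₂ : W →L[ℝ] (E →L[ℝ] E) :=
    (ContinuousLinearMap.compL ℝ E E E p).comp
      (((ContinuousLinearMap.compL ℝ E E E).flip (ContinuousLinearMap.id ℝ E - p)).comp ι)
  let g₁' : W →L[ℝ] (Fin (Module.finrank ℝ E) → Fin (Module.finrank ℝ E) → E) :=
    ContinuousLinearMap.pi fun i => ContinuousLinearMap.pi fun j => f₁ i j
  let g₁ : W → (Fin (Module.finrank ℝ E) → Fin (Module.finrank ℝ E) → E) := fun k i j =>
    f₁ i j k - B (ev (b i) k) (ev (b j) k)
  have hg₁ : HasFDerivAt g₁ g₁' 0 := by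
    refine hasFDerivAt_pi.2 fun i => hasFDerivAt_pi.2 fun j => ?_
    have h1 := (B.comp (ev (b i))).hasFDerivAt (x := (0 : W)) |>.clm_apply
      ((ev (b j)).hasFDerivAt (x := (0 : W)))
    have h2 := ((f₁ i j).hasFDerivAt (x := (0 : W))).fun_sub h1
    simpa using h2
  have hf := hg₁.prodMk (f₂.hasFDerivAt (x := (0 : W)))
  have h := eventually_eq_of_hasFDerivAt hf (fun k hk => by
    have h1 : ∀ i j, f₁ i j k = 0 := fun i j => congrFun (congrFun (congrArg Prod.fst hk) i) j
    have h2 : f₂ k = 0 := congrArg Prod.snd hk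
    refine hι k (fun v w => ?_) fun v => DFunLike.congr_fun h2 v
    let D : E →ₗ[ℝ] E →ₗ[ℝ] E := LinearMap.mk₂ ℝ (fun v w => ι k (B v w) - B (ι k v) w - B v (ι k w))
      (by intros; simp; abel) (by intros; simp [smul_sub]) (by intros; simp; abel)
      (by intros; simp [smul_sub])
    have hD : D = 0 := b.ext fun i => b.ext fun j => h1 i j
    have h3 : ι k (B v w) - B (ι k v) w - B v (ι k w) = 0 :=
      DFunLike.congr_fun (DFunLike.congr_fun hD v) w
    rw [sub_sub, sub_eq_zero] at h3
    exact h3) 0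
  filter_upwards [h] with k hk h1 h2
  refine hk (Prod.ext (funext fun i => funext fun j => ?_) (ContinuousLinearMap.ext h2))
  have := h1 (b i) (b j)
  simp only [map_add, add_apply] at this
  change ι k (B (b i) (b j)) - B (ι k (b i)) (b j) - B (b i) (ι k (b j)) -
    B (ι k (b i)) (ι k (b j)) = 0
  have h4 := sub_eq_zero.2 this
  rw [← h4]; abel

end

section
variable {E : Type*} [NormedAddCommGroup E] [NormedSpace ℝ E] [FiniteDimensional ℝ E]
  {G : Type*} [TopologicalSpace G] [ChartedSpace E G] [Group G] [LieGroup 𝓘(ℝ, E) ∞ G]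
  {A : AHSPair E G}

open Filter Topology

namespace AHSPair

/-- Compatibility of an operator on the Lie algebra with the bracket, which is written in terms of the
continuous bilinear map `adDeriv`. -/
def IsLieHom (T : E →L[ℝ] E) : Prop :=
  ∀ v w, T (adDeriv E G v w) = adDeriv E G (T v) (T w)

variable [T2Space G] {EP : Type*} [NormedAddCommGroup EP] [NormedSpace ℝ EP]
  [ChartedSpace EP A.P]
  (hP : Manifold.IsSmoothEmbedding 𝓘(ℝ, EP) 𝓘(ℝ, E) ∞ (Subtype.val : A.P → G))

include hP

/-- A derivation of `𝔤` that preserves `𝔭` is given by the adjoint action of an element of the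
Lie algebra of `P`. -/
theorem exists_eq_adDeriv_of_derivation {k : E →L[ℝ] E}
    (h1 : ∀ v w, k (adDeriv E G v w) = adDeriv E G (k v) w + adDeriv E G v (k w))
    (h2 : ∀ v ∈ A.p, (k v : LieAlg E G) ∈ A.p) :
    ∃ a : EP, k = adDeriv E G
      ((mfderiv 𝓘(ℝ, EP) 𝓘(ℝ, E) (Subtype.val : A.P → G) 1 : EP →L[ℝ] E) a) := by
  have := A.simple
  have had : ∀ v w : LieAlg E G, (adDeriv E G v w : E) = (⁅v, w⁆ : LieAlg E G) :=
    fun v w => adDeriv_apply (E := E) (G := G) v w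
  let k' : LieAlg E G →ₗ[ℝ] LieAlg E G := (k : E →ₗ[ℝ] E)
  have hk' : ∀ v w : LieAlg E G, k' ⁅v, w⁆ = ⁅v, k' w⁆ - ⁅w, k' v⁆ := by
    intro v w
    have h3 := h1 v w
    have e1 : k' ⁅v, w⁆ = ⁅k' v, w⁆ + ⁅v, k' w⁆ :=
      (congrArg k (had v w)).symm.trans (h3.trans (congrArg₂ (fun a b : E => a + b)
        (had (k v) w) (had v (k w))))
    rw [e1, ← lie_skew w]; abel
  obtain ⟨X, hX⟩ := LieDerivation.IsKilling.exists_eq_ad (R := ℝ) (L := LieAlg E G)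
    { toLinearMap := k', leibniz' := hk' }
  have hX' : ∀ v : LieAlg E G, ⁅X, v⁆ = k' v := fun v => by
    simpa using congrArg (fun D : LieDerivation ℝ (LieAlg E G) (LieAlg E G) => D v) hX
  have hXp : X ∈ A.p := A.grading.mem_parabolic_of_lie fun y hy => by
    rw [hX']; exact h2 y hy
  obtain ⟨a, ha⟩ := (range_mfderiv_val hP).ge hXp
  refine ⟨a, ContinuousLinearMap.ext fun v => ?_⟩
  exact (hX' v).symm.trans ((had X v).symm.trans
    (congrArg (fun Y : E => adDeriv E G Y v) ha.symm))

omit [T2Space G] in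
/-- The strict derivative of `Ad` on `P`, in the chart of `P` around `1`. -/
theorem hasStrictFDerivAt_adCLM_chart :
    HasStrictFDerivAt (fun y => adCLM (E := E) (((extChartAt 𝓘(ℝ, EP) (1 : A.P)).symm y : A.P) : G))
      ((adDeriv E G).comp (mfderiv 𝓘(ℝ, EP) 𝓘(ℝ, E) (Subtype.val : A.P → G) 1 : EP →L[ℝ] E))
      (extChartAt 𝓘(ℝ, EP) (1 : A.P) 1) := by
  let D : EP →L[ℝ] E := mfderiv 𝓘(ℝ, EP) 𝓘(ℝ, E) (Subtype.val : A.P → G) 1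
  let ad : EP →L[ℝ] (E →L[ℝ] E) := (adDeriv E G).comp D
  let φ := extChartAt 𝓘(ℝ, EP) (1 : A.P)
  have h1 := (hasMFDerivAt_adCLM_one (E := E) (G := G)).comp (1 : A.P) (hasMFDerivAt_val hP rfl)
  have h2 := h1.2
  have h3 : HasFDerivAt (fun y => adCLM (E := E) ((φ.symm y : A.P) : G)) ad (φ 1) := by
    refine HasFDerivWithinAt.hasFDerivAt (s := Set.range 𝓘(ℝ, EP)) h2 ?_
    rw [modelWithCornersSelf_coe, Set.range_id]
    exact Filter.univ_mem
  have h4 : ContMDiffAt 𝓘(ℝ, EP) 𝓘(ℝ, E →L[ℝ] E) ∞ (fun g : A.P => adCLM (E := E) (g : G)) 1 :=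
    ((contMDiff_adCLM (E := E) (G := G)).comp hP.contMDiff).contMDiffAt
  have h5 := (contMDiffAt_iff.1 h4).2
  rw [modelWithCornersSelf_coe, Set.range_id, contDiffWithinAt_univ] at h5
  exact h5.hasStrictFDerivAt' h3 (by simp)

/-- Near the identity, the automorphisms of `𝔤` which preserve `𝔭` are given by the adjoint action
of elements of `P`: such an automorphism is `Ad(x) ∘ (1 + k)` with `x` in `P` and `k` in a complement of
`ad(𝔭)`, so that `1 + k` is an automorphism which preserves `𝔭`. As all derivations of `𝔤` which
preserve `𝔭` are in `ad(𝔭)`, it follows that `k = 0`. -/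
theorem eventually_exists_eq_adCLM [FiniteDimensional ℝ EP] :
    ∀ᶠ T : E →L[ℝ] E in 𝓝 (ContinuousLinearMap.id ℝ E),
    IsLieHom (G := G) T → (∀ v ∈ A.p, (T v : LieAlg E G) ∈ A.p) →
      ∃ x : A.P, T = adCLM (E := E) (x : G) := by
  let D : EP →L[ℝ] E := mfderiv 𝓘(ℝ, EP) 𝓘(ℝ, E) (Subtype.val : A.P → G) 1
  let ad : EP →L[ℝ] (E →L[ℝ] E) := (adDeriv E G).comp D
  obtain ⟨m, ι, hsurj, hι⟩ := exists_complement_range (ad : EP →ₗ[ℝ] (E →L[ℝ] E))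
  let φ := extChartAt 𝓘(ℝ, EP) (1 : A.P)
  let F : EP × (Fin m → ℝ) → (E →L[ℝ] E) := fun z =>
    (adCLM (E := E) ((φ.symm z.1 : A.P) : G)).comp (ContinuousLinearMap.id ℝ E + ι z.2)
  have had : ∀ v w : LieAlg E G, (adDeriv E G v w : E) = (⁅v, w⁆ : LieAlg E G) :=
    fun v w => adDeriv_apply (E := E) (G := G) v w
  have hφ1 : φ.symm (φ 1) = 1 := extChartAt_to_inv (I := 𝓘(ℝ, EP)) (1 : A.P)
  have hf : HasStrictFDerivAt (fun y => adCLM (E := E) ((φ.symm y : A.P) : G)) ad (φ 1) :=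
    hasStrictFDerivAt_adCLM_chart hP
  have hf₀ : adCLM (E := E) ((φ.symm (φ 1) : A.P) : G) =
    ContinuousLinearMap.id ℝ E := by rw [hφ1]; exact adCLM_one
  have hmap : map F (𝓝 (φ 1, 0)) = 𝓝 (ContinuousLinearMap.id ℝ E) :=
    map_nhds_comp_eq hf hf₀ ι hsurj
  rw [← hmap, eventually_map]
  let p₀ : E →ₗ[ℝ] E := A.grading.proj (-1)
  have hp₀ : ∀ v, p₀ (v - p₀ v) = 0 := fun v => by
    rw [map_sub, sub_eq_zero]
    exact (A.grading.proj_of_mem (A.grading.proj_mem (-1) v)).symm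
  have hp₁ : ∀ v : E, (v - p₀ v : E) ∈ A.p := fun v => A.grading.mem_parabolic_iff.2 (hp₀ v)
  have hev := eventually_eq_zero_of_map_bilinear (adDeriv E G)
    (LinearMap.toContinuousLinearMap p₀) ι (fun k h1 h2 => by
      have h3 : ∀ v ∈ A.p, (ι k v : LieAlg E G) ∈ A.p := by
        intro (v : E) hv
        have h4 := h2 v
        have h5 : p₀ v = 0 := A.grading.mem_parabolic_iff.1 hv
        refine A.grading.mem_parabolic_iff.2 ?_
        have h6 : p₀ (ι k (v - p₀ v)) = 0 := h4
        rwa [h5, sub_zero] at h6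
      obtain ⟨a, ha⟩ := exists_eq_adDeriv_of_derivation hP h1 h3
      exact hι a k ha.symm)
  have hev2 : ∀ᶠ z : EP × (Fin m → ℝ) in 𝓝 (φ 1, 0), _ := (continuous_snd.tendsto (φ 1, (0 : Fin m → ℝ))).eventually hev
  filter_upwards [hev2] with z hz h1 h2
  set x : A.P := φ.symm z.1 with hx
  have h3 : ∀ v, v + ι z.2 v = adCLM (x : G)⁻¹ (F z v) := fun v =>
    (adCLM_inv_apply_self (x : G) (v + ι z.2 v)).symm
  have hz0 : z.2 = 0 := by
    refine hz (fun v w => ?_) fun v => ?_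
    · change _ + ι z.2 _ = adDeriv E G (v + ι z.2 v) (w + ι z.2 w)
      rw [h3, h3, h3, adDeriv_adCLM, h1]
    · have h4 : (F z (v - p₀ v) : LieAlg E G) ∈ A.p := h2 _ (hp₁ v)
      have h5 := A.Ad_mem_p (inv_mem x.2) h4
      have h6 : ((v - p₀ v) + ι z.2 (v - p₀ v) : E) ∈ A.p :=
        (congrArg (fun Y : E => (Y : LieAlg E G) ∈ A.p) (h3 _)).mpr h5
      have h7 : p₀ ((v - p₀ v) + ι z.2 (v - p₀ v)) = 0 := A.grading.mem_parabolic_iff.1 h6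
      rwa [map_add, hp₀, zero_add] at h7
  refine ⟨x, ?_⟩
  ext v
  change adCLM (x : G) (v + ι z.2 v) = _
  rw [hz0]; simp

end AHSPair
end

/-! ### The image of `G₀` in the general linear group -/

/-- The elements of degree one can be recovered linearly from their products under the Killing form
with finitely many elements of degree `-1`. -/
theorem OneGrading.exists_dual_components {L : Type*} [LieRing L] [LieAlgebra ℝ L]
    [LieAlgebra.IsSimple ℝ L] [FiniteDimensional ℝ L] (gr : OneGrading L) :
    ∃ (m : ℕ) (y : Fin m → L) (μ : (Fin m → ℝ) →ₗ[ℝ] L), (∀ j, y j ∈ gr.comp (-1)) ∧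
      ∀ z ∈ gr.comp 1, μ (fun j => killingForm ℝ L z (y j)) = z := by
  let b := Module.finBasis ℝ L
  let κ : L →ₗ[ℝ] (Fin (Module.finrank ℝ L) → ℝ) :=
    LinearMap.pi fun i => (killingForm ℝ L).flip (gr.proj (-1) (b i))
  obtain ⟨μ, hμ⟩ := LinearMap.exists_leftInverse_of_injective (κ.comp (gr.comp 1).subtype)
    (LinearMap.ker_eq_bot'.2 fun z hz => by
      have h1 : killingForm ℝ L z.1 ∘ₗ gr.proj (-1) = 0 := b.ext fun i => congrFun hz i
      refine Subtype.ext (gr.eq_zero_of_killingForm_of_mem_one z.2 fun y hy => ?_)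
      have h2 : killingForm ℝ L z.1 (gr.proj (-1) y) = 0 := DFunLike.congr_fun h1 y
      rwa [gr.proj_of_mem hy] at h2)
  exact ⟨_, fun j => gr.proj (-1) (b j), (gr.comp 1).subtype.comp μ, fun j => gr.proj_mem _ _,
    fun z hz => by
      have h := DFunLike.congr_fun hμ ⟨z, hz⟩
      exact congrArg Subtype.val h⟩

section
variable {E : Type*} [NormedAddCommGroup E] [NormedSpace ℝ E] [FiniteDimensional ℝ E]
  {G : Type*} [TopologicalSpace G] [ChartedSpace E G] [Group G] [LieGroup 𝓘(ℝ, E) ∞ G]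
  {A : AHSPair E G}

open Filter Topology

namespace AHSPair

omit [FiniteDimensional ℝ E] in
/-- Limits of adjoint operators are compatible with the bracket. -/
theorem IsLieHom.of_tendsto {ι : Type*} {l : Filter ι} [NeBot l] {u : ι → G} {T : E →L[ℝ] E}
    (hT : Tendsto (fun i => adCLM (E := E) (u i)) l (𝓝 T)) : IsLieHom (G := G) T := by
  have h : ∀ v : E, Tendsto (fun i => adCLM (E := E) (u i) v) l (𝓝 (T v)) := fun v =>
    ((ContinuousLinearMap.apply ℝ E v).continuous.tendsto T).comp hT
  intro v w
  have h1 := h (adDeriv E G v w)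
  have h2 : Tendsto (fun i => adDeriv E G (adCLM (u i) v) (adCLM (u i) w)) l
      (𝓝 (adDeriv E G (T v) (T w))) :=
    (((adDeriv E G).continuous.comp continuous_fst).clm_apply continuous_snd).tendsto
      (T v, T w) |>.comp ((h v).prodMk_nhds (h w))
  simp only [adDeriv_adCLM] at h2
  exact tendsto_nhds_unique h1 h2

omit [LieGroup 𝓘(ℝ, E) ∞ G] in
theorem tendsto_adCLM_mem {ι : Type*} {l : Filter ι} [NeBot l] {u : ι → G}
    {T : E →L[ℝ] E} (hT : Tendsto (fun i => adCLM (E := E) (u i)) l (𝓝 T)) {S : Submodule ℝ E} {v : E}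
    (hS : ∀ i, adCLM (u i) v ∈ S) : T v ∈ S :=
  (Submodule.closed_of_finiteDimensional S).mem_of_tendsto
    (((ContinuousLinearMap.apply ℝ E v).continuous.tendsto T).comp hT) (Eventually.of_forall hS)

theorem Ad_mem_comp (g : A.G₀) {i : ℤ} {v : LieAlg E G} (hv : v ∈ A.grading.comp i) :
    Ad E G ((g : A.P) : G) v ∈ A.grading.comp i := g.2 i v hv

section

variable [T2Space G] {EP : Type*} [NormedAddCommGroup EP] [NormedSpace ℝ EP]
  [FiniteDimensional ℝ EP] [ChartedSpace EP A.P]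
  (hP : Manifold.IsSmoothEmbedding 𝓘(ℝ, EP) 𝓘(ℝ, E) ∞ (Subtype.val : A.P → G))
include hP

/-- The adjoint image of `G₀` is closed in the group of invertible operators. -/
theorem exists_eq_adCLM_of_tendsto {ι : Type*} {l : Filter ι} [NeBot l] {u : ι → A.G₀}
    {T T' : E →L[ℝ] E} (hT : Tendsto (fun i => adCLM (E := E) ((u i : A.P) : G)) l (𝓝 T))
    (hT' : Tendsto (fun i => adCLM (E := E) (((u i)⁻¹ : A.G₀) : A.P).1) l (𝓝 T')) :
    ∃ g : A.G₀, T = adCLM (E := E) ((g : A.P) : G) := by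
  have hcomp : Continuous fun p : (E →L[ℝ] E) × (E →L[ℝ] E) => p.1.comp p.2 :=
    continuous_fst.clm_comp continuous_snd
  have h1 : T.comp T' = ContinuousLinearMap.id ℝ E := by
    refine tendsto_nhds_unique (((hcomp.tendsto (T, T')).comp (hT.prodMk_nhds hT')).congr fun i => ?_) tendsto_const_nhds
    refine (adCLM_mul _ _).symm.trans ?_
    simp [adCLM_one]
  have h2 : T'.comp T = ContinuousLinearMap.id ℝ E := by
    refine tendsto_nhds_unique (((hcomp.tendsto (T', T)).comp (hT'.prodMk_nhds hT)).congr fun i => ?_) tendsto_const_nhds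
    refine (adCLM_mul _ _).symm.trans ?_
    simp [adCLM_one]
  have h3 := (hcomp.tendsto (T', T)).comp ((tendsto_const_nhds (x := T')).prodMk_nhds hT)
  rw [h2] at h3
  obtain ⟨i, hi⟩ := (h3.eventually (eventually_exists_eq_adCLM hP)).exists
  have hT'l := IsLieHom.of_tendsto hT'
  obtain ⟨x, hx⟩ := hi (fun v w => by
      change T' (adCLM _ (adDeriv E G v w)) = adDeriv E G (T' _) (T' _)
      rw [← adDeriv_adCLM, hT'l]; rfl)
    (fun v hv => tendsto_adCLM_mem (S := A.p) hT' fun j =>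
      A.Ad_mem_p ((u j)⁻¹ : A.G₀).1.2 (A.Ad_mem_p (u i).1.2 hv))
  have hTx : T = adCLM (E := E) (((u i : A.P) * x⁻¹ : A.P) : G) := by
    ext v
    have h4 := DFunLike.congr_fun hx (adCLM (x : G)⁻¹ v)
    rw [adCLM_apply_inv_self] at h4
    have h5 := congrArg T h4
    have h6 : ∀ w, T (T' w) = w := DFunLike.congr_fun h1
    rw [← h5]
    refine (h6 _).trans ?_
    exact (adCLM_mul_apply _ _ _).symm
  refine ⟨⟨(u i : A.P) * x⁻¹, fun k X hX => ?_⟩, hTx⟩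
  have h7 : T X ∈ (A.grading.comp k : Submodule ℝ E) :=
    tendsto_adCLM_mem (S := A.grading.comp k) hT fun j => Ad_mem_comp (u j) hX
  rw [hTx] at h7
  exact h7

end

/-- If the adjoint operators of a net in `G₀` and of its inverse converge on `𝔤₋₁`, then they
converge: the action on `𝔤₁` is dual to the one on `𝔤₋₁`, and these subspaces generate `𝔤`. -/
theorem exists_tendsto_adCLM {ι : Type*} {l : Filter ι} {u : ι → A.G₀}
    (h : ∀ v ∈ A.grading.comp (-1), ∃ w : E,
      Tendsto (fun i => adCLM (E := E) ((u i : A.P) : G) v) l (𝓝 w))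
    (h' : ∀ v ∈ A.grading.comp (-1), ∃ w : E,
      Tendsto (fun i => adCLM (E := E) (((u i)⁻¹ : A.G₀) : A.P).1 v) l (𝓝 w)) :
    ∃ T : E →L[ℝ] E, Tendsto (fun i => adCLM (E := E) ((u i : A.P) : G)) l (𝓝 T) := by
  have := A.simple
  let κ : E →ₗ[ℝ] E →ₗ[ℝ] ℝ := killingForm ℝ (LieAlg E G)
  obtain ⟨m, y, μ', hy, hμ'⟩ := A.grading.exists_dual_components
  let μ : (Fin m → ℝ) →ₗ[ℝ] E := μ'
  have hμ : ∀ z : E, z ∈ (A.grading.comp 1 : Submodule ℝ E) → μ (fun j => κ z (y j)) = z := hμ'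
  have hκ : ∀ (g : G) (v w : E), κ (adCLM g v) w = κ v (adCLM g⁻¹ w) := fun g v w => by
    have h1 := LieAlgebra.killingForm_of_equiv_apply (adEquiv (E := E) g) v (Ad E G g⁻¹ w)
    refine Eq.trans ?_ h1
    exact congrArg (κ (adCLM g v)) (adCLM_apply_inv_self g w).symm
  let S : Submodule ℝ E :=
    { carrier := {v | ∃ w : E, Tendsto (fun i => adCLM (E := E) ((u i : A.P) : G) v) l (𝓝 w)}
      zero_mem' := ⟨0, by simpa using tendsto_const_nhds⟩
      add_mem' := by
        rintro a b ⟨v, hv⟩ ⟨w, hw⟩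
        exact ⟨v + w, by simpa using hv.add hw⟩
      smul_mem' := by
        rintro c a ⟨v, hv⟩
        exact ⟨c • v, by simpa using hv.const_smul c⟩ }
  have hS : S = ⊤ := by
    refine A.grading.eq_top_of_lie_mem (S := S) ?_ h fun (z : E) hz => ?_
    · rintro a ⟨v, hv⟩ b ⟨w, hw⟩
      refine ⟨adDeriv E G v w, ?_⟩
      have h2 := (((adDeriv E G).continuous.comp continuous_fst).clm_apply continuous_snd).tendsto
        (v, w) |>.comp (hv.prodMk_nhds hw)
      refine h2.congr fun i => ?_
      refine (adDeriv_adCLM _ _ _).trans (congrArg (adCLM (E := E) ((u i : A.P) : G)) ?_)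
      exact adDeriv_apply (E := E) (G := G) a b
    · choose! w hw using h'
      refine ⟨μ fun j => κ z (w (y j)), ?_⟩
      have h2 : Tendsto (fun i => fun j => κ (adCLM (E := E) ((u i : A.P) : G) z) (y j)) l
          (𝓝 fun j => κ z (w (y j))) := by
        refine tendsto_pi_nhds.2 fun j => ?_
        have h3 := ((κ z).continuous_of_finiteDimensional.tendsto _).comp (hw (y j) (hy j))
        exact h3.congr fun i => (hκ _ _ _).symm
      refine ((μ.continuous_of_finiteDimensional.tendsto _).comp h2).congr fun i => ?_
      exact hμ _ (Ad_mem_comp (u i) hz)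
  have hS' : ∀ v : E, ∃ w : E, Tendsto (fun i => adCLM (E := E) ((u i : A.P) : G) v) l (𝓝 w) :=
    fun v => (hS ▸ Submodule.mem_top : v ∈ S)
  choose w hw using hS'
  let b := Module.finBasis ℝ E
  let Ψ : (Fin (Module.finrank ℝ E) → E) →ₗ[ℝ] (E →L[ℝ] E) :=
    LinearMap.toContinuousLinearMap.toLinearMap.comp (b.constr ℝ).toLinearMap
  have hΨ : ∀ T : E →L[ℝ] E, Ψ (fun j => T (b j)) = T := fun T => by
    ext v
    change b.constr ℝ (fun j => T (b j)) v = T v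
    exact DFunLike.congr_fun (b.constr_eq ℝ (f := (T : E →ₗ[ℝ] E)) (fun j => rfl)) v
  refine ⟨Ψ fun j => w (b j), ?_⟩
  have h4 := (Ψ.continuous_of_finiteDimensional.tendsto _).comp
    (tendsto_pi_nhds.2 fun j => hw (b j))
  exact h4.congr fun i => hΨ _

theorem rep₀_mk (g : A.G₀) (v : LieAlg E G) :
    A.rep₀ g (A.p.mkQ v) = A.p.mkQ (Ad E G ((g : A.P) : G) v) := rfl

section Covering

variable {n : ℕ} (b : Module.Basis (Fin n) ℝ (LieAlg E G ⧸ A.p))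

/-- The matrix of the representation of `G₀` on `𝔤 / 𝔭` depends continuously on `Ad(g)`. -/
theorem exists_matrixHom_eq :
    ∃ Λ : (E →L[ℝ] E) → Matrix (Fin n) (Fin n) ℝ, Continuous Λ ∧
      ∀ g : A.G₀, (matrixHom A.rep₀ b g : Matrix (Fin n) (Fin n) ℝ) =
        Λ (adCLM (E := E) ((g : A.P) : G)) := by
  choose y hy using fun j => Submodule.mkQ_surjective A.p (b j)
  let y' : Fin n → E := y
  let f : ∀ i : Fin n, E →ₗ[ℝ] ℝ := fun i => (b.coord i).comp A.p.mkQ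
  refine ⟨fun T => Matrix.of fun i j => f i (T (y' j)), ?_, fun g => ?_⟩
  · refine continuous_matrix fun i j => ?_
    exact ((f i).continuous_of_finiteDimensional).comp
      (ContinuousLinearMap.apply ℝ E (y' j)).continuous
  · ext i j
    change LinearMap.toMatrix b b (A.rep₀ g) i j = _
    rw [LinearMap.toMatrix_apply, ← hy j, rep₀_mk]
    rfl

theorem continuous_adCLM_val {X : Type*} [TopologicalSpace X] {u : X → A.G₀} (hu : Continuous u) :
    Continuous fun x => adCLM (E := E) ((u x : A.P) : G) :=
  (contMDiff_adCLM (E := E) (G := G)).continuous.comp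
    (continuous_subtype_val.comp (continuous_subtype_val.comp hu))

theorem continuous_matrixHom : Continuous (matrixHom A.rep₀ b) := by
  obtain ⟨Λ, hΛ, h⟩ := exists_matrixHom_eq b
  refine Units.continuous_iff.2 ⟨?_, ?_⟩
  · exact (hΛ.comp (continuous_adCLM_val continuous_id)).congr fun g => (h g).symm
  · have : IsTopologicalGroup G := topologicalGroup_of_lieGroup 𝓘(ℝ, E) ∞
    refine (hΛ.comp (continuous_adCLM_val continuous_inv)).congr fun g => ?_
    rw [← map_inv]
    exact (h g⁻¹).symm

/-- Convergence of the matrices of `\underline{Ad}` forces convergence of `Ad` on `𝔤₋₁`. -/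
theorem exists_tendsto_of_matrixHom {ι : Type*} {l : Filter ι} {u : ι → A.G₀}
    {N : Matrix (Fin n) (Fin n) ℝ}
    (h : Tendsto (fun i => (matrixHom A.rep₀ b (u i) : Matrix (Fin n) (Fin n) ℝ)) l (𝓝 N))
    {v : E} (hv : v ∈ (A.grading.comp (-1) : Submodule ℝ E)) : ∃ w : E,
      Tendsto (fun i => adCLM (E := E) ((u i : A.P) : G) v) l (𝓝 w) := by
  let σ : (LieAlg E G ⧸ A.p) →ₗ[ℝ] E := A.p.liftQ (A.grading.proj (-1))
    fun x hx => A.grading.mem_parabolic_iff.1 hx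
  let v' : LieAlg E G := v
  let c := b.repr (A.p.mkQ v')
  let Ξ : Matrix (Fin n) (Fin n) ℝ → E := fun M => ∑ i, (M.mulVec c) i • σ (b i)
  have hΞ : Continuous Ξ := by fun_prop
  refine ⟨Ξ N, ((hΞ.tendsto N).comp h).congr fun i => ?_⟩
  have h1 : (matrixHom A.rep₀ b (u i) : Matrix (Fin n) (Fin n) ℝ).mulVec c =
      b.repr (A.p.mkQ (Ad E G ((u i : A.P) : G) v')) :=
    (LinearMap.toMatrix_mulVec_repr b b (A.rep₀ (u i)) (A.p.mkQ v')).trans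
      (by rw [rep₀_mk])
  change ∑ j, _ = _
  rw [h1]
  have h2 := congrArg σ (b.sum_repr (A.p.mkQ (Ad E G ((u i : A.P) : G) v')))
  rw [map_sum] at h2
  simp only [map_smul] at h2
  exact h2.trans (A.grading.proj_of_mem (Ad_mem_comp (u i) hv))

instance instLocallyCompactSpaceGL : LocallyCompactSpace (Matrix.GeneralLinearGroup (Fin n) ℝ) := by
  have h1 : LocallyCompactSpace (Matrix (Fin n) (Fin n) ℝ) :=
    inferInstanceAs (LocallyCompactSpace (Fin n → Fin n → ℝ))
  have h2 : LocallyCompactSpace (Matrix (Fin n) (Fin n) ℝ)ᵐᵒᵖ :=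
    MulOpposite.opHomeomorph.symm.isClosedEmbedding.locallyCompactSpace
  exact Units.isClosedEmbedding_embedProduct.locallyCompactSpace

section

variable [T2Space G] {EP : Type*} [NormedAddCommGroup EP] [NormedSpace ℝ EP]
  [FiniteDimensional ℝ EP] [ChartedSpace EP A.P]
  (hP : Manifold.IsSmoothEmbedding 𝓘(ℝ, EP) 𝓘(ℝ, E) ∞ (Subtype.val : A.P → G))
include hP

/-- The image of `G₀` in the general linear group of `𝔤 / 𝔭` is closed: by convergence on `𝔤 / 𝔭`, the
adjoint operators converge on `𝔤₋₁` and then on all of `𝔤`, and their limit is `Ad(g)` for some `g`. -/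
theorem isClosed_range_matrixHom :
    IsClosed ((matrixHom A.rep₀ b).range : Set (Matrix.GeneralLinearGroup (Fin n) ℝ)) := by
  refine isClosed_of_closure_subset fun h hh => ?_
  let l : Filter A.G₀ := comap (matrixHom A.rep₀ b) (𝓝 h)
  have hl : NeBot l := by
    refine comap_neBot fun t ht => ?_
    obtain ⟨_, h1, g, rfl⟩ := mem_closure_iff_nhds.1 hh t ht
    exact ⟨g, h1⟩
  have h1 : Tendsto (matrixHom A.rep₀ b) l (𝓝 h) := tendsto_comap
  have h2 : Tendsto (fun g => (matrixHom A.rep₀ b g : Matrix (Fin n) (Fin n) ℝ)) l (𝓝 h.1) :=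
    (Units.continuous_val.tendsto h).comp h1
  have h3 : Tendsto (fun g => (matrixHom A.rep₀ b g⁻¹ : Matrix (Fin n) (Fin n) ℝ)) l
      (𝓝 (h⁻¹).1) := by
    refine ((Units.continuous_val.tendsto h⁻¹).comp h1.inv).congr fun g => ?_
    rw [map_inv]; rfl
  have c1 := fun v hv => exists_tendsto_of_matrixHom b (u := fun g => g) h2 (v := v) hv
  have c2 := fun v hv => exists_tendsto_of_matrixHom b (u := fun g => g⁻¹) h3 (v := v) hv
  obtain ⟨T, hT⟩ := exists_tendsto_adCLM (u := fun g : A.G₀ => g) c1 c2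
  obtain ⟨T', hT'⟩ := exists_tendsto_adCLM (u := fun g : A.G₀ => g⁻¹) c2 (by
    simp only [inv_inv]; exact c1)
  obtain ⟨g₀, hg₀⟩ := exists_eq_adCLM_of_tendsto hP hT hT'
  obtain ⟨Λ, hΛ, hΛ'⟩ := exists_matrixHom_eq (A := A) b
  refine ⟨g₀, Units.ext ?_⟩
  refine tendsto_nhds_unique (((hΛ.tendsto T).comp hT).congr fun g => (hΛ' g).symm) h2 |>.symm.trans ?_ |>.symm
  rw [hΛ', hg₀]

end

/-- The adjoint representation is injective near the identity. -/
theorem eventually_eq_one_of_adCLM (A : AHSPair E G) : ∀ᶠ g : G in 𝓝 1,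
    adCLM (E := E) g = ContinuousLinearMap.id ℝ E → g = 1 := by
  have := A.simple
  have h := (hasMFDerivAt_adCLM_one (E := E) (G := G)).2
  have h' : HasFDerivAt (fun x => adCLM ((extChartAt 𝓘(ℝ, E) (1 : G)).symm x)) (adDeriv E G)
      (extChartAt 𝓘(ℝ, E) (1 : G) 1) := by
    refine HasFDerivWithinAt.hasFDerivAt (s := Set.range 𝓘(ℝ, E)) h ?_
    rw [modelWithCornersSelf_coe, Set.range_id]
    exact Filter.univ_mem
  have h1 := eventually_eq_of_hasFDerivAt h' (fun v hv => by
    refine OneGrading.eq_zero_of_lie_eq_zero (L := LieAlg E G) (x := v) fun w => ?_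
    exact (adDeriv_apply (E := E) (G := G) v w).symm.trans (DFunLike.congr_fun hv w))
    (ContinuousLinearMap.id ℝ E)
  filter_upwards [(continuousAt_extChartAt (I := 𝓘(ℝ, E)) (1 : G)).eventually h1,
    extChartAt_source_mem_nhds (I := 𝓘(ℝ, E)) (1 : G)] with g hg hs hid
  refine (extChartAt 𝓘(ℝ, E) (1 : G)).injOn hs (mem_extChartAt_source 1) (hg ?_)
  rw [(extChartAt 𝓘(ℝ, E) (1 : G)).left_inv hs, hid]

/-- The kernel of the representation of `G₀` on `𝔤 / 𝔭` is the kernel of `Ad`. -/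
theorem eq_of_matrixHom_eq_one {g : A.G₀} (hg : matrixHom A.rep₀ b g = 1) :
    adCLM (E := E) ((g : A.P) : G) = ContinuousLinearMap.id ℝ E := by
  have := A.simple
  have h1 : A.rep₀ g = 1 := by
    have h2 : LinearMap.toMatrixAlgEquiv b (A.rep₀ g) = 1 := congrArg Units.val hg
    exact (LinearMap.toMatrixAlgEquiv b).injective (h2.trans (map_one _).symm)
  ext v
  refine A.grading.eq_of_map_sub_mem (adEquiv ((g : A.P) : G)) g.2 (fun x => ?_) v
  rw [← Submodule.Quotient.mk_eq_zero, Submodule.Quotient.mk_sub, sub_eq_zero]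
  exact DFunLike.congr_fun h1 (A.p.mkQ x)

variable [T2Space G] [SecondCountableTopology G]
  {EP : Type*} [NormedAddCommGroup EP] [NormedSpace ℝ EP]
  [FiniteDimensional ℝ EP] [ChartedSpace EP A.P]
  (hP : Manifold.IsSmoothEmbedding 𝓘(ℝ, EP) 𝓘(ℝ, E) ∞ (Subtype.val : A.P → G))

include hP in
/-- The representation of `G₀` on `𝔤 / 𝔭` is a covering of a closed subgroup. It is open onto its image,
as a surjective homomorphism from a `σ`-compact group to a locally compact group, and its kernel is
discrete, because `Ad` is injective near the identity. -/
theorem isCoveringOfClosedSubgroup_rep₀ [LocallyCompactSpace A.G₀] : IsCoveringOfClosedSubgroup A.rep₀ := by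
  intro n b
  have hcl := isClosed_range_matrixHom b hP
  refine ⟨hcl, ?_⟩
  have : IsTopologicalGroup G := topologicalGroup_of_lieGroup 𝓘(ℝ, E) ∞
  have : SecondCountableTopology A.G₀ :=
    (Topology.IsEmbedding.subtypeVal.comp Topology.IsEmbedding.subtypeVal :
      Topology.IsEmbedding fun g : A.G₀ => ((g : A.P) : G)).secondCountableTopology
  have : SigmaCompactSpace A.G₀ := sigmaCompactSpace_of_locallyCompact_secondCountable
  have : LocallyCompactSpace (matrixHom A.rep₀ b).range := hcl.locallyCompactSpace
  have hc : Continuous (matrixHom A.rep₀ b).rangeRestrict :=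
    (continuous_matrixHom b).subtype_mk _
  have hs := (matrixHom A.rep₀ b).rangeRestrict_surjective
  have ho := (matrixHom A.rep₀ b).rangeRestrict.isOpenMap_of_sigmaCompact hs hc
  refine (Topology.IsQuotientMap.isQuotientCoveringMap_of_isDiscrete_ker_monoidHom
    (ho.isQuotientMap hc hs) ?_).isCoveringMap
  rw [isDiscrete_iff_discreteTopology]
  have : IsTopologicalGroup (matrixHom A.rep₀ b).rangeRestrict.ker :=
    inferInstanceAs (IsTopologicalGroup ((matrixHom A.rep₀ b).rangeRestrict.ker : Subgroup A.G₀))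
  refine discreteTopology_of_isOpen_singleton_one (G := (matrixHom A.rep₀ b).rangeRestrict.ker) ?_
  have hval : Continuous fun g : (matrixHom A.rep₀ b).rangeRestrict.ker =>
    (((g : A.G₀) : A.P) : G) := by fun_prop
  have h1 := (hval.tendsto 1).eventually (eventually_eq_one_of_adCLM A)
  rw [isOpen_singleton_iff_nhds_eq_pure]
  refine le_antisymm ?_ (pure_le_nhds _)
  rw [le_pure_iff]
  filter_upwards [h1] with g hg
  have h2 : matrixHom A.rep₀ b g = 1 := congrArg Subtype.val g.2
  have h3 := hg (eq_of_matrixHom_eq_one b h2)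
  exact Subtype.ext (Subtype.ext (Subtype.ext h3))

end Covering

end AHSPair
end

/-! ### Smooth structures from local homeomorphisms -/

section LocalHomeos

variable (EN : Type*) [NormedAddCommGroup EN] [NormedSpace ℝ EN] {N : Type*} [TopologicalSpace N]
  [ChartedSpace EN N] {X : Type*} [TopologicalSpace X] {ι : Type*}
  (e : ι → OpenPartialHomeomorph X N) (he : ∀ x, ∃ i, x ∈ (e i).source)

/-- The charted space structure on `X` which is obtained from a cover of `X` by the domains of
local homeomorphisms to a manifold `N`. -/
@[reducible] def chartedSpaceOfLocalHomeos : ChartedSpace EN X where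
  atlas := {c | ∃ i, ∃ c' ∈ atlas EN N, c = e i ≫ₕ c'}
  chartAt x := e (he x).choose ≫ₕ chartAt EN (e (he x).choose x)
  mem_chart_source x := by
    rw [OpenPartialHomeomorph.trans_source]
    exact ⟨(he x).choose_spec, mem_chart_source EN _⟩
  chart_mem_atlas x := ⟨_, _, chart_mem_atlas EN _, rfl⟩

variable (hT : ∀ i j, ContMDiffOn 𝓘(ℝ, EN) 𝓘(ℝ, EN) ∞ ((e i).symm ≫ₕ e j)
  ((e i).symm ≫ₕ e j).source)

variable [IsManifold 𝓘(ℝ, EN) ∞ N]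

include hT

/-- If the changes between the local homeomorphisms are smooth, the charts are smoothly compatible. -/
theorem isManifold_of_localHomeos :
    letI := chartedSpaceOfLocalHomeos EN e he
    IsManifold 𝓘(ℝ, EN) ∞ X := by
  let := chartedSpaceOfLocalHomeos EN e he
  refine isManifold_of_contDiffOn _ _ _ ?_
  rintro _ _ ⟨i, c, hc, rfl⟩ ⟨j, c', hc', rfl⟩
  simp only [modelWithCornersSelf_coe, modelWithCornersSelf_coe_symm, Function.id_comp,
    Function.comp_id, Set.preimage_id, Set.range_id, Set.inter_univ]
  have h1 := contMDiffOn_symm_of_mem_maximalAtlas (I := 𝓘(ℝ, EN)) (n := ∞)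
    (IsManifold.subset_maximalAtlas hc)
  have h2 := contMDiffOn_of_mem_maximalAtlas (I := 𝓘(ℝ, EN)) (n := ∞)
    (IsManifold.subset_maximalAtlas hc')
  rw [← contMDiffOn_iff_contDiffOn]
  refine ((h2.comp' (hT i j)).comp' h1).mono ?_
  intro x hx
  simp only [mfld_simps] at hx ⊢
  tauto

theorem contMDiffOn_localHomeo (i : ι) :
    letI := chartedSpaceOfLocalHomeos EN e he
    ContMDiffOn 𝓘(ℝ, EN) 𝓘(ℝ, EN) ∞ (e i) (e i).source := by
  let := chartedSpaceOfLocalHomeos EN e he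
  have := isManifold_of_localHomeos EN e he hT
  intro x hx
  set k := (he x).choose with hk
  have hkx : x ∈ (e k).source := (he x).choose_spec
  set c := chartAt EN (e k x) with hc
  have h0 : chartAt EN x = e k ≫ₕ c := rfl
  have h1 : ContMDiffAt 𝓘(ℝ, EN) 𝓘(ℝ, EN) ∞ (chartAt EN x) x :=
    (contMDiffOn_chart (I := 𝓘(ℝ, EN)) (n := ∞) (x := x)).contMDiffAt (chart_source_mem_nhds EN x)
  have hcx : chartAt EN x x = c (e k x) := rfl
  have h2 : ContMDiffAt 𝓘(ℝ, EN) 𝓘(ℝ, EN) ∞ c.symm (chartAt EN x x) :=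
    (contMDiffOn_chart_symm (I := 𝓘(ℝ, EN)) (n := ∞) (x := e k x)).contMDiffAt
      (c.open_target.mem_nhds (mem_chart_target EN (e k x)))
  have hcs : c.symm (chartAt EN x x) = e k x := c.left_inv (mem_chart_source EN (e k x))
  have h3 : ContMDiffAt 𝓘(ℝ, EN) 𝓘(ℝ, EN) ∞ ((e k).symm ≫ₕ e i) (e k x) := by
    refine (hT k i).contMDiffAt (((e k).symm ≫ₕ e i).open_source.mem_nhds ?_)
    rw [OpenPartialHomeomorph.trans_source]
    exact ⟨(e k).map_source hkx, by rw [Set.mem_preimage, (e k).left_inv hkx]; exact hx⟩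
  refine ContMDiffAt.contMDiffWithinAt ?_
  refine (ContMDiffAt.comp_of_eq (y := e k x) (f := fun y => c.symm (chartAt EN x y)) h3
    (h2.comp x h1) hcs).congr_of_eventuallyEq ?_
  filter_upwards [chart_source_mem_nhds EN x] with y hy
  rw [h0, OpenPartialHomeomorph.trans_source] at hy
  change e i y = e i ((e k).symm (c.symm (c (e k y))))
  rw [c.left_inv hy.2, (e k).left_inv hy.1]

theorem contMDiffOn_localHomeo_symm (i : ι) :
    letI := chartedSpaceOfLocalHomeos EN e he
    ContMDiffOn 𝓘(ℝ, EN) 𝓘(ℝ, EN) ∞ (e i).symm (e i).target := by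
  let := chartedSpaceOfLocalHomeos EN e he
  have := isManifold_of_localHomeos EN e he hT
  intro y hy
  set x := (e i).symm y with hxy
  have hx : x ∈ (e i).source := (e i).map_target hy
  set k := (he x).choose with hk
  have hkx : x ∈ (e k).source := (he x).choose_spec
  set c := chartAt EN (e k x) with hc
  have h0 : chartAt EN x = e k ≫ₕ c := rfl
  have hyS : y ∈ ((e i).symm ≫ₕ e k).source := by
    rw [OpenPartialHomeomorph.trans_source]
    exact ⟨hy, hkx⟩
  have h1 : ContMDiffAt 𝓘(ℝ, EN) 𝓘(ℝ, EN) ∞ ((e i).symm ≫ₕ e k) y :=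
    (hT i k).contMDiffAt (((e i).symm ≫ₕ e k).open_source.mem_nhds hyS)
  have h2 : ContMDiffAt 𝓘(ℝ, EN) 𝓘(ℝ, EN) ∞ c (e k x) :=
    (contMDiffOn_chart (I := 𝓘(ℝ, EN)) (n := ∞) (x := e k x)).contMDiffAt
      (chart_source_mem_nhds EN _)
  have h3 : ContMDiffAt 𝓘(ℝ, EN) 𝓘(ℝ, EN) ∞ (chartAt EN x).symm (c (e k x)) :=
    (contMDiffOn_chart_symm (I := 𝓘(ℝ, EN)) (n := ∞) (x := x)).contMDiffAt
      (chart_target_mem_nhds EN x)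
  refine ContMDiffAt.contMDiffWithinAt ?_
  refine (h3.comp y (h2.comp y h1)).congr_of_eventuallyEq ?_
  filter_upwards [((e i).symm ≫ₕ e k).open_source.mem_nhds hyS,
    (h1.continuousAt).preimage_mem_nhds (chart_source_mem_nhds EN (e k x))] with z hz hz'
  rw [OpenPartialHomeomorph.trans_source] at hz
  change (e i).symm z = (e k).symm (c.symm (c (e k ((e i).symm z))))
  have hl : c.symm (c (e k ((e i).symm z))) = e k ((e i).symm z) := c.left_inv hz'
  rw [hl, (e k).left_inv hz.2]

end LocalHomeos

/-! ### Products as manifolds over the product of the model spaces -/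

section Product
variable {E F : Type*} [NormedAddCommGroup E] [NormedSpace ℝ E] [NormedAddCommGroup F] [NormedSpace ℝ F]
  {M N : Type*} [TopologicalSpace M] [ChartedSpace E M] [TopologicalSpace N] [ChartedSpace F N]
  {X : Type*} {EX : Type*} [NormedAddCommGroup EX] [NormedSpace ℝ EX] [TopologicalSpace X] [ChartedSpace EX X]

theorem contMDiffOn_prod_self_iff {f : X → M × N} {s : Set X} :
    letI : ChartedSpace (E × F) (M × N) := prodChartedSpace E M F N
    ContMDiffOn 𝓘(ℝ, EX) 𝓘(ℝ, E × F) ∞ f s ↔ ContMDiffOn 𝓘(ℝ, EX) (𝓘(ℝ, E).prod 𝓘(ℝ, F)) ∞ f s := by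
  rw [modelWithCornersSelf_prod]

theorem contMDiffOn_self_prod_iff {f : M × N → X} {s : Set (M × N)} :
    letI : ChartedSpace (E × F) (M × N) := prodChartedSpace E M F N
    ContMDiffOn 𝓘(ℝ, E × F) 𝓘(ℝ, EX) ∞ f s ↔ ContMDiffOn (𝓘(ℝ, E).prod 𝓘(ℝ, F)) 𝓘(ℝ, EX) ∞ f s := by
  rw [modelWithCornersSelf_prod]

theorem contMDiffOn_self_prod_prod_iff {f : M × N → M × N} {s : Set (M × N)} :
    letI : ChartedSpace (E × F) (M × N) := prodChartedSpace E M F N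
    ContMDiffOn 𝓘(ℝ, E × F) 𝓘(ℝ, E × F) ∞ f s ↔
    ContMDiffOn (𝓘(ℝ, E).prod 𝓘(ℝ, F)) (𝓘(ℝ, E).prod 𝓘(ℝ, F)) ∞ f s := by
  rw [modelWithCornersSelf_prod]

theorem isManifold_prod_self [IsManifold 𝓘(ℝ, E) ∞ M] [IsManifold 𝓘(ℝ, F) ∞ N] :
    letI : ChartedSpace (E × F) (M × N) := prodChartedSpace E M F N
    IsManifold 𝓘(ℝ, E × F) ∞ (M × N) := by
  rw [modelWithCornersSelf_prod]
  exact IsManifold.prod (I := 𝓘(ℝ, E)) (I' := 𝓘(ℝ, F))  M N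
end Product

/-! ### Quotients of principal bundles -/

section QuotientBundle

open Topology

variable {EM : Type*} [NormedAddCommGroup EM] [NormedSpace ℝ EM]
  {M : Type*} [TopologicalSpace M] [ChartedSpace EM M]
  {EH : Type*} [NormedAddCommGroup EH] [NormedSpace ℝ EH]
  {H : Type*} [TopologicalSpace H] [ChartedSpace EH H] [Group H]
  {EQ : Type*} [NormedAddCommGroup EQ] [NormedSpace ℝ EQ]
  {Q : Type*} [TopologicalSpace Q] [ChartedSpace EQ Q]
  {EH₀ : Type*} [NormedAddCommGroup EH₀] [NormedSpace ℝ EH₀]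
  {H₀ : Type*} [Group H₀]
  {Q₀ : Type*} [TopologicalSpace Q₀]

namespace PrincipalBundle

/-- A smooth equivariant local trivialization of a principal bundle. -/
structure SmoothTrivialization (B : PrincipalBundle EM M EH H EQ Q)
    extends Trivialization H B.proj where
  smooth : ContMDiffOn 𝓘(ℝ, EQ) (𝓘(ℝ, EM).prod 𝓘(ℝ, EH)) ∞ toOpenPartialHomeomorph source
  smooth_symm : ContMDiffOn (𝓘(ℝ, EM).prod 𝓘(ℝ, EH)) 𝓘(ℝ, EQ) ∞ toOpenPartialHomeomorph.symm target
  map_act : ∀ u ∈ source, ∀ g, toOpenPartialHomeomorph (B.act u g) =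
    ((toOpenPartialHomeomorph u).1, (toOpenPartialHomeomorph u).2 * g)

variable (B : PrincipalBundle EM M EH H EQ Q)

theorem exists_smoothTrivialization (x : M) : ∃ e : B.SmoothTrivialization, x ∈ e.baseSet := by
  obtain ⟨e, hx, h1, h2, h3⟩ := B.exists_trivialization x
  exact ⟨⟨e, h1, h2, h3⟩, hx⟩

variable {B}

namespace SmoothTrivialization

variable (e : B.SmoothTrivialization)

/-- The fiber coordinate of a local trivialization. -/
def fib (u : Q) : H := (e.toOpenPartialHomeomorph u).2

/-- The inverse of a local trivialization. -/
def inv (x : M) (g : H) : Q := e.toOpenPartialHomeomorph.symm (x, g)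

theorem apply_eq {u : Q} (hu : B.proj u ∈ e.baseSet) :
    e.toOpenPartialHomeomorph u = (B.proj u, e.fib u) :=
  Prod.ext (e.toTrivialization.coe_fst' hu) rfl

theorem mem_source {u : Q} : u ∈ e.source ↔ B.proj u ∈ e.baseSet := e.toTrivialization.mem_source

theorem mem_target {z : M × H} : z ∈ e.target ↔ z.1 ∈ e.baseSet := e.toTrivialization.mem_target

theorem inv_proj_fib {u : Q} (hu : B.proj u ∈ e.baseSet) : e.inv (B.proj u) (e.fib u) = u := by
  rw [inv, ← e.apply_eq hu]
  exact e.left_inv (e.mem_source.2 hu)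

theorem apply_inv {x : M} (hx : x ∈ e.baseSet) (g : H) :
    e.toOpenPartialHomeomorph (e.inv x g) = (x, g) :=
  e.right_inv (e.mem_target.2 hx)

theorem proj_inv {x : M} (hx : x ∈ e.baseSet) (g : H) : B.proj (e.inv x g) = x := by
  have h : e.inv x g ∈ e.source := e.map_target (e.mem_target.2 hx)
  have h2 := e.apply_eq (e.mem_source.1 h)
  rw [e.apply_inv hx] at h2
  exact (congrArg Prod.fst h2).symm

theorem fib_inv {x : M} (hx : x ∈ e.baseSet) (g : H) : e.fib (e.inv x g) = g :=
  congrArg Prod.snd (e.apply_inv hx g)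

theorem fib_act {u : Q} (hu : B.proj u ∈ e.baseSet) (g : H) : e.fib (B.act u g) = e.fib u * g :=
  congrArg Prod.snd (e.map_act u (e.mem_source.2 hu) g)

theorem inv_mul {x : M} (hx : x ∈ e.baseSet) (g h : H) : e.inv x (g * h) = B.act (e.inv x g) h := by
  have h1 : B.proj (B.act (e.inv x g) h) = x := by rw [B.proj_act, e.proj_inv hx]
  have h2 : B.proj (e.inv x g) ∈ e.baseSet := by rwa [e.proj_inv hx]
  rw [← e.inv_proj_fib (u := B.act (e.inv x g) h) (by rwa [h1]), h1, e.fib_act h2, e.fib_inv hx]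

theorem contMDiffOn_fib : ContMDiffOn 𝓘(ℝ, EQ) 𝓘(ℝ, EH) ∞ e.fib (B.proj ⁻¹' e.baseSet) :=
  (contMDiff_snd.comp_contMDiffOn e.smooth).mono fun _ hu => e.mem_source.2 hu

theorem contMDiffOn_inv : ContMDiffOn (𝓘(ℝ, EM).prod 𝓘(ℝ, EH)) 𝓘(ℝ, EQ) ∞
    (fun z : M × H => e.inv z.1 z.2) (e.baseSet ×ˢ Set.univ) :=
  e.smooth_symm.mono fun _ hz => e.mem_target.2 hz.1

theorem isOpen_preimage_baseSet : IsOpen (B.proj ⁻¹' e.baseSet) :=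
  e.open_baseSet.preimage B.smooth_proj.continuous

end SmoothTrivialization

/-- Two points in the same fiber differ by an element of the structure group. -/
theorem exists_act_eq {u v : Q} (h : B.proj u = B.proj v) : ∃ g, B.act u g = v := by
  obtain ⟨e, he⟩ := B.exists_smoothTrivialization (B.proj u)
  have he' : B.proj v ∈ e.baseSet := h ▸ he
  refine ⟨(e.fib u)⁻¹ * e.fib v, ?_⟩
  have h1 := e.inv_mul he (e.fib u) ((e.fib u)⁻¹ * e.fib v)
  rw [e.inv_proj_fib he, mul_inv_cancel_left] at h1
  rw [← h1, h, e.inv_proj_fib he']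

theorem act_right_injective (u : Q) {g h : H} (hgh : B.act u g = B.act u h) : g = h := by
  obtain ⟨e, he⟩ := B.exists_smoothTrivialization (B.proj u)
  have := congrArg e.fib hgh
  rwa [e.fib_act he, e.fib_act he, mul_right_inj] at this

theorem contMDiff_act_right (g : H) : ContMDiff 𝓘(ℝ, EQ) 𝓘(ℝ, EQ) ∞ (fun u => B.act u g) :=
  B.smooth_act.comp (contMDiff_id.prodMk contMDiff_const)

theorem contMDiff_act_left (u : Q) : ContMDiff 𝓘(ℝ, EH) 𝓘(ℝ, EQ) ∞ (fun g => B.act u g) :=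
  B.smooth_act.comp (contMDiff_const.prodMk contMDiff_id)

end PrincipalBundle

/-- `q : Q → Q₀` is the quotient map for the action of the kernel of `ϖ` on a principal bundle. -/
structure IsQuotientBy (B : PrincipalBundle EM M EH H EQ Q) (ϖ : H →* H₀) (q : Q → Q₀) : Prop where
  isQuotientMap : IsQuotientMap q
  eq_iff : ∀ u v, q u = q v ↔ ∃ g, ϖ g = 1 ∧ B.act u g = v

namespace IsQuotientBy

variable {B : PrincipalBundle EM M EH H EQ Q} {ϖ : H →* H₀} {q : Q → Q₀} (hq : IsQuotientBy B ϖ q)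

include hq

theorem map_act_congr {u v : Q} {g h : H} (huv : q u = q v) (hgh : ϖ g = ϖ h) :
    q (B.act u g) = q (B.act v h) := by
  obtain ⟨n, hn, rfl⟩ := (hq.eq_iff u v).1 huv
  refine (hq.eq_iff _ _).2 ⟨g⁻¹ * n * h, by simp [hn, hgh], ?_⟩
  rw [← B.act_mul, ← B.act_mul]
  congr 1
  group

theorem isOpenMap : IsOpenMap q := by
  intro U hU
  rw [← hq.isQuotientMap.isOpen_preimage]
  have h : q ⁻¹' (q '' U) = ⋃ g ∈ (ϖ.ker : Set H), (fun u => B.act u g) ⁻¹' U := by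
    ext v
    simp only [Set.mem_preimage, Set.mem_image, Set.mem_iUnion, SetLike.mem_coe, MonoidHom.mem_ker,
      exists_prop]
    constructor
    · rintro ⟨u, hu, huv⟩
      obtain ⟨g, hg, rfl⟩ := (hq.eq_iff v u).1 huv.symm
      exact ⟨g, hg, hu⟩
    · rintro ⟨g, hg, hu⟩
      exact ⟨_, hu, ((hq.eq_iff _ _).2 ⟨g, hg, rfl⟩).symm⟩
  rw [h]
  exact isOpen_biUnion fun g _ => hU.preimage (B.contMDiff_act_right g).continuous

/-- The projection of the quotient bundle. By `proj_map`, it does not depend on the representatives. -/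
def proj (r : Q₀) : M := B.proj (Function.surjInv hq.isQuotientMap.surjective r)

theorem map_surjInv (r : Q₀) : q (Function.surjInv hq.isQuotientMap.surjective r) = r :=
  Function.surjInv_eq _ r

theorem proj_map (u : Q) : hq.proj (q u) = B.proj u := by
  obtain ⟨n, -, hn⟩ := (hq.eq_iff _ _).1 (hq.map_surjInv (q u))
  exact (B.proj_act _ n).symm.trans (congrArg B.proj hn)

theorem continuous_proj : Continuous hq.proj := by
  rw [hq.isQuotientMap.continuous_iff]
  exact B.smooth_proj.continuous.congr fun u => (hq.proj_map u).symm

/-- The fiber coordinate on the quotient bundle. By `fib_map`, it does not depend on the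
representatives. -/
def fib (e : B.SmoothTrivialization) (r : Q₀) : H₀ :=
  ϖ (e.fib (Function.surjInv hq.isQuotientMap.surjective r))

theorem fib_map (e : B.SmoothTrivialization) {u : Q} (hu : B.proj u ∈ e.baseSet) :
    hq.fib e (q u) = ϖ (e.fib u) := by
  obtain ⟨n, hn, h⟩ := (hq.eq_iff _ _).1 (hq.map_surjInv (q u)).symm
  rw [fib, ← h, e.fib_act hu, map_mul, hn, mul_one]

variable {s : H₀ →* H} (hs : ∀ g, ϖ (s g) = g)

include hs

theorem map_inv_fib (e : B.SmoothTrivialization) {r : Q₀} (hr : hq.proj r ∈ e.baseSet) :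
    q (e.inv (hq.proj r) (s (hq.fib e r))) = r := by
  obtain ⟨u, rfl⟩ := hq.isQuotientMap.surjective r
  rw [hq.proj_map] at hr ⊢
  rw [hq.fib_map e hr]
  conv_rhs => rw [← e.inv_proj_fib hr]
  refine (hq.eq_iff _ _).2 ⟨(s (ϖ (e.fib u)))⁻¹ * e.fib u, by simp [hs], ?_⟩
  rw [← e.inv_mul hr, mul_inv_cancel_left]

variable [TopologicalSpace H₀] (hϖc : Continuous ϖ) (hsc : Continuous s)

/-- The local homeomorphism of the quotient bundle to `M × H₀` induced by a local trivialization. -/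
def localHomeo (e : B.SmoothTrivialization) : OpenPartialHomeomorph Q₀ (M × H₀) where
  toFun r := (hq.proj r, hq.fib e r)
  invFun z := q (e.inv z.1 (s z.2))
  source := hq.proj ⁻¹' e.baseSet
  target := e.baseSet ×ˢ Set.univ
  map_source' r hr := ⟨hr, trivial⟩
  map_target' z hz := by
    rw [Set.mem_preimage, hq.proj_map, e.proj_inv hz.1]; exact hz.1
  left_inv' r hr := hq.map_inv_fib hs e hr
  right_inv' z hz := by
    have h : B.proj (e.inv z.1 (s z.2)) = z.1 := e.proj_inv hz.1 _
    ext
    · rw [hq.proj_map, h]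
    · rw [hq.fib_map e (by rw [h]; exact hz.1), e.fib_inv hz.1, hs]
  open_source := e.open_baseSet.preimage hq.continuous_proj
  open_target := e.open_baseSet.prod isOpen_univ
  continuousOn_toFun := by
    refine hq.continuous_proj.continuousOn.prodMk ?_
    rw [hq.isQuotientMap.continuousOn_isOpen_iff (e.open_baseSet.preimage hq.continuous_proj)]
    have h : q ⁻¹' (hq.proj ⁻¹' e.baseSet) = B.proj ⁻¹' e.baseSet := by
      ext u; simp [hq.proj_map]
    rw [h]
    exact (hϖc.comp_continuousOn e.contMDiffOn_fib.continuousOn).congr fun u hu => hq.fib_map e hu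
  continuousOn_invFun := by
    refine hq.isQuotientMap.continuous.comp_continuousOn ?_
    refine e.contMDiffOn_inv.continuousOn.comp
      (continuous_fst.prodMk (hsc.comp continuous_snd)).continuousOn fun z hz => ⟨hz.1, trivial⟩

variable [T2Space M] [T2Space H₀]

include hϖc hsc in
/-- Points over different base points are separated by the projection, points over the same base point
by a local trivialization. -/
theorem t2Space : T2Space Q₀ := by
  refine ⟨fun r r' hr => ?_⟩
  by_cases hp : hq.proj r = hq.proj r'
  · obtain ⟨e, he⟩ := B.exists_smoothTrivialization (hq.proj r)
    set c := hq.localHomeo hs hϖc hsc e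
    have h1 : r ∈ c.source := he
    have h2 : r' ∈ c.source := show hq.proj r' ∈ e.baseSet from hp ▸ he
    obtain ⟨V, V', hV, hV', hrV, hrV', hd⟩ := t2_separation fun h => hr (c.injOn h1 h2 h)
    refine ⟨_, _, c.isOpen_inter_preimage hV, c.isOpen_inter_preimage hV', ⟨h1, hrV⟩, ⟨h2, hrV'⟩, ?_⟩
    exact ((hd.preimage c).mono_left Set.inter_subset_right).mono_right Set.inter_subset_right
  · exact separated_by_continuous hq.continuous_proj hp

end IsQuotientBy

namespace IsQuotientBy

variable {B : PrincipalBundle EM M EH H EQ Q} {ϖ : H →* H₀} {q : Q → Q₀} (hq : IsQuotientBy B ϖ q)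
  {s : H₀ →* H} (hs : ∀ g, ϖ (s g) = g) [TopologicalSpace H₀] [ChartedSpace EH₀ H₀]
  (hϖ : ContMDiff 𝓘(ℝ, EH) 𝓘(ℝ, EH₀) ∞ ϖ) (hsm : ContMDiff 𝓘(ℝ, EH₀) 𝓘(ℝ, EH) ∞ s)

/-- The local trivializations of `Q` induce a smooth structure on the quotient bundle. -/
theorem exists_chartedSpace [IsManifold 𝓘(ℝ, EM) ∞ M] [IsManifold 𝓘(ℝ, EH₀) ∞ H₀] :
    ∃ (_ : ChartedSpace (EM × EH₀) Q₀), IsManifold 𝓘(ℝ, EM × EH₀) ∞ Q₀ ∧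
      ∀ e : B.SmoothTrivialization,
        ContMDiffOn 𝓘(ℝ, EM × EH₀) (𝓘(ℝ, EM).prod 𝓘(ℝ, EH₀)) ∞
          (hq.localHomeo hs hϖ.continuous hsm.continuous e)
          (hq.localHomeo hs hϖ.continuous hsm.continuous e).source ∧
        ContMDiffOn (𝓘(ℝ, EM).prod 𝓘(ℝ, EH₀)) 𝓘(ℝ, EM × EH₀) ∞
          (hq.localHomeo hs hϖ.continuous hsm.continuous e).symm
          (hq.localHomeo hs hϖ.continuous hsm.continuous e).target := by
  let : ChartedSpace (EM × EH₀) (M × H₀) := prodChartedSpace EM M EH₀ H₀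
  have : IsManifold 𝓘(ℝ, EM × EH₀) ∞ (M × H₀) := isManifold_prod_self
  set c := fun e => hq.localHomeo hs hϖ.continuous hsm.continuous e with hc
  have he : ∀ r, ∃ e, r ∈ (c e).source := fun r => B.exists_smoothTrivialization (hq.proj r)
  have hT : ∀ e e', ContMDiffOn 𝓘(ℝ, EM × EH₀) 𝓘(ℝ, EM × EH₀) ∞ ((c e).symm ≫ₕ c e')
      ((c e).symm ≫ₕ c e').source := by
    intro e e'
    rw [contMDiffOn_self_prod_prod_iff]
    have hsrc : ((c e).symm ≫ₕ c e').source ⊆ (e.baseSet ∩ e'.baseSet) ×ˢ Set.univ := by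
      rintro z ⟨hz, hz'⟩
      refine ⟨⟨hz.1, ?_⟩, trivial⟩
      have h : hq.proj (q (e.inv z.1 (s z.2))) ∈ e'.baseSet := hz'
      rwa [hq.proj_map, e.proj_inv hz.1] at h
    have h1 : ContMDiffOn (𝓘(ℝ, EM).prod 𝓘(ℝ, EH₀)) 𝓘(ℝ, EQ) ∞
        (fun z : M × H₀ => e.inv z.1 (s z.2)) ((e.baseSet ∩ e'.baseSet) ×ˢ Set.univ) :=
      e.contMDiffOn_inv.comp (contMDiff_fst.prodMk (hsm.comp contMDiff_snd)).contMDiffOn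
        fun z hz => ⟨hz.1.1, trivial⟩
    have h2 : ContMDiffOn (𝓘(ℝ, EM).prod 𝓘(ℝ, EH₀)) 𝓘(ℝ, EH₀) ∞
        (fun z : M × H₀ => ϖ (e'.fib (e.inv z.1 (s z.2))))
        ((e.baseSet ∩ e'.baseSet) ×ˢ Set.univ) :=
      hϖ.comp_contMDiffOn (e'.contMDiffOn_fib.comp h1 fun z hz => by
        rw [Set.mem_preimage, Set.mem_preimage, e.proj_inv hz.1.1]; exact hz.1.2)
    refine ((contMDiff_fst.contMDiffOn.prodMk h2).mono hsrc).congr fun z hz => ?_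
    obtain ⟨⟨hz1, hz2⟩, -⟩ := hsrc hz
    have h3 : B.proj (e.inv z.1 (s z.2)) = z.1 := e.proj_inv hz1 _
    refine Prod.ext ?_ ?_
    · exact (hq.proj_map _).trans h3
    · exact hq.fib_map e' (by rw [h3]; exact hz2)
  let := chartedSpaceOfLocalHomeos (EM × EH₀) c he
  exact ⟨inferInstance, isManifold_of_localHomeos _ c he hT,
    fun e => ⟨contMDiffOn_prod_self_iff.1 (contMDiffOn_localHomeo _ c he hT e),
      contMDiffOn_self_prod_iff.1 (contMDiffOn_localHomeo_symm _ c he hT e)⟩⟩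

variable [ChartedSpace (EM × EH₀) Q₀]
  (hc : ∀ e : B.SmoothTrivialization,
    ContMDiffOn 𝓘(ℝ, EM × EH₀) (𝓘(ℝ, EM).prod 𝓘(ℝ, EH₀)) ∞
      (hq.localHomeo hs hϖ.continuous hsm.continuous e)
      (hq.localHomeo hs hϖ.continuous hsm.continuous e).source ∧
    ContMDiffOn (𝓘(ℝ, EM).prod 𝓘(ℝ, EH₀)) 𝓘(ℝ, EM × EH₀) ∞
      (hq.localHomeo hs hϖ.continuous hsm.continuous e).symm
      (hq.localHomeo hs hϖ.continuous hsm.continuous e).target)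

include hc in
theorem contMDiff_quotientMap : ContMDiff 𝓘(ℝ, EQ) 𝓘(ℝ, EM × EH₀) ∞ q := by
  intro u
  obtain ⟨e, he⟩ := B.exists_smoothTrivialization (B.proj u)
  have h1 : ContMDiffOn 𝓘(ℝ, EQ) (𝓘(ℝ, EM).prod 𝓘(ℝ, EH₀)) ∞
      (fun v => (B.proj v, ϖ (e.fib v))) (B.proj ⁻¹' e.baseSet) :=
    B.smooth_proj.contMDiffOn.prodMk (hϖ.comp_contMDiffOn e.contMDiffOn_fib)
  have h2 := (hc e).2.comp h1 fun v hv => ⟨hv, trivial⟩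
  refine (h2.congr fun v hv => ?_).contMDiffAt (e.isOpen_preimage_baseSet.mem_nhds he)
  refine (hq.map_inv_fib hs e (r := q v) ?_).symm.trans ?_
  · rwa [hq.proj_map]
  · rw [hq.proj_map, hq.fib_map e hv]; rfl

/-- The quotient of a principal `H`-bundle by the kernel of a homomorphism `H → H₀` that has a
smooth section, as a principal `H₀`-bundle. -/
def principalBundle [LieGroup 𝓘(ℝ, EH₀) ∞ H₀] :
    PrincipalBundle EM M EH₀ H₀ (EM × EH₀) Q₀ :=
  have hact : ∀ u g, q (B.act (Function.surjInv hq.isQuotientMap.surjective (q u)) (s g)) =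
      q (B.act u (s g)) := fun u g => hq.map_act_congr (hq.map_surjInv _) rfl
  have hfib : ∀ (e : B.SmoothTrivialization) (r : Q₀), hq.proj r ∈ e.baseSet → ∀ g,
      hq.fib e (q (B.act (Function.surjInv hq.isQuotientMap.surjective r) (s g))) =
        hq.fib e r * g := by
    intro e r hr g
    obtain ⟨u, rfl⟩ := hq.isQuotientMap.surjective r
    rw [hq.proj_map] at hr
    rw [hact, hq.fib_map e (by rwa [B.proj_act]), hq.fib_map e hr, e.fib_act hr, map_mul, hs]
  have hproj : ∀ r g, hq.proj (q (B.act (Function.surjInv hq.isQuotientMap.surjective r) (s g))) =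
      hq.proj r := by
    intro r g
    obtain ⟨u, rfl⟩ := hq.isQuotientMap.surjective r
    rw [hact, hq.proj_map, hq.proj_map, B.proj_act]
  { proj := hq.proj
    act := fun r g => q (B.act (Function.surjInv hq.isQuotientMap.surjective r) (s g))
    act_one := fun r => by rw [map_one, B.act_one, hq.map_surjInv]
    act_mul := fun r g h => by rw [hact, map_mul, B.act_mul]
    proj_act := hproj
    smooth_proj := by
      intro r
      obtain ⟨e, he⟩ := B.exists_smoothTrivialization (hq.proj r)
      exact ((contMDiff_fst.comp_contMDiffOn (hc e).1).contMDiffAt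
        ((hq.localHomeo hs hϖ.continuous hsm.continuous e).open_source.mem_nhds he))
    smooth_act := by
      rintro ⟨r, g⟩
      obtain ⟨e, he⟩ := B.exists_smoothTrivialization (hq.proj r)
      set c := hq.localHomeo hs hϖ.continuous hsm.continuous e with hcdef
      have h1 : ContMDiffOn (𝓘(ℝ, EM × EH₀).prod 𝓘(ℝ, EH₀)) (𝓘(ℝ, EM).prod 𝓘(ℝ, EH₀)) ∞
          (fun z : Q₀ × H₀ => c z.1) (c.source ×ˢ Set.univ) :=
        (hc e).1.comp contMDiffOn_fst fun z hz => hz.1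
      have h2 : ContMDiffOn (𝓘(ℝ, EM × EH₀).prod 𝓘(ℝ, EH₀)) (𝓘(ℝ, EM).prod 𝓘(ℝ, EH₀)) ∞
          (fun z : Q₀ × H₀ => ((c z.1).1, (c z.1).2 * z.2)) (c.source ×ˢ Set.univ) :=
        (contMDiff_fst.comp_contMDiffOn h1).prodMk
          ((contMDiff_snd.comp_contMDiffOn h1).mul contMDiffOn_snd)
      have h3 := (hc e).2.comp h2 fun z hz => ⟨hz.1, trivial⟩
      refine (h3.congr fun z hz => ?_).contMDiffAt
        ((c.open_source.prod isOpen_univ).mem_nhds ⟨he, trivial⟩)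
      have h4 : q (B.act (Function.surjInv hq.isQuotientMap.surjective z.1) (s z.2)) ∈ c.source :=
        show hq.proj _ ∈ e.baseSet by rw [hproj]; exact hz.1
      refine (c.left_inv h4).symm.trans (congrArg c.symm ?_)
      exact Prod.ext (hproj _ _) (hfib e _ hz.1 _)
    exists_trivialization := by
      intro x
      obtain ⟨e, he⟩ := B.exists_smoothTrivialization x
      set c := hq.localHomeo hs hϖ.continuous hsm.continuous e with hcdef
      refine ⟨{ c with
          baseSet := e.baseSet
          open_baseSet := e.open_baseSet
          source_eq := rfl
          target_eq := rfl
          proj_toFun := fun _ _ => rfl }, he, (hc e).1, (hc e).2, fun r hr g => ?_⟩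
      exact Prod.ext (hproj _ _) (hfib e _ hr _) }

end IsQuotientBy

/-- The quotient of a principal `H`-bundle by the kernel of a smooth homomorphism `ϖ : H → H₀` with
a smooth homomorphic section `s` is a principal `H₀`-bundle. -/
theorem IsQuotientBy.exists_principalBundle {B : PrincipalBundle EM M EH H EQ Q} {ϖ : H →* H₀}
    {q : Q → Q₀} (hq : IsQuotientBy B ϖ q) {s : H₀ →* H} (hs : ∀ g, ϖ (s g) = g)
    [TopologicalSpace H₀] [ChartedSpace EH₀ H₀] [LieGroup 𝓘(ℝ, EH₀) ∞ H₀]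
    [IsManifold 𝓘(ℝ, EM) ∞ M]
    (hϖ : ContMDiff 𝓘(ℝ, EH) 𝓘(ℝ, EH₀) ∞ ϖ) (hsm : ContMDiff 𝓘(ℝ, EH₀) 𝓘(ℝ, EH) ∞ s) :
    ∃ (_ : ChartedSpace (EM × EH₀) Q₀) (_ : IsManifold 𝓘(ℝ, EM × EH₀) ∞ Q₀)
      (B₀ : PrincipalBundle EM M EH₀ H₀ (EM × EH₀) Q₀),
      ContMDiff 𝓘(ℝ, EQ) 𝓘(ℝ, EM × EH₀) ∞ q ∧ (∀ u, B₀.proj (q u) = B.proj u) ∧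
        ∀ u g, q (B.act u (s g)) = B₀.act (q u) g := by
  obtain ⟨i, hi, hc⟩ := hq.exists_chartedSpace hs hϖ hsm
  exact ⟨i, hi, hq.principalBundle hs hϖ hsm hc, hq.contMDiff_quotientMap hs hϖ hsm hc,
    hq.proj_map, fun u g => hq.map_act_congr (hq.map_surjInv _).symm rfl⟩

end QuotientBundle

/-! ### Tangent maps -/

section TangentMaps

variable {E₁ : Type*} [NormedAddCommGroup E₁] [NormedSpace ℝ E₁]
  {M₁ : Type*} [TopologicalSpace M₁] [ChartedSpace E₁ M₁]
  {E₂ : Type*} [NormedAddCommGroup E₂] [NormedSpace ℝ E₂]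
  {M₂ : Type*} [TopologicalSpace M₂] [ChartedSpace E₂ M₂]
  {E₃ : Type*} [NormedAddCommGroup E₃] [NormedSpace ℝ E₃]
  {M₃ : Type*} [TopologicalSpace M₃] [ChartedSpace E₃ M₃]

theorem eq_of_tangentBundle_mk_eq {x : M₁} {v w : TangentSpace 𝓘(ℝ, E₁) x}
    (h : (⟨x, v⟩ : TangentBundle 𝓘(ℝ, E₁) M₁) = ⟨x, w⟩) : v = w :=
  eq_of_heq (TotalSpace.mk.inj h).2

theorem tangentMap_congr_of_eventuallyEq {f g : M₁ → M₂} {z : TangentBundle 𝓘(ℝ, E₁) M₁}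
    (h : f =ᶠ[nhds z.1] g) :
    tangentMap 𝓘(ℝ, E₁) 𝓘(ℝ, E₂) f z = tangentMap 𝓘(ℝ, E₁) 𝓘(ℝ, E₂) g z :=
  tangentBundle_mk_eq h.eq_of_nhds (DFunLike.congr_fun (h.mfderiv_eq (I := 𝓘(ℝ, E₁)) (I' := 𝓘(ℝ, E₂))) z.2)

/-- The partial derivative of a smooth map `f : M₁ × M₂ → M₃` in the direction of a vector field on
the first factor is smooth along smooth maps. -/
theorem contMDiffOn_tangentMap_partial [IsManifold 𝓘(ℝ, E₁) 1 M₁] [IsManifold 𝓘(ℝ, E₂) 1 M₂]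
    [IsManifold 𝓘(ℝ, E₃) 1 M₃] {f : M₁ × M₂ → M₃} {S : Set (M₁ × M₂)} (hS : IsOpen S)
    (hf : ContMDiffOn (𝓘(ℝ, E₁).prod 𝓘(ℝ, E₂)) 𝓘(ℝ, E₃) ∞ f S)
    {E₄ : Type*} [NormedAddCommGroup E₄] [NormedSpace ℝ E₄]
    {M₄ : Type*} [TopologicalSpace M₄] [ChartedSpace E₄ M₄] {W : Set M₄}
    {X : M₄ → TangentBundle 𝓘(ℝ, E₁) M₁} {b : M₄ → M₂}
    (hX : ContMDiffOn 𝓘(ℝ, E₄) 𝓘(ℝ, E₁).tangent ∞ X W)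
    (hb : ContMDiffOn 𝓘(ℝ, E₄) 𝓘(ℝ, E₂) ∞ b W)
    (hW : ∀ u ∈ W, ((X u).1, b u) ∈ S) :
    ContMDiffOn 𝓘(ℝ, E₄) 𝓘(ℝ, E₃).tangent ∞
      (fun u => tangentMap 𝓘(ℝ, E₁) 𝓘(ℝ, E₃) (fun x => f (x, b u)) (X u)) W := by
  have h0 : ContMDiffOn 𝓘(ℝ, E₄) 𝓘(ℝ, E₂).tangent ∞
      (fun u => (⟨b u, 0⟩ : TangentBundle 𝓘(ℝ, E₂) M₂)) W :=
    (contMDiff_zeroSection ℝ (TangentSpace 𝓘(ℝ, E₂) : M₂ → Type _)).comp_contMDiffOn hb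
  have h1 : ContMDiffOn 𝓘(ℝ, E₄) (𝓘(ℝ, E₁).prod 𝓘(ℝ, E₂)).tangent ∞
      (fun u => (equivTangentBundleProd 𝓘(ℝ, E₁) M₁ 𝓘(ℝ, E₂) M₂).symm (X u, ⟨b u, 0⟩)) W :=
    contMDiff_equivTangentBundleProd_symm.comp_contMDiffOn (hX.prodMk h0)
  have h2 := (hf.contMDiffOn_tangentMapWithin (m := ∞) (by simp) hS.uniqueMDiffOn).comp h1
    fun u hu => hW u hu
  refine h2.congr fun u hu => ?_
  have hfu : MDifferentiableAt (𝓘(ℝ, E₁).prod 𝓘(ℝ, E₂)) 𝓘(ℝ, E₃) f ((X u).1, b u) :=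
    (hf.contMDiffAt (hS.mem_nhds (hW u hu))).mdifferentiableAt (by simp)
  have h3 : MDifferentiableAt 𝓘(ℝ, E₁) (𝓘(ℝ, E₁).prod 𝓘(ℝ, E₂)) (fun x => (x, b u)) (X u).1 :=
    mdifferentiableAt_id.prodMk mdifferentiableAt_const
  have h4 : tangentMap 𝓘(ℝ, E₁) 𝓘(ℝ, E₃) (fun x => f (x, b u)) (X u) =
      tangentMap (𝓘(ℝ, E₁).prod 𝓘(ℝ, E₂)) 𝓘(ℝ, E₃) f
        (tangentMap 𝓘(ℝ, E₁) (𝓘(ℝ, E₁).prod 𝓘(ℝ, E₂)) (fun x => (x, b u)) (X u)) :=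
    tangentMap_comp_at (X u) hfu h3
  have h5 : tangentMap 𝓘(ℝ, E₁) (𝓘(ℝ, E₁).prod 𝓘(ℝ, E₂)) (fun x => (x, b u)) (X u) =
      (equivTangentBundleProd 𝓘(ℝ, E₁) M₁ 𝓘(ℝ, E₂) M₂).symm (X u, ⟨b u, 0⟩) := by
    change (⟨_, _⟩ : TangentBundle (𝓘(ℝ, E₁).prod 𝓘(ℝ, E₂)) (M₁ × M₂)) = ⟨_, _⟩
    rw [mfderiv_prod_left]
    rfl
  rw [h4, h5]
  exact (tangentMapWithin_eq_tangentMap (hS.uniqueMDiffOn _ (hW u hu)) hfu).symm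

end TangentMaps

/-! ### Local sections and lifts of vector fields -/

section LocalSections

variable {EM : Type*} [NormedAddCommGroup EM] [NormedSpace ℝ EM]
  {M : Type*} [TopologicalSpace M] [ChartedSpace EM M]
  {EH : Type*} [NormedAddCommGroup EH] [NormedSpace ℝ EH]
  {H : Type*} [TopologicalSpace H] [ChartedSpace EH H] [Group H]
  {EQ : Type*} [NormedAddCommGroup EQ] [NormedSpace ℝ EQ]
  {Q : Type*} [TopologicalSpace Q] [ChartedSpace EQ Q]
  {EH₀ : Type*} [NormedAddCommGroup EH₀] [NormedSpace ℝ EH₀]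
  {H₀ : Type*} [TopologicalSpace H₀] [ChartedSpace EH₀ H₀] [Group H₀]
  {ER : Type*} [NormedAddCommGroup ER] [NormedSpace ℝ ER]
  {R : Type*} [TopologicalSpace R] [ChartedSpace ER R]

/-- `q : Q → R` admits a smooth local section through each point of `Q`. -/
def HasLocalSections (EQ ER : Type*) [NormedAddCommGroup EQ] [NormedSpace ℝ EQ]
    [NormedAddCommGroup ER] [NormedSpace ℝ ER] {Q : Type*} [TopologicalSpace Q] [ChartedSpace EQ Q]
    {R : Type*} [TopologicalSpace R] [ChartedSpace ER R] (q : Q → R) : Prop :=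
  ∀ u, ∃ (U : Set R) (σ : R → Q), IsOpen U ∧ q u ∈ U ∧ ContMDiffOn 𝓘(ℝ, ER) 𝓘(ℝ, EQ) ∞ σ U ∧
    (∀ r ∈ U, q (σ r) = r) ∧ σ (q u) = u

theorem HasLocalSections.mfderiv_surjective {q : Q → R} (h : HasLocalSections EQ ER q)
    (hq : ContMDiff 𝓘(ℝ, EQ) 𝓘(ℝ, ER) ∞ q) (u : Q) :
    Function.Surjective (mfderiv 𝓘(ℝ, EQ) 𝓘(ℝ, ER) q u) := by
  obtain ⟨U, σ, hU, huU, hσ, hqσ, hσu⟩ := h u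
  intro w
  have h1 : MDifferentiableAt 𝓘(ℝ, ER) 𝓘(ℝ, EQ) σ (q u) :=
    (hσ.contMDiffAt (hU.mem_nhds huU)).mdifferentiableAt (by simp)
  have h2 := tangentMap_comp_at (f := σ) (g := q) (⟨q u, w⟩ : TangentBundle 𝓘(ℝ, ER) R)
    (hq.mdifferentiable (by simp) (σ (q u))) h1
  have h4 : q ∘ σ =ᶠ[nhds (q u)] id := Filter.eventuallyEq_of_mem (hU.mem_nhds huU) hqσ
  rw [tangentMap_congr_of_eventuallyEq h4, tangentMap_id] at h2
  have h3 : ∃ v : TangentSpace 𝓘(ℝ, EQ) u, tangentMap 𝓘(ℝ, ER) 𝓘(ℝ, EQ) σ ⟨q u, w⟩ = ⟨u, v⟩ :=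
    ⟨(show EQ from (tangentMap 𝓘(ℝ, ER) 𝓘(ℝ, EQ) σ ⟨q u, w⟩).2), tangentBundle_mk_eq hσu rfl⟩
  obtain ⟨v, hv⟩ := h3
  rw [hv] at h2
  exact ⟨v, (eq_of_tangentBundle_mk_eq h2).symm⟩

/-- Smoothness can be checked after composition with a map which has local sections. -/
theorem HasLocalSections.contMDiffAt_of_comp {q : Q → R} (h : HasLocalSections EQ ER q)
    {EY : Type*} [NormedAddCommGroup EY] [NormedSpace ℝ EY] {HY : Type*} [TopologicalSpace HY]
    {IY : ModelWithCorners ℝ EY HY}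
    {Y : Type*} [TopologicalSpace Y] [ChartedSpace HY Y] {f : R → Y} {u : Q}
    (hf : ContMDiffAt 𝓘(ℝ, EQ) IY ∞ (fun v => f (q v)) u) :
    ContMDiffAt 𝓘(ℝ, ER) IY ∞ f (q u) := by
  obtain ⟨U, σ, hU, huU, hσ, hqσ, hσu⟩ := h u
  refine (ContMDiffAt.comp_of_eq (g := fun v => f (q v)) hf
    (hσ.contMDiffAt (hU.mem_nhds huU)) hσu).congr_of_eventuallyEq ?_
  filter_upwards [hU.mem_nhds huU] with r hr
  exact congrArg f (hqσ r hr).symm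

namespace PrincipalBundle

variable {B : PrincipalBundle EM M EH H EQ Q}

theorem hasLocalSections_proj : HasLocalSections EQ EM B.proj := by
  intro u
  obtain ⟨e, he⟩ := B.exists_smoothTrivialization (B.proj u)
  exact ⟨e.baseSet, fun x => e.inv x (e.fib u), e.open_baseSet, he,
    e.contMDiffOn_inv.comp (contMDiff_id.prodMk contMDiff_const).contMDiffOn
      fun x hx => ⟨hx, trivial⟩, fun x hx => e.proj_inv hx _, e.inv_proj_fib he⟩

/-- A smooth map between principal bundles over the same base, which is equivariant along a smooth
homomorphism `s` in the direction opposite to the map, has local sections. -/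
theorem hasLocalSections_of_equivariant [LieGroup 𝓘(ℝ, EH₀) ∞ H₀]
    {B₀ : PrincipalBundle EM M EH₀ H₀ ER R} {q : Q → R} {s : H₀ →* H}
    (hq : ContMDiff 𝓘(ℝ, EQ) 𝓘(ℝ, ER) ∞ q) (hs : ContMDiff 𝓘(ℝ, EH₀) 𝓘(ℝ, EH) ∞ s)
    (hproj : ∀ u, B₀.proj (q u) = B.proj u) (hact : ∀ u g, q (B.act u (s g)) = B₀.act (q u) g) :
    HasLocalSections EQ ER q := by
  intro u
  obtain ⟨e, he⟩ := B.exists_smoothTrivialization (B.proj u)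
  obtain ⟨e₀, he₀⟩ := B₀.exists_smoothTrivialization (B.proj u)
  -- the fiber coordinate of the image of a local section of `B`; its deviation from that of a given point
  -- is compensated by the action of an element in the image of `s`
  set k : M → H₀ := fun x => e₀.fib (q (e.inv x (e.fib u))) with hk
  have hpi : ∀ x ∈ e.baseSet, B₀.proj (q (e.inv x (e.fib u))) = x := fun x hx => by
    rw [hproj, e.proj_inv hx]
  have hi : ContMDiffOn 𝓘(ℝ, EM) 𝓘(ℝ, EQ) ∞ (fun x => e.inv x (e.fib u)) e.baseSet :=
    e.contMDiffOn_inv.comp (contMDiff_id.prodMk contMDiff_const).contMDiffOn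
      fun x hx => ⟨hx, trivial⟩
  have hks : ContMDiffOn 𝓘(ℝ, EM) 𝓘(ℝ, EH₀) ∞ k (e.baseSet ∩ e₀.baseSet) :=
    e₀.contMDiffOn_fib.comp ((hq.comp_contMDiffOn hi).mono Set.inter_subset_left) fun x hx => by
      rw [Set.mem_preimage, Set.mem_preimage, hpi x hx.1]; exact hx.2
  set U : Set R := B₀.proj ⁻¹' (e.baseSet ∩ e₀.baseSet) with hU
  have hpU : ContMDiffOn 𝓘(ℝ, ER) 𝓘(ℝ, EM) ∞ B₀.proj U := B₀.smooth_proj.contMDiffOn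
  have hku : k (B.proj u) = e₀.fib (q u) := by rw [hk]; simp only [e.inv_proj_fib he]
  refine ⟨U, fun r => B.act (e.inv (B₀.proj r) (e.fib u)) (s ((k (B₀.proj r))⁻¹ * e₀.fib r)),
    (e.open_baseSet.inter e₀.open_baseSet).preimage B₀.smooth_proj.continuous, ?_, ?_, ?_, ?_⟩
  · rw [hU, Set.mem_preimage, hproj]; exact ⟨he, he₀⟩
  · have h1 : ContMDiffOn 𝓘(ℝ, ER) 𝓘(ℝ, EQ) ∞ (fun r => e.inv (B₀.proj r) (e.fib u)) U :=
      hi.comp hpU fun r hr => hr.1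
    have h2 : ContMDiffOn 𝓘(ℝ, ER) 𝓘(ℝ, EH₀) ∞ (fun r => (k (B₀.proj r))⁻¹ * e₀.fib r) U :=
      (hks.comp hpU fun r hr => hr).inv.mul (e₀.contMDiffOn_fib.mono fun r hr => hr.2)
    exact B.smooth_act.comp_contMDiffOn (h1.prodMk (hs.comp_contMDiffOn h2))
  · intro r hr
    have h1 : B₀.proj (q (e.inv (B₀.proj r) (e.fib u))) = B₀.proj r := hpi _ hr.1
    rw [hact, ← e₀.inv_proj_fib (u := q (e.inv (B₀.proj r) (e.fib u))) (by rw [h1]; exact hr.2),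
      ← e₀.inv_mul (by rw [h1]; exact hr.2), h1]
    change e₀.inv _ (k (B₀.proj r) * _) = _
    rw [mul_inv_cancel_left, e₀.inv_proj_fib hr.2]
  · simp only [hproj, hku, inv_mul_cancel, map_one, B.act_one, e.inv_proj_fib he]

/-- Local lifting of vector fields along a map `q` whose fibers consist of points which differ by
elements of the structure group: the values of `σ_* X` for a local section `σ` are moved along the
fibers by the principal action. -/
theorem exists_lift_field [IsManifold 𝓘(ℝ, EQ) ∞ Q] [IsManifold 𝓘(ℝ, ER) ∞ R]
    [LieGroup 𝓘(ℝ, EH) ∞ H] {q : Q → R}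
    (hq : ContMDiff 𝓘(ℝ, EQ) 𝓘(ℝ, ER) ∞ q) (hsec : HasLocalSections EQ ER q)
    (hfib : ∀ u v, q u = q v → ∃ g, B.act u g = v ∧ ∀ w, q (B.act w g) = q w)
    {X : ∀ r : R, TangentSpace 𝓘(ℝ, ER) r} {V : Set R} (hV : IsOpen V) (hX : SmoothFieldOn X V)
    {u₀ : Q} (hu₀ : q u₀ ∈ V) :
    ∃ (W : Set Q) (η : ∀ u : Q, TangentSpace 𝓘(ℝ, EQ) u), IsOpen W ∧ u₀ ∈ W ∧ SmoothFieldOn η W ∧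
      ∀ u ∈ W, q u ∈ V ∧ mfderiv 𝓘(ℝ, EQ) 𝓘(ℝ, ER) q u (η u) = X (q u) := by
  have : IsManifold 𝓘(ℝ, EQ) 1 Q := IsManifold.of_le (n := ∞) (by simp)
  have : IsManifold 𝓘(ℝ, ER) 1 R := IsManifold.of_le (n := ∞) (by simp)
  have : IsManifold 𝓘(ℝ, EH) 1 H := IsManifold.of_le (n := ∞) (by simp)
  obtain ⟨U, σ, hU, huU, hσ, hqσ, hσu⟩ := hsec u₀
  obtain ⟨e, he⟩ := B.exists_smoothTrivialization (B.proj u₀)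
  have hproj : ∀ u v, q u = q v → B.proj u = B.proj v := fun u v huv => by
    obtain ⟨g, rfl, -⟩ := hfib u v huv
    rw [B.proj_act]
  set W : Set Q := (q ⁻¹' (U ∩ V)) ∩ B.proj ⁻¹' e.baseSet with hWdef
  have hW : IsOpen W := ((hU.inter hV).preimage hq.continuous).inter e.isOpen_preimage_baseSet
  have hpσ : ∀ u ∈ W, B.proj (σ (q u)) = B.proj u := fun u hu => hproj _ _ (hqσ _ hu.1.1)
  -- the element of the structure group which moves `σ (q u)` to `u`
  set b : Q → H := fun u => (e.fib (σ (q u)))⁻¹ * e.fib u with hbdef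
  have hb : ContMDiffOn 𝓘(ℝ, EQ) 𝓘(ℝ, EH) ∞ b W := by
    have h1 : ContMDiffOn 𝓘(ℝ, EQ) 𝓘(ℝ, EQ) ∞ (fun u => σ (q u)) W :=
      hσ.comp hq.contMDiffOn fun u hu => hu.1.1
    exact (e.contMDiffOn_fib.comp h1 fun u hu => by
      rw [Set.mem_preimage, Set.mem_preimage, hpσ u hu]; exact hu.2).inv.mul
      (e.contMDiffOn_fib.mono fun u hu => hu.2)
  have hbu : ∀ u ∈ W, B.act (σ (q u)) (b u) = u := fun u hu => by
    have h1 := hpσ u hu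
    have h2 : B.proj (σ (q u)) ∈ e.baseSet := by rw [h1]; exact hu.2
    have h3 := e.inv_mul h2 (e.fib (σ (q u))) (b u)
    rw [e.inv_proj_fib h2, hbdef] at h3
    rw [← h3, mul_inv_cancel_left, h1, e.inv_proj_fib hu.2]
  have hbq : ∀ u ∈ W, ∀ w, q (B.act w (b u)) = q w := fun u hu w => by
    obtain ⟨g, hg, hgq⟩ := hfib (σ (q u)) u (hqσ _ hu.1.1)
    rw [B.act_right_injective _ ((hbu u hu).trans hg.symm), hgq]
  set f : R × H → Q := fun z => B.act (σ z.1) z.2 with hfdef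
  have hf : ContMDiffOn (𝓘(ℝ, ER).prod 𝓘(ℝ, EH)) 𝓘(ℝ, EQ) ∞ f (U ×ˢ Set.univ) :=
    B.smooth_act.comp_contMDiffOn
      ((hσ.comp contMDiffOn_fst fun z hz => hz.1).prodMk contMDiffOn_snd)
  set τ : Q → TangentBundle 𝓘(ℝ, EQ) Q := fun u =>
    tangentMap 𝓘(ℝ, ER) 𝓘(ℝ, EQ) (fun x => f (x, b u)) ⟨q u, X (q u)⟩ with hτdef
  have hτ : ContMDiffOn 𝓘(ℝ, EQ) 𝓘(ℝ, EQ).tangent ∞ τ W :=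
    contMDiffOn_tangentMap_partial (hU.prod isOpen_univ) hf
      (hX.comp hq.contMDiffOn fun u hu => hu.1.2) hb fun u hu => ⟨hu.1.1, trivial⟩
  set η : ∀ u : Q, TangentSpace 𝓘(ℝ, EQ) u := fun u => (show EQ from (τ u).2) with hηdef
  have hη : ∀ u ∈ W, (⟨u, η u⟩ : TangentBundle 𝓘(ℝ, EQ) Q) = τ u := fun u hu =>
    tangentBundle_mk_eq (hbu u hu).symm rfl
  refine ⟨W, η, hW, ⟨⟨huU, hu₀⟩, he⟩, hτ.congr hη, fun u hu => ⟨hu.1.2, ?_⟩⟩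
  have h1 : MDifferentiableAt 𝓘(ℝ, ER) 𝓘(ℝ, EQ) (fun x => f (x, b u)) (q u) := by
    refine ContMDiffAt.mdifferentiableAt (n := ∞) ?_ (by simp)
    exact ((B.contMDiff_act_right (b u)).comp_contMDiffOn hσ).contMDiffAt (hU.mem_nhds hu.1.1)
  have h2 := tangentMap_comp_at (f := fun x => f (x, b u)) (g := q)
    (⟨q u, X (q u)⟩ : TangentBundle 𝓘(ℝ, ER) R)
    (hq.mdifferentiable (by simp) _) h1
  have h3 : q ∘ (fun x => f (x, b u)) =ᶠ[nhds (q u)] id := by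
    filter_upwards [hU.mem_nhds hu.1.1] with r hr
    exact (hbq u hu _).trans (hqσ r hr)
  rw [tangentMap_congr_of_eventuallyEq h3, tangentMap_id] at h2
  have h4 : tangentMap 𝓘(ℝ, EQ) 𝓘(ℝ, ER) q ⟨u, η u⟩ = ⟨q u, X (q u)⟩ := by
    rw [hη u hu]; exact h2.symm
  exact eq_of_tangentBundle_mk_eq h4

end PrincipalBundle

end LocalSections

/-! ### Smooth coordinates -/

section SmoothCoordinates

variable {EQ : Type*} [NormedAddCommGroup EQ] [NormedSpace ℝ EQ]
  {Q : Type*} [TopologicalSpace Q] [ChartedSpace EQ Q]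

theorem contMDiffOn_det {n : ℕ} {N : Q → Matrix (Fin n) (Fin n) ℝ} {W : Set Q}
    (hN : ∀ i j, ContMDiffOn 𝓘(ℝ, EQ) 𝓘(ℝ, ℝ) ∞ (fun u => N u i j) W) :
    ContMDiffOn 𝓘(ℝ, EQ) 𝓘(ℝ, ℝ) ∞ (fun u => (N u).det) W := by
  simp only [Matrix.det_apply']
  exact contMDiffOn_finsetSum fun σ _ =>
    contMDiffOn_const.mul (contMDiffOn_finsetProd fun i _ => hN _ _)

/-- The coordinates of a fixed vector with respect to a smooth family of bases are smooth, by
Cramer's rule. -/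
theorem exists_smooth_coordinates {V : Type*} [AddCommGroup V] [Module ℝ V] {n : ℕ}
    (b : Module.Basis (Fin n) ℝ V) {W : Set Q} {c : Q → Fin n → V}
    (hc : ∀ i (l : V →ₗ[ℝ] ℝ), ContMDiffOn 𝓘(ℝ, EQ) 𝓘(ℝ, ℝ) ∞ (fun u => l (c u i)) W)
    (hli : ∀ u ∈ W, LinearIndependent ℝ (c u)) (v : V) :
    ∃ x : Q → Fin n → ℝ, (∀ i, ContMDiffOn 𝓘(ℝ, EQ) 𝓘(ℝ, ℝ) ∞ (fun u => x u i) W) ∧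
      ∀ u ∈ W, ∑ i, x u i • c u i = v := by
  set N : Q → Matrix (Fin n) (Fin n) ℝ := fun u i j => b.equivFun (c u j) i with hNdef
  have hN : ∀ i j, ContMDiffOn 𝓘(ℝ, EQ) 𝓘(ℝ, ℝ) ∞ (fun u => N u i j) W :=
    fun i j => hc j ((LinearMap.proj i).comp b.equivFun.toLinearMap)
  have hdet : ∀ u ∈ W, (N u).det ≠ 0 := by
    intro u hu
    have h : LinearIndependent ℝ (N u).col :=
      (hli u hu).map' b.equivFun.toLinearMap (LinearEquiv.ker _)
    exact ((N u).isUnit_iff_isUnit_det.1 (Matrix.linearIndependent_cols_iff_isUnit.1 h)).ne_zero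
  refine ⟨fun u => (N u).det⁻¹ • (N u).cramer (b.equivFun v), fun i => ?_, fun u hu => ?_⟩
  · have h1 : ContMDiffOn 𝓘(ℝ, EQ) 𝓘(ℝ, ℝ) ∞ (fun u => (N u).cramer (b.equivFun v) i) W := by
      simp only [Matrix.cramer_apply]
      refine contMDiffOn_det fun k j => ?_
      by_cases hj : j = i
      · subst hj
        simp only [Matrix.updateCol_self]
        exact contMDiffOn_const
      · simp only [Matrix.updateCol_ne hj]
        exact hN k j
    exact ((contMDiffOn_det hN).inv₀ hdet).mul h1
  · have h1 : (N u).mulVec ((N u).det⁻¹ • (N u).cramer (b.equivFun v)) = b.equivFun v := by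
      rw [Matrix.mulVec_smul, Matrix.mulVec_cramer, smul_smul, inv_mul_cancel₀ (hdet u hu), one_smul]
    refine b.equivFun.injective (Eq.trans ?_ h1)
    ext i
    simp only [map_sum, map_smul, Finset.sum_apply, Pi.smul_apply, Matrix.mulVec, dotProduct, hNdef,
      smul_eq_mul]
    exact Finset.sum_congr rfl fun j _ => mul_comm _ _

variable {EM : Type*} [NormedAddCommGroup EM] [NormedSpace ℝ EM]
  {M : Type*} [TopologicalSpace M] [ChartedSpace EM M] [IsManifold 𝓘(ℝ, EM) ∞ M]

/-- Linear combinations of vector fields along a map with smooth coefficients are smooth. -/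
theorem contMDiffOn_sum_smul_field {ι : Type*} [Fintype ι] {W : Set Q} {f : Q → M}
    (hf : ContMDiffOn 𝓘(ℝ, EQ) 𝓘(ℝ, EM) ∞ f W) {a : Q → ι → ℝ}
    (ha : ∀ i, ContMDiffOn 𝓘(ℝ, EQ) 𝓘(ℝ, ℝ) ∞ (fun u => a u i) W)
    {X : ι → ∀ x : M, TangentSpace 𝓘(ℝ, EM) x}
    (hX : ∀ i, ContMDiffOn 𝓘(ℝ, EQ) 𝓘(ℝ, EM).tangent ∞
      (fun u => (⟨f u, X i (f u)⟩ : TangentBundle 𝓘(ℝ, EM) M)) W) :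
    ContMDiffOn 𝓘(ℝ, EQ) 𝓘(ℝ, EM).tangent ∞
      (fun u => (⟨f u, ∑ i, a u i • X i (f u)⟩ : TangentBundle 𝓘(ℝ, EM) M)) W := by
  have : IsManifold 𝓘(ℝ, EM) 1 M := IsManifold.of_le (n := ∞) (by simp)
  intro u hu
  rw [Bundle.contMDiffWithinAt_totalSpace]
  refine ⟨hf u hu, ?_⟩
  set e := trivializationAt EM (TangentSpace 𝓘(ℝ, EM)) (f u) with he
  have h1 : ∀ i, ContMDiffWithinAt 𝓘(ℝ, EQ) 𝓘(ℝ, EM) ∞ (fun v => (e ⟨f v, X i (f v)⟩).2) W u :=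
    fun i => ((Bundle.contMDiffWithinAt_totalSpace).1 (hX i u hu)).2
  have h2 : ContMDiffWithinAt 𝓘(ℝ, EQ) 𝓘(ℝ, EM) ∞
      (fun v => ∑ i, a v i • (e ⟨f v, X i (f v)⟩).2) W u :=
    contMDiffWithinAt_finsetSum fun i _ => (ha i u hu).smul (h1 i)
  have h3 : ∀ v, f v ∈ e.baseSet →
      (e ⟨f v, ∑ i, a v i • X i (f v)⟩).2 = ∑ i, a v i • (e ⟨f v, X i (f v)⟩).2 := by
    intro v hv
    have h4 := e.linear ℝ hv
    have h5 := map_sum (h4.mk' _) (fun i => a v i • X i (f v)) Finset.univ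
    simp only [map_smul] at h5
    exact h5
  refine h2.congr_of_eventuallyEq ?_ (h3 u (mem_baseSet_trivializationAt _ _ _))
  filter_upwards [(hf u hu).continuousWithinAt.preimage_mem_nhdsWithin
    (e.open_baseSet.mem_nhds (mem_baseSet_trivializationAt _ _ _))] with v hv
  exact h3 v hv

end SmoothCoordinates

/-! ### The frames determined by a partial Cartan connection -/

section Frames

variable {E : Type*} [NormedAddCommGroup E] [NormedSpace ℝ E] [FiniteDimensional ℝ E]
  {G : Type*} [TopologicalSpace G] [T2Space G]
  [ChartedSpace E G] [Group G] [LieGroup 𝓘(ℝ, E) ∞ G] {A : AHSPair E G}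
  {EP : Type*} [NormedAddCommGroup EP] [NormedSpace ℝ EP] [ChartedSpace EP A.P]
  {EM : Type*} [NormedAddCommGroup EM] [NormedSpace ℝ EM]
  {M : Type*} [TopologicalSpace M] [ChartedSpace EM M] [IsManifold 𝓘(ℝ, EM) ∞ M]
  {F : InvolutiveDistribution EM M (Module.finrank ℝ (LieAlg E G ⧸ A.p))}
  {EQ : Type*} [NormedAddCommGroup EQ] [NormedSpace ℝ EQ]
  {Q : Type*} [TopologicalSpace Q] [ChartedSpace EQ Q] [IsManifold 𝓘(ℝ, EQ) ∞ Q]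

theorem InvolutiveDistribution.finrank_toField {n : ℕ} (F : InvolutiveDistribution EM M n) (x : M) :
    Module.finrank ℝ (F.toField x) = n := by
  obtain ⟨U, -, hx, X, -, hX⟩ := F.exists_frame x
  rw [← (hX x hx).2, finrank_span_eq_card (hX x hx).1, Fintype.card_fin]

theorem InvolutiveDistribution.finite_toField {n : ℕ} (F : InvolutiveDistribution EM M n) (x : M) :
    FiniteDimensional ℝ (F.toField x) := by
  obtain ⟨U, -, hx, X, -, hX⟩ := F.exists_frame x
  rw [← (hX x hx).2]
  exact FiniteDimensional.span_of_finite ℝ (Set.finite_range _)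

namespace PartialCartanGeometry

variable (C : PartialCartanGeometry A EP F EQ Q)

omit [T2Space G] in
theorem mfderiv_proj_fundamental (a : LieAlg EP A.P) (u : Q) :
    mfderiv 𝓘(ℝ, EQ) 𝓘(ℝ, EM) C.proj u (C.toPrincipalBundle.fundamental a u) = 0 := by
  have h0 : (⟨u, C.toPrincipalBundle.fundamental a u⟩ : TangentBundle 𝓘(ℝ, EQ) Q) =
      tangentMap 𝓘(ℝ, EP) 𝓘(ℝ, EQ) (fun g : A.P => C.act u g) ⟨1, a⟩ :=
    tangentBundle_mk_eq (C.act_one u).symm rfl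
  have h1 := tangentMap_comp_at (f := fun g : A.P => C.act u g) (g := C.proj)
    (⟨1, a⟩ : TangentBundle 𝓘(ℝ, EP) A.P) (C.smooth_proj.mdifferentiable (by simp) _)
    ((C.contMDiff_act_left u).mdifferentiable (by simp) _)
  rw [← h0] at h1
  have h2 : C.proj ∘ (fun g : A.P => C.act u g) = fun _ => C.proj u :=
    funext fun g => C.proj_act u g
  have h3 : tangentMap 𝓘(ℝ, EP) 𝓘(ℝ, EM) (C.proj ∘ (fun g : A.P => C.act u g)) ⟨1, a⟩ =
      ⟨C.proj u, 0⟩ := by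
    rw [h2]
    refine tangentBundle_mk_eq rfl ?_
    rw [mfderiv_const]
    rfl
  exact eq_of_tangentBundle_mk_eq (h1.symm.trans h3)

variable (hP : Manifold.IsSmoothEmbedding 𝓘(ℝ, EP) 𝓘(ℝ, E) ∞ (Subtype.val : A.P → G))
include hP

/-- A partial Cartan connection induces linear isomorphisms from `𝔤 / 𝔭` to the fibers of the
distribution on the base: by reproduction of fundamental fields, `ω(u)⁻¹(𝔭)` is vertical, and the
dimensions agree. -/
theorem exists_frame (u : Q) : ∃ f : (LieAlg E G ⧸ A.p) ≃ₗ[ℝ] F.toField (C.proj u),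
    ∀ ξ : F.toField.lift (EQ := EQ) C.proj u, ((f (C.projected u ξ)).1 : TangentSpace 𝓘(ℝ, EM) (C.proj u)) =
      mfderiv 𝓘(ℝ, EQ) 𝓘(ℝ, EM) C.proj u ξ.1 := by
  have := F.finite_toField (C.proj u)
  let t : F.toField.lift (EQ := EQ) C.proj u →ₗ[ℝ] F.toField (C.proj u) :=
    (mfderiv 𝓘(ℝ, EQ) 𝓘(ℝ, EM) C.proj u).toLinearMap.restrict fun x hx => hx
  have ht : Function.Surjective t := by
    rintro ⟨w, hw⟩
    obtain ⟨v, hv⟩ := C.hasLocalSections_proj.mfderiv_surjective C.smooth_proj u w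
    exact ⟨⟨v, show mfderiv 𝓘(ℝ, EQ) 𝓘(ℝ, EM) C.proj u v ∈ _ by rw [hv]; exact hw⟩, Subtype.ext hv⟩
  let o := LinearEquiv.ofBijective (C.conn.toFun u) (C.bijective u)
  have hker : A.p ≤ LinearMap.ker (t ∘ₗ o.symm.toLinearMap) := by
    intro X hX
    obtain ⟨a, rfl⟩ : X ∈ Set.range (mfderiv 𝓘(ℝ, EP) 𝓘(ℝ, E) (Subtype.val : A.P → G) 1) := by
      rw [AHSPair.range_mfderiv_val hP]; exact hX
    obtain ⟨h, ha⟩ := C.reproduces a u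
    have h1 : o.symm (mfderiv 𝓘(ℝ, EP) 𝓘(ℝ, E) (Subtype.val : A.P → G) 1 a) =
        ⟨C.toPrincipalBundle.fundamental a u, h⟩ := by
      rw [LinearEquiv.symm_apply_eq]; exact ha.symm
    rw [LinearMap.mem_ker]
    refine (congrArg t h1).trans (Subtype.ext ?_)
    exact C.mfderiv_proj_fundamental a u
  let f := A.p.liftQ (t ∘ₗ o.symm.toLinearMap) hker
  have hf : Function.Surjective f := by
    intro w
    obtain ⟨ξ, rfl⟩ := ht w
    refine ⟨A.p.mkQ (o ξ), ?_⟩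
    exact (Submodule.liftQ_apply _ _ _).trans (congrArg t (o.symm_apply_apply ξ))
  have hfin : Module.finrank ℝ (LieAlg E G ⧸ A.p) = Module.finrank ℝ (F.toField (C.proj u)) :=
    (F.finrank_toField _).symm
  refine ⟨LinearEquiv.ofBijective f
    ⟨(LinearMap.injective_iff_surjective_of_finrank_eq_finrank hfin).2 hf, hf⟩, fun ξ => ?_⟩
  have h1 : f (C.projected u ξ) = t ξ :=
    (Submodule.liftQ_apply _ _ _).trans (congrArg t (o.symm_apply_apply ξ))
  exact congrArg Subtype.val h1

/-- The isomorphism from `𝔤 / 𝔭` to the fiber of the distribution over the base point of `u` which is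
determined by `ω(u)`. -/
def frame (u : Q) : (LieAlg E G ⧸ A.p) ≃ₗ[ℝ] F.toField (C.proj u) := (C.exists_frame hP u).choose

theorem frame_projected (u : Q) (ξ : F.toField.lift (EQ := EQ) C.proj u) :
    ((C.frame hP u (C.projected u ξ)).1 : TangentSpace 𝓘(ℝ, EM) (C.proj u)) =
      mfderiv 𝓘(ℝ, EQ) 𝓘(ℝ, EM) C.proj u ξ.1 :=
  (C.exists_frame hP u).choose_spec ξ

omit hP [T2Space G] in
theorem projected_surjective (u : Q) : Function.Surjective (C.projected u) :=
  (Submodule.mkQ_surjective _).comp (C.bijective u).2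

/-- Equivariance of `C.frame` over `\underline{Ad}`. -/
theorem frame_act (u : Q) (g : A.P) (v : LieAlg E G ⧸ A.p) :
    (⟨C.proj (C.act u g), (C.frame hP (C.act u g) v).1⟩ : TangentBundle 𝓘(ℝ, EM) M) =
      ⟨C.proj u, (C.frame hP u (A.adQuot g v)).1⟩ := by
  obtain ⟨ξ, hξ⟩ := C.projected_surjective u (A.adQuot g v)
  obtain ⟨h, hg⟩ := C.equivariant g u ξ
  have h1 : C.projected (C.act u g) ⟨C.toPrincipalBundle.tangentAct g u ξ.1, h⟩ = v := by
    have h2 : C.projected (C.act u g) ⟨C.toPrincipalBundle.tangentAct g u ξ.1, h⟩ =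
        A.adQuot g⁻¹ (C.projected u ξ) := congrArg A.p.mkQ hg
    rw [h2, hξ, ← Module.End.mul_apply, ← map_mul, inv_mul_cancel, map_one]
    rfl
  have h3 := C.frame_projected hP (C.act u g) ⟨C.toPrincipalBundle.tangentAct g u ξ.1, h⟩
  rw [h1] at h3
  rw [h3, ← hξ, C.frame_projected hP u ξ]
  have h4 := tangentMap_comp_at (f := fun v => C.act v g) (g := C.proj)
    (⟨u, ξ.1⟩ : TangentBundle 𝓘(ℝ, EQ) Q) (C.smooth_proj.mdifferentiable (by simp) _)
    ((C.contMDiff_act_right g).mdifferentiable (by simp) _)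
  have h5 : C.proj ∘ (fun v => C.act v g) = C.proj := funext fun v => C.proj_act v g
  rw [h5] at h4
  exact h4.symm

/-- Smoothness of `C.frame`: lift a local frame of the distribution to fields `ηᵢ` on the total space.
Then `C.frame u` sends the basis of classes of `ω(ηᵢ)` in `𝔤 / 𝔭`, which depends smoothly on `u`, to the
local frame. -/
theorem contMDiff_frame [LieGroup 𝓘(ℝ, EP) ∞ A.P] (v : LieAlg E G ⧸ A.p) :
    ContMDiff 𝓘(ℝ, EQ) 𝓘(ℝ, EM).tangent ∞
      (fun u => (⟨C.proj u, (C.frame hP u v).1⟩ : TangentBundle 𝓘(ℝ, EM) M)) := by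
  classical
  intro u₀
  obtain ⟨U, hU, hu₀, X, hX, hXF⟩ := F.exists_frame (C.proj u₀)
  have hlift := fun i => PrincipalBundle.exists_lift_field (B := C.toPrincipalBundle)
    C.smooth_proj C.hasLocalSections_proj
    (fun u v huv => (C.exists_act_eq huv).imp fun g hg => ⟨hg, fun w => C.proj_act w g⟩)
    hU (hX i) hu₀
  choose W' η hW' hu₀' hη hWη using hlift
  set W : Set Q := (⋂ i, W' i) ∩ C.proj ⁻¹' U with hW
  have hWo : IsOpen W :=
    (isOpen_iInter_of_finite hW').inter (hU.preimage C.smooth_proj.continuous)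
  have hu₀W : u₀ ∈ W := ⟨Set.mem_iInter.2 hu₀', hu₀⟩
  have hmem : ∀ i, ∀ u ∈ W, η i u ∈ F.toField.lift (EQ := EQ) C.proj u := by
    intro i u hu
    change mfderiv 𝓘(ℝ, EQ) 𝓘(ℝ, EM) C.proj u (η i u) ∈ F.toField (C.proj u)
    rw [(hWη i u (Set.mem_iInter.1 hu.1 i)).2, ← (hXF _ hu.2).2]
    exact Submodule.subset_span ⟨i, rfl⟩
  -- `PartialForm.smooth` asks for global fields; only the values on `W` matter
  set ξ : Fin _ → ∀ u, F.toField.lift (EQ := EQ) C.proj u := fun i u =>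
    if h : η i u ∈ F.toField.lift (EQ := EQ) C.proj u then ⟨η i u, h⟩ else 0 with hξdef
  have hξ : ∀ i, ∀ u ∈ W, (ξ i u).1 = η i u := fun i u hu => by
    simp only [hξdef, dif_pos (hmem i u hu)]
  have hξs : ∀ i, SmoothFieldOn (fun u => (ξ i u).1) W := fun i =>
    ((hη i).mono fun u hu => Set.mem_iInter.1 hu.1 i).congr fun u hu =>
      congrArg (TotalSpace.mk u) (hξ i u hu)
  set c : Q → Fin _ → LieAlg E G ⧸ A.p := fun u i => C.projected u (ξ i u) with hcdef
  have hfc : ∀ i, ∀ u ∈ W, (C.frame hP u (c u i)).1 = X i (C.proj u) := fun i u hu => by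
    refine (C.frame_projected hP u (ξ i u)).trans ?_
    rw [hξ i u hu]
    exact (hWη i u (Set.mem_iInter.1 hu.1 i)).2
  have hcs : ∀ i (l : (LieAlg E G ⧸ A.p) →ₗ[ℝ] ℝ),
      ContMDiffOn 𝓘(ℝ, EQ) 𝓘(ℝ, ℝ) ∞ (fun u => l (c u i)) W := fun i l =>
    C.conn.smooth W hWo (ξ i) (hξs i) (l.comp A.p.mkQ)
  have hli : ∀ u ∈ W, LinearIndependent ℝ (c u) := by
    intro u hu
    -- the images of the `c u i` under the frame are linearly independent
    refine LinearIndependent.of_comp ((F.toField (C.proj u)).subtype ∘ₗ (C.frame hP u).toLinearMap) ?_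
    have h1 : ((F.toField (C.proj u)).subtype ∘ₗ (C.frame hP u).toLinearMap) ∘ c u =
        fun i => X i (C.proj u) := funext fun i => hfc i u hu
    rw [h1]
    exact (hXF _ hu.2).1
  obtain ⟨x, hx, hxv⟩ := exists_smooth_coordinates (Module.finBasis ℝ (LieAlg E G ⧸ A.p)) hcs hli v
  have h1 := contMDiffOn_sum_smul_field C.smooth_proj.contMDiffOn hx (X := X)
    fun i => (hX i).comp C.smooth_proj.contMDiffOn fun u (hu : u ∈ W) => hu.2
  refine (h1.congr fun u hu => ?_).contMDiffAt (hWo.mem_nhds hu₀W)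
  refine congrArg (TotalSpace.mk (C.proj u)) ?_
  have h2 : (F.toField (C.proj u)).subtype (C.frame hP u v) =
      ∑ i, x u i • (F.toField (C.proj u)).subtype (C.frame hP u (c u i)) := by
    conv_lhs => rw [← hxv u hu]
    simp only [map_sum, map_smul]
  exact h2.trans (Finset.sum_congr rfl fun i _ => congrArg (x u i • ·) (hfc i u hu))

/-- A family of isomorphisms `𝔤 / 𝔭 ≅ F` on a bundle of `P₊`-orbits which is induced by the
isomorphisms `C.frame`. -/
theorem exists_frame_quotient {R : Type*} {q : Q → R} {p₀ : R → M} (hsurj : Function.Surjective q)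
    (hfib : ∀ u v, q u = q v ↔ ∃ g ∈ A.Pplus, C.act u g = v) (hproj : ∀ u, p₀ (q u) = C.proj u)
    (r : R) : ∃ f : (LieAlg E G ⧸ A.p) ≃ₗ[ℝ] F.toField (p₀ r), ∀ u, q u = r → ∀ v,
      (⟨p₀ r, (f v).1⟩ : TangentBundle 𝓘(ℝ, EM) M) = ⟨C.proj u, (C.frame hP u v).1⟩ := by
  obtain ⟨u, rfl⟩ := hsurj r
  have h : ∀ y, y = C.proj u → ∃ f : (LieAlg E G ⧸ A.p) ≃ₗ[ℝ] F.toField y, ∀ v,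
      (⟨y, (f v).1⟩ : TangentBundle 𝓘(ℝ, EM) M) = ⟨C.proj u, (C.frame hP u v).1⟩ := by
    rintro _ rfl
    exact ⟨C.frame hP u, fun v => rfl⟩
  obtain ⟨f, hf⟩ := h _ (hproj u)
  refine ⟨f, fun u' hu' v => ?_⟩
  obtain ⟨g, hg, rfl⟩ := (hfib u u').1 hu'.symm
  rw [hf, C.frame_act hP, A.adQuot_of_mem_Pplus hg]
  rfl

end PartialCartanGeometry

end Frames

/-! ### Descent to the orbit space -/

section Descent

variable {E : Type*} [NormedAddCommGroup E] [NormedSpace ℝ E] [FiniteDimensional ℝ E]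
  {G : Type*} [TopologicalSpace G] [T2Space G] [SecondCountableTopology G]
  [ChartedSpace E G] [Group G] [LieGroup 𝓘(ℝ, E) ∞ G] {A : AHSPair E G}
  {EP : Type*} [NormedAddCommGroup EP] [NormedSpace ℝ EP] [FiniteDimensional ℝ EP]
  [ChartedSpace EP A.P] [LieGroup 𝓘(ℝ, EP) ∞ A.P]
  (hP : Manifold.IsSmoothEmbedding 𝓘(ℝ, EP) 𝓘(ℝ, E) ∞ (Subtype.val : A.P → G))
  {EP₀ : Type*} [NormedAddCommGroup EP₀] [NormedSpace ℝ EP₀] [FiniteDimensional ℝ EP₀]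
  [ChartedSpace EP₀ A.G₀] [LieGroup 𝓘(ℝ, EP₀) ∞ A.G₀]
  (hG₀ : Manifold.IsSmoothEmbedding 𝓘(ℝ, EP₀) 𝓘(ℝ, EP) ∞ (Subtype.val : A.G₀ → A.P))
  {EM : Type*} [NormedAddCommGroup EM] [NormedSpace ℝ EM]
  {M : Type*} [TopologicalSpace M] [ChartedSpace EM M] [IsManifold 𝓘(ℝ, EM) ∞ M]
  {F : InvolutiveDistribution EM M (Module.finrank ℝ (LieAlg E G ⧸ A.p))}
  {EQ : Type*} [NormedAddCommGroup EQ] [NormedSpace ℝ EQ]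
  {Q : Type*} [TopologicalSpace Q] [ChartedSpace EQ Q] [IsManifold 𝓘(ℝ, EQ) ∞ Q]
  (C : PartialCartanGeometry A EP F EQ Q)
  {ER : Type*} [NormedAddCommGroup ER] [NormedSpace ℝ ER]
  {R : Type*} [TopologicalSpace R] [ChartedSpace ER R] [IsManifold 𝓘(ℝ, ER) ∞ R]

omit [LieGroup 𝓘(ℝ, EP₀) ∞ A.G₀] in
include hP in
/-- If a principal `G₀`-bundle realizes the quotient `𝒢 / P₊`, then the partial Cartan connection
descends to it. -/
theorem exists_isUnderlying (B₀ : PrincipalBundle EM M EP₀ A.G₀ ER R) {q : Q → R}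
    (hq : ContMDiff 𝓘(ℝ, EQ) 𝓘(ℝ, ER) ∞ q) (hsec : HasLocalSections EQ ER q)
    (hsurj : Function.Surjective q)
    (hfib : ∀ u v, q u = q v ↔ ∃ g ∈ A.Pplus, C.act u g = v)
    (hproj : ∀ u, B₀.proj (q u) = C.proj u)
    (hact : ∀ u (g : A.G₀), q (C.act u g) = B₀.act (q u) g) :
    ∃ (S : PartialGStructure F EP₀ A.rep₀ ER R)
      (θ : PartialForm (F.toField.lift (EQ := ER) S.proj) (LieAlg E G ⧸ A.p)),
      IsUnderlying C S θ q := by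
  classical
  choose f hf using C.exists_frame_quotient hP hsurj hfib hproj
  have : LocallyCompactSpace A.G₀ := ChartedSpace.locallyCompactSpace EP₀ A.G₀
  have hfact : ∀ r (g : A.G₀) v,
      (⟨B₀.proj (B₀.act r g), (f (B₀.act r g) v).1⟩ : TangentBundle 𝓘(ℝ, EM) M) =
        ⟨B₀.proj r, (f r (A.rep₀ g v)).1⟩ := by
    intro r g v
    obtain ⟨u, rfl⟩ := hsurj r
    rw [hf _ (C.act u g) (hact u g), C.frame_act hP, hf _ u rfl]
    rfl
  have hfs : ∀ v, ContMDiff 𝓘(ℝ, ER) 𝓘(ℝ, EM).tangent ∞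
      (fun r => (⟨B₀.proj r, (f r v).1⟩ : TangentBundle 𝓘(ℝ, EM) M)) := by
    intro v r
    obtain ⟨u, rfl⟩ := hsurj r
    refine hsec.contMDiffAt_of_comp ?_
    exact (C.contMDiff_frame hP v u).congr_of_eventuallyEq
      (Filter.Eventually.of_forall fun w => hf _ w rfl v)
  -- the tangent map of the projection, as a map between the fibers of the distributions
  let t : ∀ r, F.toField.lift (EQ := ER) B₀.proj r →ₗ[ℝ] F.toField (B₀.proj r) := fun r =>
    (mfderiv 𝓘(ℝ, ER) 𝓘(ℝ, EM) B₀.proj r).toLinearMap.restrict fun x hx => hx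
  let θ : ∀ r, F.toField.lift (EQ := ER) B₀.proj r →ₗ[ℝ] LieAlg E G ⧸ A.p := fun r =>
    (f r).symm.toLinearMap ∘ₗ t r
  have hfθ : ∀ r ξ, f r (θ r ξ) = t r ξ := fun r ξ => (f r).apply_symm_apply _
  have hθ : ∀ r ξ v, ((f r v).1 : TangentSpace 𝓘(ℝ, EM) (B₀.proj r)) =
      mfderiv 𝓘(ℝ, ER) 𝓘(ℝ, EM) B₀.proj r ξ.1 → θ r ξ = v := fun r ξ v h =>
    (f r).symm_apply_eq.2 (Subtype.ext h.symm)
  have hTq : ∀ u (v : TangentSpace 𝓘(ℝ, EQ) u),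
      (⟨B₀.proj (q u), mfderiv 𝓘(ℝ, ER) 𝓘(ℝ, EM) B₀.proj (q u)
        (mfderiv 𝓘(ℝ, EQ) 𝓘(ℝ, ER) q u v)⟩ : TangentBundle 𝓘(ℝ, EM) M) =
      ⟨C.proj u, mfderiv 𝓘(ℝ, EQ) 𝓘(ℝ, EM) C.proj u v⟩ := by
    intro u v
    have h1 := tangentMap_comp_at (f := q) (g := B₀.proj) (⟨u, v⟩ : TangentBundle 𝓘(ℝ, EQ) Q)
      (B₀.smooth_proj.mdifferentiable (by simp) _) (hq.mdifferentiable (by simp) _)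
    have h2 : B₀.proj ∘ q = C.proj := funext hproj
    rw [h2] at h1
    exact h1.symm
  have hmem : ∀ u (v : TangentSpace 𝓘(ℝ, EQ) u), v ∈ F.toField.lift (EQ := EQ) C.proj u ↔
      mfderiv 𝓘(ℝ, EQ) 𝓘(ℝ, ER) q u v ∈ F.toField.lift (EQ := ER) B₀.proj (q u) := by
    intro u v
    have h : ∀ z z' : TangentBundle 𝓘(ℝ, EM) M, z = z' → (z'.2 ∈ F.toField z'.1 ↔ z.2 ∈ F.toField z.1) := by
      rintro z _ rfl; rfl
    exact h _ _ (hTq u v)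
  have hdesc : ∀ u (ξ : F.toField.lift (EQ := EQ) C.proj u),
      θ (q u) ⟨mfderiv 𝓘(ℝ, EQ) 𝓘(ℝ, ER) q u ξ.1, (hmem u ξ.1).1 ξ.2⟩ = C.projected u ξ := by
    intro u ξ
    refine hθ _ _ _ (eq_of_tangentBundle_mk_eq ?_)
    rw [hf _ u rfl, C.frame_projected hP]
    exact (hTq u ξ.1).symm
  -- a field on `R` is lifted along `q`, so that smoothness of `θ` follows from that of the connection
  have hθs : ∀ U : Set R, IsOpen U → ∀ ξ : (∀ r, F.toField.lift (EQ := ER) B₀.proj r),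
      SmoothFieldOn (fun r => (ξ r).1) U → ∀ l : (LieAlg E G ⧸ A.p) →ₗ[ℝ] ℝ,
      ContMDiffOn 𝓘(ℝ, ER) 𝓘(ℝ, ℝ) ∞ (fun r => l (θ r (ξ r))) U := by
    intro U hU ξ hξ l r hr
    obtain ⟨u, rfl⟩ := hsurj r
    refine (hsec.contMDiffAt_of_comp ?_).contMDiffWithinAt
    obtain ⟨W, η, hW, huW, hη, hηξ⟩ := PrincipalBundle.exists_lift_field (B := C.toPrincipalBundle)
      hq hsec (fun u v huv => by
        obtain ⟨g, hg, h⟩ := (hfib u v).1 huv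
        exact ⟨g, h, fun w => ((hfib _ _).2 ⟨g, hg, rfl⟩).symm⟩) hU hξ hr
    have hηmem : ∀ v ∈ W, η v ∈ F.toField.lift (EQ := EQ) C.proj v := fun v hv => by
      rw [hmem, (hηξ v hv).2]
      exact (ξ (q v)).2
    -- only the values on `W` matter
    let η' : ∀ v, F.toField.lift (EQ := EQ) C.proj v := fun v =>
      if h : η v ∈ F.toField.lift (EQ := EQ) C.proj v then ⟨η v, h⟩ else 0
    have hη' : ∀ v ∈ W, (η' v).1 = η v := fun v hv => by simp only [η', dif_pos (hηmem v hv)]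
    have h1 := C.conn.smooth W hW η' (hη.congr fun v hv => congrArg (TotalSpace.mk v) (hη' v hv))
      (l.comp A.p.mkQ)
    refine (h1.contMDiffAt (hW.mem_nhds huW)).congr_of_eventuallyEq ?_
    filter_upwards [hW.mem_nhds huW] with v hv
    refine congrArg l (Eq.trans ?_ (hdesc v (η' v)))
    refine congrArg (θ (q v)) (Subtype.ext ?_)
    exact (hηξ v hv).2.symm.trans
      (congrArg (mfderiv 𝓘(ℝ, EQ) 𝓘(ℝ, ER) q v) (hη' v hv).symm)
  let S : PartialGStructure F EP₀ A.rep₀ ER R :=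
    { B₀ with
      covering := AHSPair.isCoveringOfClosedSubgroup_rep₀ hP
      frame := f
      smooth_frame := hfs
      frame_act := hfact }
  refine ⟨S, ⟨θ, hθs⟩, hq, hsurj, hsec.mfderiv_surjective hq, hfib, hproj, hact, ?_, ?_, ?_, ?_⟩
  · exact fun u ξ => ⟨_, hdesc u ξ⟩
  · intro r ξ
    change (f r).symm (t r ξ) = 0 ↔ _
    rw [LinearEquiv.map_eq_zero_iff]
    exact Subtype.ext_iff
  · intro g r ξ
    have h1 := tangentMap_comp_at (f := fun r => B₀.act r g) (g := B₀.proj)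
      (⟨r, ξ.1⟩ : TangentBundle 𝓘(ℝ, ER) R) (B₀.smooth_proj.mdifferentiable (by simp) _)
      ((B₀.contMDiff_act_right g).mdifferentiable (by simp) _)
    have h2 : B₀.proj ∘ (fun r => B₀.act r g) = B₀.proj := funext fun r => B₀.proj_act r g
    rw [h2] at h1
    have h3 : B₀.tangentAct g r ξ.1 ∈ F.toField.lift (EQ := ER) B₀.proj (B₀.act r g) := by
      have h : ∀ z z' : TangentBundle 𝓘(ℝ, EM) M, z = z' → z.2 ∈ F.toField z.1 →
        z'.2 ∈ F.toField z'.1 := by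
        rintro z _ rfl; exact id
      exact h _ _ h1 ξ.2
    refine ⟨h3, hθ _ _ _ (eq_of_tangentBundle_mk_eq ?_)⟩
    rw [hfact]
    have h4 : A.rep₀ g (A.rep₀ g⁻¹ (θ r ξ)) = θ r ξ := by
      rw [← Module.End.mul_apply, ← map_mul, mul_inv_cancel, map_one]; rfl
    refine Eq.trans ?_ h1
    refine congrArg (TotalSpace.mk (B₀.proj r)) ?_
    refine (congrArg (fun v => (f r v).1) h4).trans ?_
    exact congrArg Subtype.val (hfθ r ξ)
  · intro r ξ
    exact congrArg Subtype.val (hfθ r ξ)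

include hP hG₀ in
/-- A partial Cartan geometry descends to a partial `G₀`-structure on its orbit space. -/
theorem exists_isUnderlying_orbitSpace [T2Space M] [SecondCountableTopology Q] :
    T2Space C.OrbitSpace ∧ SecondCountableTopology C.OrbitSpace ∧
      ∃ (_ : ChartedSpace (EM × EP₀) C.OrbitSpace)
        (_ : IsManifold 𝓘(ℝ, EM × EP₀) ∞ C.OrbitSpace)
        (S : PartialGStructure F EP₀ A.rep₀ (EM × EP₀) C.OrbitSpace)
        (θ : PartialForm (F.toField.lift (EQ := EM × EP₀) S.proj) (LieAlg E G ⧸ A.p)),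
        IsUnderlying C S θ C.toOrbitSpace := by
  have hfib : ∀ u v, C.toOrbitSpace u = C.toOrbitSpace v ↔ ∃ g ∈ A.Pplus, C.act u g = v :=
    fun u v => Quotient.eq
  have hq : IsQuotientBy C.toPrincipalBundle A.levi C.toOrbitSpace :=
    ⟨isQuotientMap_quotient_mk', fun u v => by simp only [hfib, AHSPair.levi_eq_one_iff]⟩
  have hs : ∀ g : A.G₀, A.levi (A.G₀.subtype g) = g := A.levi_coe
  have hϖ := AHSPair.contMDiff_levi hP hG₀
  have hsm : ContMDiff 𝓘(ℝ, EP₀) 𝓘(ℝ, EP) ∞ A.G₀.subtype := hG₀.contMDiff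
  refine ⟨hq.t2Space hs hϖ.continuous hsm.continuous,
    hq.isQuotientMap.secondCountableTopology hq.isOpenMap, ?_⟩
  obtain ⟨i, hi, B₀, hqs, hproj, hact⟩ := hq.exists_principalBundle hs hϖ hsm
  exact ⟨i, hi, exists_isUnderlying hP C B₀ hqs
    (PrincipalBundle.hasLocalSections_of_equivariant hqs hsm hproj hact)
    hq.isQuotientMap.surjective hfib hproj hact⟩

end Descent

/-! ### Functoriality -/

section PullBack

variable {E₁ : Type*} [NormedAddCommGroup E₁] [NormedSpace ℝ E₁]
  {Q₁ : Type*} [TopologicalSpace Q₁] [ChartedSpace E₁ Q₁]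
  {E₂ : Type*} [NormedAddCommGroup E₂] [NormedSpace ℝ E₂]
  {Q₂ : Type*} [TopologicalSpace Q₂] [ChartedSpace E₂ Q₂]
  {V : Type*} [AddCommGroup V] [Module ℝ V]
  {D₁ : SubspaceField E₁ Q₁} {D₂ : SubspaceField E₂ Q₂}
  {α₁ : ∀ u, D₁ u →ₗ[ℝ] V} {α₂ : ∀ u, D₂ u →ₗ[ℝ] V} {Φ : Q₁ → Q₂}

/-- The condition on the values of the forms in `PullsBackTo`, in terms of the tangent map. -/
theorem exists_eq_of_tangentMap_eq {u : Q₁} {v : TangentSpace 𝓘(ℝ, E₁) u} {y : Q₂}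
    {w : TangentSpace 𝓘(ℝ, E₂) y} (h : tangentMap 𝓘(ℝ, E₁) 𝓘(ℝ, E₂) Φ ⟨u, v⟩ = ⟨y, w⟩)
    (hw : w ∈ D₂ y) :
    ∃ h : mfderiv 𝓘(ℝ, E₁) 𝓘(ℝ, E₂) Φ u v ∈ D₂ (Φ u),
      α₂ (Φ u) ⟨mfderiv 𝓘(ℝ, E₁) 𝓘(ℝ, E₂) Φ u v, h⟩ = α₂ y ⟨w, hw⟩ := by
  have key : ∀ z z' : TangentBundle 𝓘(ℝ, E₂) Q₂, z = z' → ∀ hz' : z'.2 ∈ D₂ z'.1,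
      ∃ hz : z.2 ∈ D₂ z.1, α₂ z.1 ⟨z.2, hz⟩ = α₂ z'.1 ⟨z'.2, hz'⟩ := by
    rintro z _ rfl hz'
    exact ⟨hz', rfl⟩
  exact key _ _ h hw

end PullBack

section Functoriality

variable {E : Type*} [NormedAddCommGroup E] [NormedSpace ℝ E] [FiniteDimensional ℝ E]
  {G : Type*} [TopologicalSpace G]
  [ChartedSpace E G] [Group G] [LieGroup 𝓘(ℝ, E) ∞ G] {A : AHSPair E G}
  {EP : Type*} [NormedAddCommGroup EP] [NormedSpace ℝ EP]
  [ChartedSpace EP A.P]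
  {EP₀ : Type*} [NormedAddCommGroup EP₀] [NormedSpace ℝ EP₀]
  [ChartedSpace EP₀ A.G₀]
  {EM : Type*} [NormedAddCommGroup EM] [NormedSpace ℝ EM]
  {M : Type*} [TopologicalSpace M] [ChartedSpace EM M] [IsManifold 𝓘(ℝ, EM) ∞ M]
  {F : InvolutiveDistribution EM M (Module.finrank ℝ (LieAlg E G ⧸ A.p))}
  {EQ : Type*} [NormedAddCommGroup EQ] [NormedSpace ℝ EQ]
  {Q : Type*} [TopologicalSpace Q] [ChartedSpace EQ Q] [IsManifold 𝓘(ℝ, EQ) ∞ Q]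
  {C : PartialCartanGeometry A EP F EQ Q}
  {ER : Type*} [NormedAddCommGroup ER] [NormedSpace ℝ ER]
  {R : Type*} [TopologicalSpace R] [ChartedSpace ER R] [IsManifold 𝓘(ℝ, ER) ∞ R]
  {S : PartialGStructure F EP₀ A.rep₀ ER R}
  {θ : PartialForm (F.toField.lift (EQ := ER) S.proj) (LieAlg E G ⧸ A.p)} {q : Q → R}

namespace IsUnderlying

theorem tangentMap_proj_comp (h : IsUnderlying C S θ q) (z : TangentBundle 𝓘(ℝ, EQ) Q) :
    tangentMap 𝓘(ℝ, ER) 𝓘(ℝ, EM) S.proj (tangentMap 𝓘(ℝ, EQ) 𝓘(ℝ, ER) q z) =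
      tangentMap 𝓘(ℝ, EQ) 𝓘(ℝ, EM) C.proj z := by
  have h1 := tangentMap_comp_at (f := q) (g := S.proj) z
    (S.smooth_proj.mdifferentiable (by simp) _) (h.smooth.mdifferentiable (by simp) _)
  have h2 : S.proj ∘ q = C.proj := funext h.proj_comm
  rw [h2] at h1
  exact h1.symm

theorem frame_projected (h : IsUnderlying C S θ q) (u : Q)
    (ξ : F.toField.lift (EQ := EQ) C.proj u) :
    (⟨S.proj (q u), (S.frame (q u) (C.projected u ξ)).1⟩ : TangentBundle 𝓘(ℝ, EM) M) =
      tangentMap 𝓘(ℝ, EQ) 𝓘(ℝ, EM) C.proj ⟨u, ξ.1⟩ := by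
  obtain ⟨h1, h2⟩ := h.descends u ξ
  rw [← h.tangentMap_proj_comp, ← h2]
  exact congrArg (TotalSpace.mk (S.proj (q u))) (h.frame_comp _ _)

theorem mem_lift_iff (h : IsUnderlying C S θ q) (u : Q) (v : TangentSpace 𝓘(ℝ, EQ) u) :
    v ∈ F.toField.lift (EQ := EQ) C.proj u ↔
      mfderiv 𝓘(ℝ, EQ) 𝓘(ℝ, ER) q u v ∈ F.toField.lift (EQ := ER) S.proj (q u) := by
  have key : ∀ z z' : TangentBundle 𝓘(ℝ, EM) M, z = z' →
      (z'.2 ∈ F.toField z'.1 ↔ z.2 ∈ F.toField z.1) := by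
    rintro z _ rfl; rfl
  exact key _ _ (h.tangentMap_proj_comp ⟨u, v⟩)

end IsUnderlying

variable
  {EM₂ : Type*} [NormedAddCommGroup EM₂] [NormedSpace ℝ EM₂]
  {M₂ : Type*} [TopologicalSpace M₂] [ChartedSpace EM₂ M₂] [IsManifold 𝓘(ℝ, EM₂) ∞ M₂]
  {F₂ : InvolutiveDistribution EM₂ M₂ (Module.finrank ℝ (LieAlg E G ⧸ A.p))}
  {EQ₂ : Type*} [NormedAddCommGroup EQ₂] [NormedSpace ℝ EQ₂]
  {Q₂ : Type*} [TopologicalSpace Q₂] [ChartedSpace EQ₂ Q₂] [IsManifold 𝓘(ℝ, EQ₂) ∞ Q₂]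
  {C₂ : PartialCartanGeometry A EP F₂ EQ₂ Q₂}
  {ER₂ : Type*} [NormedAddCommGroup ER₂] [NormedSpace ℝ ER₂]
  {R₂ : Type*} [TopologicalSpace R₂] [ChartedSpace ER₂ R₂] [IsManifold 𝓘(ℝ, ER₂) ∞ R₂]
  {S₂ : PartialGStructure F₂ EP₀ A.rep₀ ER₂ R₂}
  {θ₂ : PartialForm (F₂.toField.lift (EQ := ER₂) S₂.proj) (LieAlg E G ⧸ A.p)} {q₂ : Q₂ → R₂}
  {Φ : Q → Q₂} {φ : M → M₂}

namespace IsCartanMorphism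

/-- A morphism is compatible with the projections of the connections to `𝔤 / 𝔭`. -/
theorem projected_eq (hΦ : IsCartanMorphism C C₂ Φ φ) : PullsBackTo Φ C₂.projected C.projected :=
  fun u ξ => (hΦ.pullback u ξ).imp fun _ h => congrArg A.p.mkQ h

variable (hΦ : IsCartanMorphism C C₂ Φ φ) (h₁ : IsUnderlying C S θ q)
  (h₂ : IsUnderlying C₂ S₂ θ₂ q₂) {Ψ : R → R₂} (hΨ : ∀ u, Ψ (q u) = q₂ (Φ u))

include hΦ h₁ h₂

theorem exists_descends : ∃ Ψ : R → R₂, ∀ u, Ψ (q u) = q₂ (Φ u) := by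
  refine ⟨fun r => q₂ (Φ (Function.surjInv h₁.surjective r)), fun u => ?_⟩
  obtain ⟨g, hg, h⟩ := (h₁.fibers _ _).1 (Function.surjInv_eq h₁.surjective (q u))
  rw [h₂.fibers]
  exact ⟨g, hg, by rw [← hΦ.isPrincipalHom.act_comm, h]⟩

include hΨ

theorem isPrincipalHom_of_descends (hsec : HasLocalSections EQ ER q) :
    IsPrincipalHom S.toPrincipalBundle S₂.toPrincipalBundle Ψ φ where
  smooth r := by
    obtain ⟨u, rfl⟩ := h₁.surjective r
    exact hsec.contMDiffAt_of_comp (((h₂.smooth.comp hΦ.isPrincipalHom.smooth) u).congr_of_eventuallyEq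
      (Filter.Eventually.of_forall hΨ))
  smooth_base := hΦ.isPrincipalHom.smooth_base
  proj_comm r := by
    obtain ⟨u, rfl⟩ := h₁.surjective r
    rw [hΨ, h₂.proj_comm, hΦ.isPrincipalHom.proj_comm, h₁.proj_comm]
  act_comm r g := by
    obtain ⟨u, rfl⟩ := h₁.surjective r
    rw [← h₁.act_comm, hΨ, hΦ.isPrincipalHom.act_comm, h₂.act_comm, hΨ]

/-- Both frames are given by the connections and the tangent maps of the projections, which are
compatible with `Φ`. -/
theorem frame_comm_of_descends (r : R) (v : LieAlg E G ⧸ A.p) :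
    (⟨S₂.proj (Ψ r), (S₂.frame (Ψ r) v).1⟩ : TangentBundle 𝓘(ℝ, EM₂) M₂) =
      tangentMap 𝓘(ℝ, EM) 𝓘(ℝ, EM₂) φ ⟨S.proj r, (S.frame r v).1⟩ := by
  obtain ⟨u, rfl⟩ := h₁.surjective r
  obtain ⟨ξ, rfl⟩ := C.projected_surjective u v
  obtain ⟨h, hξ⟩ := hΦ.projected_eq u ξ
  rw [h₁.frame_projected, hΨ, ← hξ, h₂.frame_projected]
  have h1 := tangentMap_comp_at (f := Φ) (g := C₂.proj) (⟨u, ξ.1⟩ : TangentBundle 𝓘(ℝ, EQ) Q)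
    (C₂.smooth_proj.mdifferentiable (by simp) _)
    (hΦ.isPrincipalHom.smooth.mdifferentiable (by simp) _)
  have h2 := tangentMap_comp_at (f := C.proj) (g := φ) (⟨u, ξ.1⟩ : TangentBundle 𝓘(ℝ, EQ) Q)
    (hΦ.isPrincipalHom.smooth_base.mdifferentiable (by simp) _)
    (C.smooth_proj.mdifferentiable (by simp) _)
  have h3 : C₂.proj ∘ Φ = φ ∘ C.proj := funext hΦ.isPrincipalHom.proj_comm
  rw [h3] at h1
  exact h1.symm.trans h2

/-- The tangent maps of the base map are isomorphisms between the fibers of the distributions, since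
they are compatible with the frames. -/
theorem base_iso_of_descends (x : M) : ∃ e : F.toField x ≃ₗ[ℝ] F₂.toField (φ x),
    ∀ v, (e v : TangentSpace 𝓘(ℝ, EM₂) (φ x)) = mfderiv 𝓘(ℝ, EM) 𝓘(ℝ, EM₂) φ x v.1 := by
  obtain ⟨e, he⟩ := S.exists_smoothTrivialization x
  obtain ⟨r, rfl⟩ : ∃ r, S.proj r = x := ⟨_, e.proj_inv he 1⟩
  have key : ∀ (y : M₂) (f : (LieAlg E G ⧸ A.p) ≃ₗ[ℝ] F₂.toField y), y = φ (S.proj r) →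
      (∀ v, (⟨y, (f v).1⟩ : TangentBundle 𝓘(ℝ, EM₂) M₂) =
        tangentMap 𝓘(ℝ, EM) 𝓘(ℝ, EM₂) φ ⟨S.proj r, (S.frame r v).1⟩) →
      ∃ e : F.toField (S.proj r) ≃ₗ[ℝ] F₂.toField (φ (S.proj r)),
        ∀ v, (e v : TangentSpace 𝓘(ℝ, EM₂) (φ (S.proj r))) =
          mfderiv 𝓘(ℝ, EM) 𝓘(ℝ, EM₂) φ (S.proj r) v.1 := by
    rintro _ f rfl hf
    refine ⟨(S.frame r).symm ≪≫ₗ f, fun v => ?_⟩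
    refine (eq_of_tangentBundle_mk_eq (hf ((S.frame r).symm v))).trans ?_
    rw [LinearEquiv.apply_symm_apply]
  refine key _ (S₂.frame (Ψ r)) ?_ (hΦ.frame_comm_of_descends h₁ h₂ hΨ r)
  obtain ⟨u, rfl⟩ := h₁.surjective r
  rw [hΨ, h₂.proj_comm, hΦ.isPrincipalHom.proj_comm, h₁.proj_comm]

theorem pullsBackTo_of_descends (hsm : ContMDiff 𝓘(ℝ, ER) 𝓘(ℝ, ER₂) ∞ Ψ) :
    PullsBackTo Ψ θ₂.toFun θ.toFun := by
  rintro r ⟨w, hw⟩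
  obtain ⟨u, rfl⟩ := h₁.surjective r
  obtain ⟨v, rfl⟩ := h₁.submersion u w
  have hv : v ∈ F.toField.lift (EQ := EQ) C.proj u := (h₁.mem_lift_iff u v).2 hw
  obtain ⟨k1, e1⟩ := h₁.descends u ⟨v, hv⟩
  obtain ⟨k2, e2⟩ := hΦ.projected_eq u ⟨v, hv⟩
  obtain ⟨k3, e3⟩ := h₂.descends (Φ u) ⟨_, k2⟩
  have h1 := tangentMap_comp_at (f := q) (g := Ψ) (⟨u, v⟩ : TangentBundle 𝓘(ℝ, EQ) Q)
    (hsm.mdifferentiable (by simp) _) (h₁.smooth.mdifferentiable (by simp) _)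
  have h2 := tangentMap_comp_at (f := Φ) (g := q₂) (⟨u, v⟩ : TangentBundle 𝓘(ℝ, EQ) Q)
    (h₂.smooth.mdifferentiable (by simp) _)
    (hΦ.isPrincipalHom.smooth.mdifferentiable (by simp) _)
  have h3 : Ψ ∘ q = q₂ ∘ Φ := funext hΨ
  rw [h3] at h1
  obtain ⟨k, e⟩ := exists_eq_of_tangentMap_eq (α₂ := θ₂.toFun) (h1.symm.trans h2) k3
  exact ⟨k, e.trans (e3.trans (e2.trans e1.symm))⟩

end IsCartanMorphism

/-- Morphisms of partial Cartan geometries descend uniquely to the underlying partial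
`G₀`-structures. -/
theorem IsCartanMorphism.existsUnique_descends [LieGroup 𝓘(ℝ, EP₀) ∞ A.G₀]
    (hG₀ : ContMDiff 𝓘(ℝ, EP₀) 𝓘(ℝ, EP) ∞ A.G₀.subtype) (hΦ : IsCartanMorphism C C₂ Φ φ)
    (h₁ : IsUnderlying C S θ q) (h₂ : IsUnderlying C₂ S₂ θ₂ q₂) :
    ∃! Ψ : R → R₂, (∀ u, Ψ (q u) = q₂ (Φ u)) ∧
      IsGStructureMorphism S S₂ Ψ φ ∧ PullsBackTo Ψ θ₂.toFun θ.toFun := by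
  obtain ⟨Ψ, hΨ⟩ := hΦ.exists_descends h₁ h₂
  have hsec := PrincipalBundle.hasLocalSections_of_equivariant (B := C.toPrincipalBundle)
    (B₀ := S.toPrincipalBundle) h₁.smooth hG₀ h₁.proj_comm h₁.act_comm
  have hhom := hΦ.isPrincipalHom_of_descends h₁ h₂ hΨ hsec
  refine ⟨Ψ, ⟨hΨ, ⟨hhom, hΦ.base_iso_of_descends h₁ h₂ hΨ,
    hΦ.frame_comm_of_descends h₁ h₂ hΨ⟩, hΦ.pullsBackTo_of_descends h₁ h₂ hΨ hhom.smooth⟩, ?_⟩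
  rintro Ψ' ⟨hΨ', -⟩
  refine funext fun r => ?_
  obtain ⟨u, rfl⟩ := h₁.surjective r
  rw [hΨ, hΨ']

end Functoriality

end PartialCartan

end

open PartialCartan in
theorem proposition2p5
    -- an AHS-pair `(G, P)`; `P` and its subgroup `G₀` are embedded Lie subgroups
    {E : Type*} [NormedAddCommGroup E] [NormedSpace ℝ E] [FiniteDimensional ℝ E]
    {G : Type*} [TopologicalSpace G] [T2Space G] [SecondCountableTopology G]
    [ChartedSpace E G] [Group G] [LieGroup 𝓘(ℝ, E) ∞ G]
    (A : AHSPair E G)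
    {EP : Type*} [NormedAddCommGroup EP] [NormedSpace ℝ EP] [FiniteDimensional ℝ EP]
    [ChartedSpace EP A.P] [LieGroup 𝓘(ℝ, EP) ∞ A.P]
    (hP : Manifold.IsSmoothEmbedding 𝓘(ℝ, EP) 𝓘(ℝ, E) ∞ (Subtype.val : A.P → G))
    {EP₀ : Type*} [NormedAddCommGroup EP₀] [NormedSpace ℝ EP₀] [FiniteDimensional ℝ EP₀]
    [ChartedSpace EP₀ A.G₀] [LieGroup 𝓘(ℝ, EP₀) ∞ A.G₀]
    (hG₀ : Manifold.IsSmoothEmbedding 𝓘(ℝ, EP₀) 𝓘(ℝ, EP) ∞ (Subtype.val : A.G₀ → A.P)) :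
    -- each partial Cartan geometry descends to a partial `G₀`-structure on `𝒢 / P₊`
    (∀ {EM : Type*} [NormedAddCommGroup EM] [NormedSpace ℝ EM] [FiniteDimensional ℝ EM]
        {M : Type*} [TopologicalSpace M] [T2Space M] [SecondCountableTopology M]
        [ChartedSpace EM M] [IsManifold 𝓘(ℝ, EM) ∞ M]
        {F : InvolutiveDistribution EM M (Module.finrank ℝ (LieAlg E G ⧸ A.p))}
        {EQ : Type*} [NormedAddCommGroup EQ] [NormedSpace ℝ EQ] [FiniteDimensional ℝ EQ]
        {Q : Type*} [TopologicalSpace Q] [T2Space Q] [SecondCountableTopology Q]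
        [ChartedSpace EQ Q] [IsManifold 𝓘(ℝ, EQ) ∞ Q]
        (C : PartialCartanGeometry A EP F EQ Q),
        T2Space C.OrbitSpace ∧ SecondCountableTopology C.OrbitSpace ∧
        ∃ (_ : ChartedSpace (EM × EP₀) C.OrbitSpace)
          (_ : IsManifold 𝓘(ℝ, EM × EP₀) ∞ C.OrbitSpace)
          (S : PartialGStructure F EP₀ A.rep₀ (EM × EP₀) C.OrbitSpace)
          (θ : PartialForm (F.toField.lift (EQ := EM × EP₀) S.proj) (LieAlg E G ⧸ A.p)),
          IsUnderlying C S θ C.toOrbitSpace) ∧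
    -- morphisms of partial Cartan geometries descend uniquely to morphisms of the underlying
    -- partial `G₀`-structures, for each realization `q : 𝒢 → 𝒢₀` of these structures
    (∀ {EM₁ : Type*} [NormedAddCommGroup EM₁] [NormedSpace ℝ EM₁] [FiniteDimensional ℝ EM₁]
        {M₁ : Type*} [TopologicalSpace M₁] [T2Space M₁] [SecondCountableTopology M₁]
        [ChartedSpace EM₁ M₁] [IsManifold 𝓘(ℝ, EM₁) ∞ M₁]
        {F₁ : InvolutiveDistribution EM₁ M₁ (Module.finrank ℝ (LieAlg E G ⧸ A.p))}
        {EQ₁ : Type*} [NormedAddCommGroup EQ₁] [NormedSpace ℝ EQ₁] [FiniteDimensional ℝ EQ₁]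
        {Q₁ : Type*} [TopologicalSpace Q₁] [T2Space Q₁] [SecondCountableTopology Q₁]
        [ChartedSpace EQ₁ Q₁] [IsManifold 𝓘(ℝ, EQ₁) ∞ Q₁]
        (C₁ : PartialCartanGeometry A EP F₁ EQ₁ Q₁)
        {ER₁ : Type*} [NormedAddCommGroup ER₁] [NormedSpace ℝ ER₁] [FiniteDimensional ℝ ER₁]
        {R₁ : Type*} [TopologicalSpace R₁] [T2Space R₁] [SecondCountableTopology R₁]
        [ChartedSpace ER₁ R₁] [IsManifold 𝓘(ℝ, ER₁) ∞ R₁]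
        (S₁ : PartialGStructure F₁ EP₀ A.rep₀ ER₁ R₁)
        (θ₁ : PartialForm (F₁.toField.lift (EQ := ER₁) S₁.proj) (LieAlg E G ⧸ A.p))
        (q₁ : Q₁ → R₁) (_ : IsUnderlying C₁ S₁ θ₁ q₁)
        {EM₂ : Type*} [NormedAddCommGroup EM₂] [NormedSpace ℝ EM₂] [FiniteDimensional ℝ EM₂]
        {M₂ : Type*} [TopologicalSpace M₂] [T2Space M₂] [SecondCountableTopology M₂]
        [ChartedSpace EM₂ M₂] [IsManifold 𝓘(ℝ, EM₂) ∞ M₂]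
        {F₂ : InvolutiveDistribution EM₂ M₂ (Module.finrank ℝ (LieAlg E G ⧸ A.p))}
        {EQ₂ : Type*} [NormedAddCommGroup EQ₂] [NormedSpace ℝ EQ₂] [FiniteDimensional ℝ EQ₂]
        {Q₂ : Type*} [TopologicalSpace Q₂] [T2Space Q₂] [SecondCountableTopology Q₂]
        [ChartedSpace EQ₂ Q₂] [IsManifold 𝓘(ℝ, EQ₂) ∞ Q₂]
        (C₂ : PartialCartanGeometry A EP F₂ EQ₂ Q₂)
        {ER₂ : Type*} [NormedAddCommGroup ER₂] [NormedSpace ℝ ER₂] [FiniteDimensional ℝ ER₂]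
        {R₂ : Type*} [TopologicalSpace R₂] [T2Space R₂] [SecondCountableTopology R₂]
        [ChartedSpace ER₂ R₂] [IsManifold 𝓘(ℝ, ER₂) ∞ R₂]
        (S₂ : PartialGStructure F₂ EP₀ A.rep₀ ER₂ R₂)
        (θ₂ : PartialForm (F₂.toField.lift (EQ := ER₂) S₂.proj) (LieAlg E G ⧸ A.p))
        (q₂ : Q₂ → R₂) (_ : IsUnderlying C₂ S₂ θ₂ q₂)
        (Φ : Q₁ → Q₂) (φ : M₁ → M₂), IsCartanMorphism C₁ C₂ Φ φ →
        ∃! Ψ : R₁ → R₂, (∀ u, Ψ (q₁ u) = q₂ (Φ u)) ∧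
          IsGStructureMorphism S₁ S₂ Ψ φ ∧ PullsBackTo Ψ θ₂.toFun θ₁.toFun) := by
  refine ⟨?_, ?_⟩
  · intro EM _ _ _ M _ _ _ _ _ F EQ _ _ _ Q _ _ _ _ _ C
    exact exists_isUnderlying_orbitSpace hP hG₀ C
  · intro EM₁ _ _ _ M₁ _ _ _ _ _ F₁ EQ₁ _ _ _ Q₁ _ _ _ _ _ C₁ ER₁ _ _ _ R₁ _ _ _ _ _ S₁ θ₁ q₁ h₁
      EM₂ _ _ _ M₂ _ _ _ _ _ F₂ EQ₂ _ _ _ Q₂ _ _ _ _ _ C₂ ER₂ _ _ _ R₂ _ _ _ _ _ S₂ θ₂ q₂ h₂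
      Φ φ hΦ
    exact hΦ.existsUnique_descends hG₀.contMDiff h₁ h₂
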